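/- **Conventions.** Manifolds, metrics, vector fields and functions are smooth ($C^\infty$). Let $(M,g)$ be a semi-Riemannian manifold with Levi-Civita connection $\nabla$, and let $TM=\mathcal V\oplus\mathcal H$ be a $g$-orthogonal splitting with $\mathcal H=\mathcal V^{\perp}$ of rank two; let $\pi:TM\to\mathcal H$ be the projection along $\mathcal V$. For a vector field $X$ with values in $\mathcal V$, the *shear operator* $\nabla^oX$ and the *twist operator* $\nabla^sX$ are the trace-free symmetric part and the skew-symmetric part of the operator $\pi\circ\nabla X|_{\mathcal H}:\mathcal H\to\mathcal H$, $v\mapsto\pi(\nabla_vX)$. $X$ is *shear-free* if $\nabla^oX=0$, and its *twist function* is $2\sqrt{\det\nabla^sX}$. For a unit vector field $X$ on a Riemannian $3$-manifold these notions are taken with $\mathcal V=\mathrm{span}(X)$. $X$ is *geodesic* if $\nabla_XX=0$. Let now $(M,g)$ be an oriented semi-Riemannian $4$-manifold with vector fields $k,t$ that are linearly independent at each point and such that $g$ is positive definite on $\mathcal H=\mathcal V^\perp$, where $\mathcal V=\mathrm{span}(k,t)$. Orient $\mathcal H$ so that $(x,y)$ is a positive basis of $\mathcal H$ iff $(k,t,x,y)$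 is a positive basis of $TM$. The almost complex structure $J=J_{g,k,t}$ is defined by $Jk=t$, $Jt=-k$ and by letting $J|_{\mathcal H}$ be the isometry of $(\mathcal H,g|_{\mathcal H})$ with square $-1$ that respects the orientation of $\mathcal H$. The oriented manifold $(M,g)$ with $(k,t)$ is *admissible* if 1. $[k,\Gamma(\mathcal H)]\subset\Gamma(\mathcal H)$, $[t,\Gamma(\mathcal H)]\subset\Gamma(\mathcal H)$ and $J\circ\nabla^ok=\nabla^ot$ on $\mathcal H$; 2. $t=\ell\,\nabla\tau$ for some $C^\infty$ functions $\tau,\ell$, where $\nabla\tau$ is the $g$-gradient; 3. the $g$-gradients of $g(k,t)$ and of $g(k,k)$ are sections of $\mathcal V$. With $k^\flat=g(k,\cdot)$ and a smooth function $f$ of one variable, put $g_K:=d(f(\tau)k^\flat)(\cdot,J_{g,k,t}\,\cdot)$. If $g_K$ is a Riemannian metric that is Kähler with respect to $J_{g,k,t}$ (that is, $J_{g,k,t}$ has vanishing Nijenhuis tensor, $g_K$ is $J_{g,k,t}$-invariant and the $2$-form $g_K(J_{g,k,t}\cdot,\cdot)$ is closed), it is called the Kähler metric *induced* by $g$ (with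 $k$, $t$, $\tau$ and $f$). **Theorem.** Let $(N,\bar g)$ be a Riemannian $3$-manifold with a unit length vector field $\bar k$ that is geodesic, shear-free, and has nowhere vanishing twist function. Let $w$ be a smooth positive function on $\mathbb R$ with $w'/w>-1$ everywhere. On $M=\mathbb R\times N$, with $t$ the coordinate of the first factor, let $$g:=-dt^2+w(t)^2\,\bar g,\qquad k:=\partial_t+\frac{1}{w(t)}\,\bar k,$$ where $\bar k$ also denotes the lift of $\bar k$ to $M$, and let $\nabla t$ be the $g$-gradient of the coordinate $t$. Then $g$ is a Lorentzian metric, and there is an orientation of $M$ with respect to which $(M,g)$ with the vector fields $(k,\nabla t)$ is admissible and $g$ induces, with $\tau=t$ and $f(\tau)=e^{\tau}$, a Kähler metric $$g_K=d(e^{t}k^\flat)(\cdot,J_{g,k,\nabla t}\,\cdot)$$ on all of $\mathbb R\times N$. -/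

import Mathlib

open scoped Manifold ContDiff Topology Bundle

noncomputable section

namespace LorentzKahler

/-! ## Linear algebra: shear, twist and complex structure of an orthogonal splitting -/

section LinearAlgebra

variable {T : Type*} [AddCommGroup T] [Module ℝ T]

/-- The projection of `T` onto `V^⊥` along `V`, for a symmetric bilinear form `b` and a subspace
`V` with `T = V^⊥ ⊕ V` (and `0` if the two subspaces are not complementary). -/
def orthProj (b : LinearMap.BilinForm ℝ T) (V : Submodule ℝ T) : T →ₗ[ℝ] b.orthogonal V := by
  classical
  exact if h : IsCompl (b.orthogonal V) V then (b.orthogonal V).projectionOnto V h else 0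

/-- The adjoint of an operator with respect to a nondegenerate symmetric bilinear form: the unique
`B'` with `b (B u) v = b u (B' v)` (and `0` if there is no adjoint). -/
def formAdjoint (b : LinearMap.BilinForm ℝ T) (B : T →ₗ[ℝ] T) : T →ₗ[ℝ] T := by
  classical
  exact if h : ∃ B' : T →ₗ[ℝ] T, LinearMap.IsAdjointPair b b B B' then h.choose else 0

/-- The operator `π ∘ A|_H` of `H = V^⊥`, where `π` is the projection onto `H` along `V`. -/
def horizontalPart (b : LinearMap.BilinForm ℝ T) (V : Submodule ℝ T) (A : T →ₗ[ℝ] T) :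
    b.orthogonal V →ₗ[ℝ] b.orthogonal V :=
  orthProj b V ∘ₗ A ∘ₗ (b.orthogonal V).subtype

/-- The trace-free symmetric part of `π ∘ A|_H`, `H = V^⊥`. -/
def shearPart (b : LinearMap.BilinForm ℝ T) (V : Submodule ℝ T) (A : T →ₗ[ℝ] T) :
    b.orthogonal V →ₗ[ℝ] b.orthogonal V :=
  let B := horizontalPart b V A
  (1 / 2 : ℝ) • (B + formAdjoint (b.restrict (b.orthogonal V)) B)
    - (LinearMap.trace ℝ (b.orthogonal V) B / (Module.finrank ℝ (b.orthogonal V) : ℝ)) •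
      LinearMap.id

/-- The skew-symmetric part of `π ∘ A|_H`, `H = V^⊥`. -/
def twistPart (b : LinearMap.BilinForm ℝ T) (V : Submodule ℝ T) (A : T →ₗ[ℝ] T) :
    b.orthogonal V →ₗ[ℝ] b.orthogonal V :=
  let B := horizontalPart b V A
  (1 / 2 : ℝ) • (B - formAdjoint (b.restrict (b.orthogonal V)) B)

end LinearAlgebra

/-- `J` is the endomorphism of the oriented four-dimensional space `T` with `J k = t`, `J t = -k`,
which on `H = span(k,t)^⊥` is an isometry with square `-1` respecting the orientation of `H`,
i.e. `(v, J v)` is a positive basis of `H` for each nonzero `v` in `H`. Here `H` is oriented so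
that a basis `(v, v')` of `H` is positive iff `(k, t, v, v')` is a positive basis of `T`. -/
structure IsSplitComplexStructure {T : Type*} [AddCommGroup T] [Module ℝ T] [TopologicalSpace T]
    (b : LinearMap.BilinForm ℝ T) (o : Orientation ℝ T (Fin 4)) (k t : T) (J : T →L[ℝ] T) :
    Prop where
  map_k : J k = t
  map_t : J t = -k
  map_mem : ∀ v ∈ b.orthogonal (Submodule.span ℝ {k, t}),
    J v ∈ b.orthogonal (Submodule.span ℝ {k, t})
  sq : ∀ v ∈ b.orthogonal (Submodule.span ℝ {k, t}), J (J v) = -v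
  isometry : ∀ v ∈ b.orthogonal (Submodule.span ℝ {k, t}),
    ∀ v' ∈ b.orthogonal (Submodule.span ℝ {k, t}), b (J v) (J v') = b v v'
  oriented : ∀ v ∈ b.orthogonal (Submodule.span ℝ {k, t}), v ≠ 0 →
    ∃ e : Module.Basis (Fin 4) ℝ T, ⇑e = ![k, t, v, J v] ∧ e.orientation = o

/-- The endomorphism described by `IsSplitComplexStructure` (which is unique; `0` if there is
none). -/
def splitComplexStructure {T : Type*} [AddCommGroup T] [Module ℝ T] [TopologicalSpace T]
    (b : LinearMap.BilinForm ℝ T) (o : Orientation ℝ T (Fin 4)) (k t : T) : T →L[ℝ] T := by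
  classical
  exact if h : ∃ J : T →L[ℝ] T, IsSplitComplexStructure b o k t J then h.choose else 0

/-! ## Semi-Riemannian geometry -/

section Geometry

variable {E : Type*} [NormedAddCommGroup E] [NormedSpace ℝ E]
  {H : Type*} [TopologicalSpace H] (I : ModelWithCorners ℝ E H)
  {M : Type*} [TopologicalSpace M] [ChartedSpace H M]

/-- Vector fields (not necessarily smooth). -/
abbrev VField (I : ModelWithCorners ℝ E H) (M : Type*) [TopologicalSpace M] [ChartedSpace H M] :=
  (x : M) → TangentSpace I x

/-- Fields of covariant 2-tensors (not necessarily smooth). -/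
abbrev TwoTensor (I : ModelWithCorners ℝ E H) (M : Type*) [TopologicalSpace M]
    [ChartedSpace H M] :=
  (x : M) → TangentSpace I x →L[ℝ] TangentSpace I x →L[ℝ] ℝ

/-- Fields of covectors (not necessarily smooth). -/
abbrev OneForm (I : ModelWithCorners ℝ E H) (M : Type*) [TopologicalSpace M] [ChartedSpace H M] :=
  (x : M) → TangentSpace I x →L[ℝ] ℝ

/-- Fields of endomorphisms of the tangent spaces (not necessarily smooth). -/
abbrev EndField (I : ModelWithCorners ℝ E H) (M : Type*) [TopologicalSpace M]
    [ChartedSpace H M] :=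
  (x : M) → TangentSpace I x →L[ℝ] TangentSpace I x

variable {I}

/-- The vector field `X` is smooth at `x`. -/
def VField.SmoothAt [IsManifold I 1 M] (X : VField I M) (x : M) : Prop :=
  ContMDiffAt I I.tangent ∞ (fun y ↦ (⟨y, X y⟩ : TangentBundle I M)) x

/-- `g` is a (smooth) semi-Riemannian metric of index `ν`. -/
structure IsSemiRiemannianMetric [IsManifold I 1 M] (g : TwoTensor I M) (ν : ℕ) : Prop where
  smooth : ContMDiff I (I.prod 𝓘(ℝ, E →L[ℝ] E →L[ℝ] ℝ)) ∞
    (fun x ↦ Bundle.TotalSpace.mk' (E →L[ℝ] E →L[ℝ] ℝ)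
      (E := fun x : M ↦ TangentSpace I x →L[ℝ] TangentSpace I x →L[ℝ] ℝ) x (g x))
  symm : ∀ x u v, g x u v = g x v u
  nondegenerate : ∀ x u, (∀ v, g x u v = 0) → u = 0
  index : ∀ x, IsGreatest {n : ℕ | ∃ W : Submodule ℝ (TangentSpace I x),
    Module.finrank ℝ W = n ∧ ∀ v ∈ W, v ≠ 0 → g x v v < 0} ν

/-- A Lorentzian metric is a semi-Riemannian metric of index one. -/
def IsLorentzianMetric [IsManifold I 1 M] (g : TwoTensor I M) : Prop :=
  IsSemiRiemannianMetric g 1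

/-- The gradient of a function: `g(∇τ, v) = dτ(v)` for each `v`. -/
def grad (g : TwoTensor I M) (τ : M → ℝ) : VField I M := fun x ↦ by
  classical
  exact if h : ∃ u : TangentSpace I x, ∀ v, g x u v = mvfderiv I τ x v then h.choose else 0

/-- The directional derivative `X(φ)` at `x`. -/
def dirDeriv (X : VField I M) (φ : M → ℝ) (x : M) : ℝ := mvfderiv I φ x (X x)

/-- The right-hand side of the Koszul formula for `2 g(∇_X Y, Z)`. -/
def koszul (g : TwoTensor I M) (X Y Z : VField I M) (x : M) : ℝ :=
  dirDeriv X (fun y ↦ g y (Y y) (Z y)) x + dirDeriv Y (fun y ↦ g y (Z y) (X y)) x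
    - dirDeriv Z (fun y ↦ g y (X y) (Y y)) x
    + g x (VectorField.mlieBracket I X Y x) (Z x)
    - g x (VectorField.mlieBracket I X Z x) (Y x)
    - g x (VectorField.mlieBracket I Y Z x) (X x)

variable [IsManifold I 1 M]

/-- The Levi-Civita connection of `g`: the linear operator `v ↦ ∇_v Y` on the tangent space at `x`,
given by the Koszul formula. The right-hand side of the formula is tensorial in `X` and `Z`, so
the choice of the extensions of the two tangent vectors is immaterial. -/
def leviCivita (g : TwoTensor I M) (Y : VField I M) (x : M) :
    TangentSpace I x →ₗ[ℝ] TangentSpace I x := by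
  classical
  exact if h : ∃ L : TangentSpace I x →ₗ[ℝ] TangentSpace I x, ∀ v z : TangentSpace I x,
      2 * g x (L v) z = koszul g (FiberBundle.extend E v) Y (FiberBundle.extend E z) x
    then h.choose else 0

/-- The vector field `X` is geodesic: `∇_X X = 0`. -/
def IsGeodesic (g : TwoTensor I M) (X : VField I M) : Prop :=
  ∀ x, leviCivita g X x (X x) = 0

/-- The relative shear operator of `X` at `x`, an operator of `H = V^⊥`. -/
def shear (g : TwoTensor I M) (V : (x : M) → Submodule ℝ (TangentSpace I x)) (X : VField I M)
    (x : M) : (g x).toBilinForm.orthogonal (V x) →ₗ[ℝ] (g x).toBilinForm.orthogonal (V x) :=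
  shearPart (g x).toBilinForm (V x) (leviCivita g X x)

/-- The relative twist operator of `X` at `x`, an operator of `H = V^⊥`. -/
def twist (g : TwoTensor I M) (V : (x : M) → Submodule ℝ (TangentSpace I x)) (X : VField I M)
    (x : M) : (g x).toBilinForm.orthogonal (V x) →ₗ[ℝ] (g x).toBilinForm.orthogonal (V x) :=
  twistPart (g x).toBilinForm (V x) (leviCivita g X x)

/-- The twist function `2 √(det ∇ˢX)`. -/
def twistFunction (g : TwoTensor I M) (V : (x : M) → Submodule ℝ (TangentSpace I x))
    (X : VField I M) (x : M) : ℝ :=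
  2 * Real.sqrt (LinearMap.det (twist g V X x))

/-- The line field spanned by one vector field. -/
def lineSpan (X : VField I M) (x : M) : Submodule ℝ (TangentSpace I x) := Submodule.span ℝ {X x}

/-- The distribution spanned by two vector fields. -/
def pairSpan (X Y : VField I M) (x : M) : Submodule ℝ (TangentSpace I x) :=
  Submodule.span ℝ {X x, Y x}

/-! ## Exterior derivative, complex structures, Kähler metrics -/

/-- The exterior derivative of a 1-form, by the invariant formula
`dα(X,Y) = X(α(Y)) - Y(α(X)) - α([X,Y])`, which is tensorial in `X` and `Y`. -/
def extDerivOne (α : OneForm I M) (x : M) (u v : TangentSpace I x) : ℝ :=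
  let X : VField I M := FiberBundle.extend E u
  let Y : VField I M := FiberBundle.extend E v
  dirDeriv X (fun y ↦ α y (Y y)) x - dirDeriv Y (fun y ↦ α y (X y)) x
    - α x (VectorField.mlieBracket I X Y x)

/-- The 2-form `Ω` is closed, by the invariant formula for `dΩ(X,Y,Z)`. -/
def IsClosedTwoForm (Ω : TwoTensor I M) : Prop :=
  ∀ (x : M) (X Y Z : VField I M), X.SmoothAt x → Y.SmoothAt x → Z.SmoothAt x →
    dirDeriv X (fun y ↦ Ω y (Y y) (Z y)) x - dirDeriv Y (fun y ↦ Ω y (X y) (Z y)) x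
      + dirDeriv Z (fun y ↦ Ω y (X y) (Y y)) x
      - Ω x (VectorField.mlieBracket I X Y x) (Z x)
      + Ω x (VectorField.mlieBracket I X Z x) (Y x)
      - Ω x (VectorField.mlieBracket I Y Z x) (X x) = 0

/-- The Nijenhuis tensor `N(X,Y) = [JX,JY] - J[JX,Y] - J[X,JY] - [X,Y]`. -/
def nijenhuis (J : EndField I M) (X Y : VField I M) : VField I M := fun x ↦
  VectorField.mlieBracket I (fun y ↦ J y (X y)) (fun y ↦ J y (Y y)) x
    - J x (VectorField.mlieBracket I (fun y ↦ J y (X y)) Y x)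
    - J x (VectorField.mlieBracket I X (fun y ↦ J y (Y y)) x)
    - VectorField.mlieBracket I X Y x

/-- `J` is an integrable almost complex structure: smooth, `J² = -1`, `N = 0`. -/
structure IsComplexStructure (J : EndField I M) : Prop where
  smooth : ContMDiff I (I.prod 𝓘(ℝ, E →L[ℝ] E)) ∞
    (fun x ↦ Bundle.TotalSpace.mk' (E →L[ℝ] E)
      (E := fun x : M ↦ TangentSpace I x →L[ℝ] TangentSpace I x) x (J x))
  sq : ∀ x v, J x (J x v) = -v
  integrable : ∀ (x : M) (X Y : VField I M), X.SmoothAt x → Y.SmoothAt x → nijenhuis J X Y x = 0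

/-- The Riemannian metric `h` is Kähler with respect to `J`: `J` is an integrable complex
structure, `h` is Hermitian, and the 2-form `h(J·,·)` is closed. -/
structure IsKahlerMetric
    (h : Bundle.ContMDiffRiemannianMetric I ∞ E (fun x : M ↦ TangentSpace I x))
    (J : EndField I M) : Prop where
  complex : IsComplexStructure J
  hermitian : ∀ x u v, h.inner x (J x u) (J x v) = h.inner x u v
  closed : IsClosedTwoForm (fun x ↦ (h.inner x).comp (J x))

/-! ## Orientations and admissible manifolds -/

/-- An orientation of a 4-manifold: a choice of orientations of the tangent spaces such that each
point has a neighbourhood with a positively oriented smooth frame. -/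
structure ManifoldOrientation (I : ModelWithCorners ℝ E H) (M : Type*) [TopologicalSpace M]
    [ChartedSpace H M] [IsManifold I 1 M] where
  orient : (x : M) → Orientation ℝ (TangentSpace I x) (Fin 4)
  exists_frame : ∀ x₀ : M, ∃ X : Fin 4 → VField I M, (∀ i, (X i).SmoothAt x₀) ∧
    ∀ᶠ x in 𝓝 x₀, ∃ e : Module.Basis (Fin 4) ℝ (TangentSpace I x),
      (∀ i, e i = X i x) ∧ e.orientation = orient x

/-- The almost complex structure `J_{g,k,t}`. -/
def almostComplex (g : TwoTensor I M) (o : ManifoldOrientation I M) (k t : VField I M) :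
    EndField I M := fun x ↦
  splitComplexStructure (g x).toBilinForm (o.orient x) (k x) (t x)

/-- Conditions under which `J_{g,k,t}` is an admissible complex structure. -/
structure IsAdmissibleComplexStructure (g : TwoTensor I M) (o : ManifoldOrientation I M)
    (k t : VField I M) : Prop where
  linearIndependent : ∀ x, LinearIndependent ℝ ![k x, t x]
  spacelike : ∀ x, ∀ v ∈ (g x).toBilinForm.orthogonal (pairSpan k t x), v ≠ 0 → 0 < g x v v
  bracket : ∀ (x : M) (X : VField I M), X.SmoothAt x →
    (∀ᶠ y in 𝓝 x, X y ∈ (g y).toBilinForm.orthogonal (pairSpan k t y)) →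
    VectorField.mlieBracket I k X x ∈ (g x).toBilinForm.orthogonal (pairSpan k t x) ∧
    VectorField.mlieBracket I t X x ∈ (g x).toBilinForm.orthogonal (pairSpan k t x)
  shear_eq : ∀ (x : M) (v : (g x).toBilinForm.orthogonal (pairSpan k t x)),
    almostComplex g o k t x (shear g (pairSpan k t) k x v : TangentSpace I x) =
      (shear g (pairSpan k t) t x v : TangentSpace I x)

/-- The oriented semi-Riemannian manifold `(M,g)` with the vector fields `k`, `t` is admissible. -/
structure IsAdmissible (g : TwoTensor I M) (o : ManifoldOrientation I M) (k t : VField I M) :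
    Prop where
  finrank_eq : Module.finrank ℝ E = 4
  metric : ∃ ν : ℕ, IsSemiRiemannianMetric g ν
  smooth_k : ∀ x, k.SmoothAt x
  smooth_t : ∀ x, t.SmoothAt x
  complex : IsAdmissibleComplexStructure g o k t
  gradient : ∃ τ ℓ : M → ℝ, ContMDiff I 𝓘(ℝ, ℝ) ∞ τ ∧ ContMDiff I 𝓘(ℝ, ℝ) ∞ ℓ ∧
    ∀ x, t x = ℓ x • grad g τ x
  grad_kt : ∀ x, grad g (fun y ↦ g y (k y) (t y)) x ∈ pairSpan k t x
  grad_kk : ∀ x, grad g (fun y ↦ g y (k y) (k y)) x ∈ pairSpan k t x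

/-- `h = ω(·, J_{g,k,t}·)` with `ω = d(f(τ) k^♭)`, and `h` is a Kähler metric for `J_{g,k,t}`:
the metric `h` is the Kähler metric induced by `g`, `k`, `t` and the functions `τ` and `f`. -/
def IsInducedKahlerMetric (g : TwoTensor I M) (o : ManifoldOrientation I M) (k t : VField I M)
    (τ : M → ℝ) (f : ℝ → ℝ)
    (h : Bundle.ContMDiffRiemannianMetric I ∞ E (fun x : M ↦ TangentSpace I x)) : Prop :=
  (∀ x u v, h.inner x u v =
    extDerivOne (fun y ↦ f (τ y) • g y (k y)) x u (almostComplex g o k t x v)) ∧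
  IsKahlerMetric h (almostComplex g o k t)

end Geometry

/-! ## Warped products over the line -/

section Warped

variable {E : Type*} [NormedAddCommGroup E] [NormedSpace ℝ E]
  {H : Type*} [TopologicalSpace H] {I : ModelWithCorners ℝ E H}
  {N : Type*} [TopologicalSpace N] [ChartedSpace H N]

/-- The pullback `b (A u) (A v)` of a bilinear form under a linear map. -/
def pullbackForm {T T' : Type*} [AddCommGroup T] [Module ℝ T] [TopologicalSpace T]
    [IsTopologicalAddGroup T] [ContinuousSMul ℝ T] [AddCommGroup T'] [Module ℝ T']
    [TopologicalSpace T'] [IsTopologicalAddGroup T'] [ContinuousSMul ℝ T']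
    (b : T' →L[ℝ] T' →L[ℝ] ℝ) (A : T →L[ℝ] T') : T →L[ℝ] T →L[ℝ] ℝ :=
  (ContinuousLinearMap.precomp ℝ A).comp (b.comp A)

/-- The tensor `-dt² + w² gN` on `ℝ × N`. -/
def warpedMetric (w : ℝ → ℝ) (gN : TwoTensor I N) :
    TwoTensor (𝓘(ℝ, ℝ).prod I) (ℝ × N) := fun p ↦
  -(pullbackForm (ContinuousLinearMap.mul ℝ ℝ)
      (mvfderiv (𝓘(ℝ, ℝ).prod I) (Prod.fst : ℝ × N → ℝ) p))
    + (w p.1) ^ 2 • pullbackForm (gN p.2)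
      (mfderiv (𝓘(ℝ, ℝ).prod I) I (Prod.snd : ℝ × N → N) p)

/-- The vector field `∂_t` on `ℝ × N`. -/
def timeField : VField (𝓘(ℝ, ℝ).prod I) (ℝ × N) := fun p ↦
  mfderiv 𝓘(ℝ, ℝ) (𝓘(ℝ, ℝ).prod I) (fun s : ℝ ↦ (s, p.2)) p.1 (1 : ℝ)

/-- The lift to `ℝ × N` of a vector field on `N`. -/
def liftField (X : VField I N) : VField (𝓘(ℝ, ℝ).prod I) (ℝ × N) := fun p ↦
  mfderiv I (𝓘(ℝ, ℝ).prod I) (fun q : N ↦ (p.1, q)) p.2 (X p.2)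

end Warped

end LorentzKahler

end

noncomputable section

set_option linter.unusedSectionVars false

/-! Write `α` for the pullback of `kN^♭` to `ℝ × N`. The gradient of `t` is `-∂_t`, the field `k` is
null, and `g(k, ∇t) = 1`. The forms `A = w α` and `B = w α - dt` are the coordinates along `k` and
`-∂_t`, and `H` is the part of the slices `{t} × N` orthogonal to `kN`.

The hypotheses on `kN` enter only through the identity `2 g(∇_u Y, v) = dY^♭(u, v) + (L_Y g)(u, v)`
(`leviCivita_spec`). By it, geodesic plus unit length gives `dα(kN, ·) = 0`, twisting says that `dα`
does not vanish on `H`, and shear-free says that the flow of `kN` is conformal on `H`. These facts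
form `IsTwistingField`. The orientation of `ℝ × N` is chosen so that `dα` is positive on oriented
bases of `H`.

Integrability: `k` and `-∂_t` both have the form `a ∂_t + φ(t) kN`. The flow of such a field
preserves `H` (`mlieBracket_mem`) and is conformal on it (`exists_lieForm_eq`). In an oriented
orthonormal frame of `H` this means `[Z, e₂] = J [Z, e₁]` for both fields (`mlieBracket_frame`), so
the Nijenhuis tensor vanishes on `(k, e₁)`. In real dimension four its `J`-antilinearity and
skewness make it vanish everywhere (`nijenhuis_eq_zero`). Conformality also makes both shears
vanish, so the shear condition of admissibility reads `0 = 0`.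

Metric: since `k^♭ = w α - dt`, one finds `d(e^t k^♭) = e^t (1 + w'/w) A ∧ B + e^t w dα`
(`extDerivOne_exp_smul`). Inserting `J` in the second slot turns `A ∧ B` into `A² + B²` and `dα`
into a positive multiple of the metric of `H` (`extDerivOne_almostComplex`). The result is positive
definite because `w'/w > -1`. The Kähler form is exact, hence closed (`isClosedTwoForm_extDeriv`).
-/

namespace LorentzKahler

/-! ### Differentiability of vector fields and derivatives of functions along them -/

section Calculus

variable {E : Type*} [NormedAddCommGroup E] [NormedSpace ℝ E]
  {H : Type*} [TopologicalSpace H] {I : ModelWithCorners ℝ E H}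
  {M : Type*} [TopologicalSpace M] [ChartedSpace H M] [IsManifold I ∞ M]

/-- The vector field `X` is differentiable at `x`. -/
abbrev VField.DiffAt (X : VField I M) (x : M) : Prop :=
  MDifferentiableAt I I.tangent (fun y ↦ (⟨y, X y⟩ : TangentBundle I M)) x

/-- The vector field `X` is of class `C^n` at `x`. -/
abbrev VField.ContAt (n : ℕ∞) (X : VField I M) (x : M) : Prop :=
  ContMDiffAt I I.tangent n (fun y ↦ (⟨y, X y⟩ : TangentBundle I M)) x

/-- The 1-form `α` is smooth: it maps vector fields of class `C^n` to functions of class `C^n`. -/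
structure OneForm.Smooth (α : OneForm I M) : Prop where
  contMDiffAt : ∀ {n : ℕ∞} {x : M} {X : VField I M}, X.ContAt n x →
    ContMDiffAt I 𝓘(ℝ, ℝ) n (fun y ↦ α y (X y)) x
  mdifferentiableAt : ∀ {x : M} {X : VField I M}, X.DiffAt x →
    MDifferentiableAt I 𝓘(ℝ, ℝ) (fun y ↦ α y (X y)) x

/-- The field of bilinear forms `g` is smooth: it maps pairs of vector fields of class `C^n` to
functions of class `C^n`. -/
structure TwoTensor.Smooth (g : TwoTensor I M) : Prop where
  contMDiffAt : ∀ {n : ℕ∞} {x : M} {X Y : VField I M}, X.ContAt n x → Y.ContAt n x →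
    ContMDiffAt I 𝓘(ℝ, ℝ) n (fun y ↦ g y (X y) (Y y)) x
  mdifferentiableAt : ∀ {x : M} {X Y : VField I M}, X.DiffAt x → Y.DiffAt x →
    MDifferentiableAt I 𝓘(ℝ, ℝ) (fun y ↦ g y (X y) (Y y)) x

lemma VField.ContAt.of_le {m n : ℕ∞} {X : VField I M} {x : M} (h : X.ContAt n x) (hmn : m ≤ n) :
    X.ContAt m x :=
  ContMDiffAt.of_le h (by exact_mod_cast hmn)

lemma VField.ContAt.diffAt {n : ℕ∞} {X : VField I M} {x : M} (h : X.ContAt n x) (hn : n ≠ 0) :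
    X.DiffAt x :=
  ContMDiffAt.mdifferentiableAt h (by exact_mod_cast hn)

lemma VField.SmoothAt.contAt {X : VField I M} {x : M} (h : X.SmoothAt x) : X.ContAt ⊤ x := h

lemma VField.SmoothAt.diffAt {X : VField I M} {x : M} (h : X.SmoothAt x) : X.DiffAt x :=
  h.contAt.diffAt (by simp)

lemma VField.ContAt.eventually {n : ℕ∞} {X : VField I M} {x : M} (h : X.ContAt n x)
    (hn : n ≠ ⊤) : ∀ᶠ y in 𝓝 x, X.ContAt n y :=
  (contMDiffAt_iff_contMDiffAt_nhds (by exact_mod_cast hn)).1 h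

lemma VField.SmoothAt.eventually_diffAt {X : VField I M} {x : M} (h : X.SmoothAt x) :
    ∀ᶠ y in 𝓝 x, X.DiffAt y := by
  filter_upwards [(h.contAt.of_le (m := 1) le_top).eventually (by simp)] with y hy
  exact hy.diffAt (by simp)

lemma VField.smoothAt_extend {x : M} (v : TangentSpace I x) :
    VField.SmoothAt (I := I) (FiberBundle.extend E v) x :=
  FiberBundle.contMDiffAt_extend (k := ∞) I E v

lemma VField.diffAt_extend {x : M} (v : TangentSpace I x) :
    VField.DiffAt (I := I) (FiberBundle.extend E v) x :=
  (VField.smoothAt_extend v).diffAt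

section Arithmetic

variable {x : M} {X Y : VField I M} {f : M → ℝ} {n : ℕ∞}

lemma VField.DiffAt.add (hX : X.DiffAt x) (hY : Y.DiffAt x) : VField.DiffAt (X + Y) x :=
  mdifferentiableAt_add_section hX hY

lemma VField.DiffAt.neg (hX : X.DiffAt x) : VField.DiffAt (-X) x :=
  mdifferentiableAt_neg_section hX

lemma VField.DiffAt.smul (hf : MDifferentiableAt I 𝓘(ℝ, ℝ) f x) (hX : X.DiffAt x) :
    VField.DiffAt (f • X) x :=
  MDifferentiableAt.smul_section hf hX

lemma VField.ContAt.add (hX : X.ContAt n x) (hY : Y.ContAt n x) : VField.ContAt n (X + Y) x :=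
  ContMDiffAt.add_section hX hY

lemma VField.ContAt.neg (hX : X.ContAt n x) : VField.ContAt n (-X) x :=
  ContMDiffAt.neg_section hX

lemma VField.ContAt.sub (hX : X.ContAt n x) (hY : Y.ContAt n x) : VField.ContAt n (X - Y) x :=
  ContMDiffAt.sub_section hX hY

lemma VField.ContAt.smul (hf : ContMDiffAt I 𝓘(ℝ, ℝ) n f x) (hX : X.ContAt n x) :
    VField.ContAt n (f • X) x :=
  ContMDiffAt.smul_section hf hX

lemma VField.ContAt.mlieBracket [CompleteSpace E] {m : ℕ∞} (hX : X.ContAt n x)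
    (hY : Y.ContAt n x) (h : m + 1 ≤ n) :
    VField.ContAt m (VectorField.mlieBracket I X Y) x := by
  have : IsManifold I (minSmoothness ℝ 2) M := by
    rw [minSmoothness_of_isRCLikeNormedField]; infer_instance
  have : IsManifold I ((n : ℕ∞ω) + 1) M := by
    refine IsManifold.of_le (n := ∞) ?_
    exact_mod_cast (le_top : n + 1 ≤ ⊤)
  refine ContMDiffAt.mlieBracket_vectorField (n := n) hX hY ?_
  simp only [minSmoothness_of_isRCLikeNormedField]
  exact_mod_cast h

end Arithmetic

section DirDeriv

variable {x : M} {X Y : VField I M} {f h : M → ℝ}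

lemma dirDeriv_congr {f h : M → ℝ} (e : f =ᶠ[𝓝 x] h) : dirDeriv X f x = dirDeriv X h x := by
  simp only [dirDeriv, mvfderiv]
  change (mfderiv I 𝓘(ℝ, ℝ) f x : E →L[ℝ] ℝ) (X x) = (mfderiv I 𝓘(ℝ, ℝ) h x : E →L[ℝ] ℝ) (X x)
  rw [e.mfderiv_eq]
  rfl

lemma dirDeriv_add (hf : MDifferentiableAt I 𝓘(ℝ, ℝ) f x) (hh : MDifferentiableAt I 𝓘(ℝ, ℝ) h x) :
    dirDeriv X (fun y ↦ f y + h y) x = dirDeriv X f x + dirDeriv X h x := by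
  have := mvfderiv_add hf hh
  simp only [dirDeriv]
  exact congrArg (· (X x)) this

lemma dirDeriv_sub (hf : MDifferentiableAt I 𝓘(ℝ, ℝ) f x) (hh : MDifferentiableAt I 𝓘(ℝ, ℝ) h x) :
    dirDeriv X (fun y ↦ f y - h y) x = dirDeriv X f x - dirDeriv X h x := by
  have := mvfderiv_sub hf hh
  exact congrArg (· (X x)) this

lemma dirDeriv_mul (hf : MDifferentiableAt I 𝓘(ℝ, ℝ) f x) (hh : MDifferentiableAt I 𝓘(ℝ, ℝ) h x) :
    dirDeriv X (fun y ↦ f y * h y) x = f x * dirDeriv X h x + h x * dirDeriv X f x := by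
  have := mvfderiv_mul hf hh
  exact congrArg (· (X x)) this

lemma dirDeriv_const (c : ℝ) : dirDeriv X (fun _ ↦ c) x = 0 := by
  have := mvfderiv_const (I := I) (M := M) (𝕜 := ℝ) c (x := x)
  exact congrArg (· (X x)) this

lemma dirDeriv_add_field : dirDeriv (X + Y) f x = dirDeriv X f x + dirDeriv Y f x := by
  simp [dirDeriv]

lemma dirDeriv_smul_field : dirDeriv (h • X) f x = h x * dirDeriv X f x := by
  simp [dirDeriv]

lemma contMDiffAt_dirDeriv {m n : ℕ∞} (hX : X.ContAt m x) (hf : ContMDiffAt I 𝓘(ℝ, ℝ) n f x)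
    (h : m + 1 ≤ n) : ContMDiffAt I 𝓘(ℝ, ℝ) m (dirDeriv X f) x := by
  have h1 := ContMDiffAt.mfderiv_const (m := m) hf (by exact_mod_cast h)
  have h2 := ContMDiffAt.clm_apply_of_inCoordinates (b₁ := id) (b₂ := f) h1 hX
    (hf.of_le (by exact_mod_cast le_trans le_self_add h))
  have h3 := (contMDiff_snd_tangentBundle_modelSpace ℝ 𝓘(ℝ, ℝ) (n := m)).contMDiffAt.comp x h2
  exact h3

end DirDeriv

end Calculus

/-! ### Lie brackets: Leibniz rules and the commutator formula -/

section Tensors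

open VectorField

variable {E : Type*} [NormedAddCommGroup E] [NormedSpace ℝ E] [FiniteDimensional ℝ E]
  {H : Type*} [TopologicalSpace H] {I : ModelWithCorners ℝ E H}
  {M : Type*} [TopologicalSpace M] [ChartedSpace H M] [IsManifold I ∞ M]
  {x : M} {X Y Z : VField I M} {f : M → ℝ}

section Bracket

lemma mlieBracket_smul_right' (hf : MDifferentiableAt I 𝓘(ℝ, ℝ) f x) (hY : Y.DiffAt x) :
    mlieBracket I X (f • Y) x = dirDeriv X f x • Y x + f x • mlieBracket I X Y x := by
  have : CompleteSpace E := FiniteDimensional.complete ℝ E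
  exact mlieBracket_smul_right hf hY

lemma mlieBracket_smul_left' (hf : MDifferentiableAt I 𝓘(ℝ, ℝ) f x) (hX : X.DiffAt x) :
    mlieBracket I (f • X) Y x = - dirDeriv Y f x • X x + f x • mlieBracket I X Y x := by
  have : CompleteSpace E := FiniteDimensional.complete ℝ E
  exact mlieBracket_smul_left hf hX

lemma mlieBracket_add_right' (hX : X.DiffAt x) (hY : Y.DiffAt x) :
    mlieBracket I Z (X + Y) x = mlieBracket I Z X x + mlieBracket I Z Y x := by
  have : CompleteSpace E := FiniteDimensional.complete ℝ E
  exact mlieBracket_add_right (V := Z) hX hY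

lemma mlieBracket_add_left' (hX : X.DiffAt x) (hY : Y.DiffAt x) :
    mlieBracket I (X + Y) Z x = mlieBracket I X Z x + mlieBracket I Y Z x := by
  have : CompleteSpace E := FiniteDimensional.complete ℝ E
  exact mlieBracket_add_left (W := Z) hX hY

lemma mlieBracket_neg_left (hX : X.DiffAt x) :
    mlieBracket I (-X) Y x = - mlieBracket I X Y x := by
  have : CompleteSpace E := FiniteDimensional.complete ℝ E
  have := mlieBracket_const_smul_left (c := (-1 : ℝ)) (W := Y) hX
  simpa using this

lemma jacobi_identity (hX : X.ContAt 2 x) (hY : Y.ContAt 2 x) (hZ : Z.ContAt 2 x) :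
    mlieBracket I X (mlieBracket I Y Z) x =
      mlieBracket I (mlieBracket I X Y) Z x + mlieBracket I Y (mlieBracket I X Z) x := by
  have : CompleteSpace E := FiniteDimensional.complete ℝ E
  have : IsManifold I (minSmoothness ℝ 3) M := by
    rw [minSmoothness_of_isRCLikeNormedField]; infer_instance
  apply leibniz_identity_mlieBracket_apply <;> rw [minSmoothness_of_isRCLikeNormedField] <;>
    assumption

/-- The Lie bracket of vector fields is the commutator of derivations. -/
lemma dirDeriv_mlieBracket (hX : X.ContAt 2 x) (hY : Y.ContAt 2 x)
    (hf : ContMDiffAt I 𝓘(ℝ, ℝ) 2 f x) :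
    dirDeriv (mlieBracket I X Y) f x
      = dirDeriv X (dirDeriv Y f) x - dirDeriv Y (dirDeriv X f) x := by
  have : CompleteSpace E := FiniteDimensional.complete ℝ E
  -- The argument compares coefficients of a vector field that is nonzero at `x`, so the
  -- zero-dimensional case is split off.
  rcases subsingleton_or_nontrivial E with hE | hE
  · have h (V : VField I M) : V x = 0 := Subsingleton.elim (α := E) _ _
    simp [dirDeriv, h]
  have : Nontrivial (TangentSpace I x) := inferInstanceAs (Nontrivial E)
  obtain ⟨v, hv⟩ := exists_ne (0 : TangentSpace I x)
  set Z : VField I M := FiberBundle.extend E v with hZdef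
  have hZx : Z x = v := FiberBundle.extend_apply_self ..
  have hZ : Z.ContAt 2 x := (VField.smoothAt_extend v).contAt.of_le le_top
  have hf1 : ∀ᶠ y in 𝓝 x, MDifferentiableAt I 𝓘(ℝ, ℝ) f y := by
    filter_upwards [(contMDiffAt_iff_contMDiffAt_nhds (by decide)).1 hf] with y hy
    exact hy.mdifferentiableAt (by simp)
  have hZ1 : ∀ᶠ y in 𝓝 x, Z.DiffAt y := (VField.smoothAt_extend v).eventually_diffAt
  -- Jacobi for `X`, `Y`, `f Z` is expanded by the Leibniz rule. The terms with undifferentiated `f`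
  -- cancel by Jacobi for `X`, `Y`, `Z` and the mixed first-order terms cancel in pairs, which
  -- leaves `([X,Y]f - XYf + YXf) Z = 0` at `x`.
  have key := jacobi_identity hX hY (hZ.smul hf)
  have e (V : VField I M) : mlieBracket I V (f • Z)
      =ᶠ[𝓝 x] dirDeriv V f • Z + f • mlieBracket I V Z := by
    filter_upwards [hf1, hZ1] with y h1 h2
    exact mlieBracket_smul_right' h1 h2
  have hd {V : VField I M} (hV : V.ContAt 2 x) :
      MDifferentiableAt I 𝓘(ℝ, ℝ) (dirDeriv V f) x :=
    (contMDiffAt_dirDeriv (m := 1) (hV.of_le (by norm_num)) hf (by norm_num)).mdifferentiableAt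
      (by simp)
  have hb {V W : VField I M} (hV : V.ContAt 2 x) (hW : W.ContAt 2 x) :
      VField.DiffAt (mlieBracket I V W) x :=
    (hV.mlieBracket (m := 1) hW (by norm_num)).diffAt (by simp)
  have hfx := hf1.self_of_nhds
  have hZd := hZ1.self_of_nhds
  rw [Filter.EventuallyEq.mlieBracket_vectorField_eq (Filter.EventuallyEq.refl _ X) (e Y),
    Filter.EventuallyEq.mlieBracket_vectorField_eq (Filter.EventuallyEq.refl _ Y) (e X),
    mlieBracket_add_right' ((hZd.smul (hd hY))) ((hb hY hZ).smul hfx),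
    mlieBracket_add_right' ((hZd.smul (hd hX))) ((hb hX hZ).smul hfx),
    mlieBracket_smul_right' (hd hY) hZd, mlieBracket_smul_right' (hd hX) hZd,
    mlieBracket_smul_right' hfx hZd, mlieBracket_smul_right' hfx (hb hY hZ),
    mlieBracket_smul_right' hfx (hb hX hZ), jacobi_identity hX hY hZ, hZx] at key
  have h2 : (dirDeriv (mlieBracket I X Y) f x
      - (dirDeriv X (dirDeriv Y f) x - dirDeriv Y (dirDeriv X f) x)) • v = 0 := by
    rw [← sub_eq_zero] at key
    rw [← neg_eq_zero, ← key]
    module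
  rcases smul_eq_zero.1 h2 with h | h
  · linarith
  · exact absurd h hv

end Bracket

/-! ### Exterior derivative of 1-forms and `d² = 0` -/

section ExteriorDerivative

variable {α β : OneForm I M}

/-- The formula for `dα(X, Y)`. -/
def extDerivAux (α : OneForm I M) (x : M) (X Y : VField I M) : ℝ :=
  dirDeriv X (fun y ↦ α y (Y y)) x - dirDeriv Y (fun y ↦ α y (X y)) x - α x (mlieBracket I X Y x)

lemma extDerivAux_swap (X Y : VField I M) : extDerivAux α x Y X = - extDerivAux α x X Y := by
  simp only [extDerivAux]
  rw [mlieBracket_swap_apply, map_neg]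
  ring

/-- The derivative of the factor `f` appears once from the product rule and once from the bracket,
with opposite signs. Hence `dα` may be evaluated on any differentiable extensions of two vectors,
not only on those fixed in `extDerivOne`. -/
lemma extDerivAux_tensorialAt (hα : α.Smooth) :
    TensorialAt I E (extDerivAux α x X ·) x where
  smul {f σ} hf hσ := by
    simp only [extDerivAux]
    rw [mlieBracket_smul_right' hf hσ]
    have h1 : dirDeriv X (fun y ↦ α y ((f • σ) y)) x
        = f x * dirDeriv X (fun y ↦ α y (σ y)) x + α x (σ x) * dirDeriv X f x := by
      simp only [Pi.smul_apply', map_smul, smul_eq_mul]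
      exact dirDeriv_mul hf (hα.mdifferentiableAt hσ)
    rw [h1, dirDeriv_smul_field]
    simp only [map_add, map_smul, smul_eq_mul]
    ring
  add {σ σ'} hσ hσ' := by
    simp only [extDerivAux]
    rw [mlieBracket_add_right' hσ hσ', dirDeriv_add_field]
    have h1 : dirDeriv X (fun y ↦ α y ((σ + σ') y)) x
        = dirDeriv X (fun y ↦ α y (σ y)) x + dirDeriv X (fun y ↦ α y (σ' y)) x := by
      simp only [Pi.add_apply, map_add]
      exact dirDeriv_add (hα.mdifferentiableAt hσ) (hα.mdifferentiableAt hσ')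
    rw [h1, map_add]
    ring

lemma extDerivAux_tensorialAt' (hα : α.Smooth) :
    TensorialAt I E (extDerivAux α x · X) x where
  smul {f σ} hf hσ := by
    have := (extDerivAux_tensorialAt (X := X) hα).smul hf hσ
    simp only [smul_eq_mul] at this ⊢
    rw [extDerivAux_swap X (f • σ), extDerivAux_swap X σ, this]
    ring
  add {σ σ'} hσ hσ' := by
    have := (extDerivAux_tensorialAt (X := X) hα).add hσ hσ'
    rw [extDerivAux_swap X, extDerivAux_swap X σ, extDerivAux_swap X σ', this]
    ring

/-- The exterior derivative of a smooth 1-form at a point, as a continuous bilinear form. -/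
def extDerivForm (α : OneForm I M) (hα : α.Smooth) (x : M) :
    TangentSpace I x →L[ℝ] TangentSpace I x →L[ℝ] ℝ :=
  TensorialAt.mkHom₂ (I := I) (F := E) (F' := E) (extDerivAux α x) x
    (fun _ _ ↦ extDerivAux_tensorialAt' hα) (fun _ _ ↦ extDerivAux_tensorialAt hα)

lemma extDerivForm_apply (hα : α.Smooth) (u v : TangentSpace I x) :
    extDerivForm α hα x u v = extDerivOne α x u v := rfl

/-- The exterior derivative of a smooth 1-form may be computed with arbitrary differentiable
vector fields. -/
lemma extDerivOne_eq (hα : α.Smooth) (hX : X.DiffAt x) (hY : Y.DiffAt x) :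
    extDerivOne α x (X x) (Y x) = dirDeriv X (fun y ↦ α y (Y y)) x
      - dirDeriv Y (fun y ↦ α y (X y)) x - α x (mlieBracket I X Y x) := by
  rw [← extDerivForm_apply hα]
  exact TensorialAt.mkHom₂_apply (fun _ _ ↦ extDerivAux_tensorialAt' hα)
    (fun _ _ ↦ extDerivAux_tensorialAt hα) hX hY

lemma extDerivOne_swap (u v : TangentSpace I x) :
    extDerivOne α x v u = - extDerivOne α x u v :=
  extDerivAux_swap _ _

lemma extDerivOne_self (u : TangentSpace I x) : extDerivOne α x u u = 0 := by
  have := extDerivOne_swap (α := α) u u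
  linarith

/-- The Leibniz rule `d(f α) = df ∧ α + f dα`. -/
lemma extDerivOne_smul (hα : α.Smooth) (hf : MDifferentiableAt I 𝓘(ℝ, ℝ) f x)
    (u v : TangentSpace I x) :
    extDerivOne (fun y ↦ f y • α y) x u v = f x * extDerivOne α x u v
      + mvfderiv I f x u * α x v - mvfderiv I f x v * α x u := by
  have hu := VField.diffAt_extend u
  have hv := VField.diffAt_extend v
  simp only [extDerivOne]
  have h1 (w z : TangentSpace I x) : dirDeriv (I := I) (FiberBundle.extend E w)
      (fun y ↦ (f y • α y) (FiberBundle.extend E z y)) x =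
      f x * dirDeriv (I := I) (FiberBundle.extend E w) (fun y ↦ α y (FiberBundle.extend E z y)) x
        + α x z * mvfderiv I f x w := by
    have := dirDeriv_mul (X := FiberBundle.extend E w) hf
      (hα.mdifferentiableAt (VField.diffAt_extend z))
    simp only [FiberBundle.extend_apply_self] at this
    simpa [dirDeriv] using this
  rw [h1, h1]
  simp only [_root_.smul_apply, smul_eq_mul]
  ring

lemma extDerivOne_add (hα : α.Smooth) (hβ : β.Smooth) (u v : TangentSpace I x) :
    extDerivOne (fun y ↦ α y + β y) x u v = extDerivOne α x u v + extDerivOne β x u v := by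
  have hu := VField.diffAt_extend u
  have hv := VField.diffAt_extend v
  simp only [extDerivOne, _root_.add_apply]
  rw [dirDeriv_add (hα.mdifferentiableAt hv) (hβ.mdifferentiableAt hv),
    dirDeriv_add (hα.mdifferentiableAt hu) (hβ.mdifferentiableAt hu)]
  ring

/-- The differential of a function is closed. -/
lemma extDerivOne_mvfderiv (hf : ContMDiffAt I 𝓘(ℝ, ℝ) 2 f x) (u v : TangentSpace I x) :
    extDerivOne (mvfderiv I f) x u v = 0 := by
  have hu := (VField.smoothAt_extend u).contAt.of_le (m := 2) le_top
  have hv := (VField.smoothAt_extend v).contAt.of_le (m := 2) le_top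
  have := dirDeriv_mlieBracket hu hv hf
  exact sub_eq_zero.2 this.symm

lemma OneForm.Smooth.add (hα : α.Smooth) (hβ : β.Smooth) :
    OneForm.Smooth (fun y ↦ α y + β y) where
  contMDiffAt hX := (hα.contMDiffAt hX).add (hβ.contMDiffAt hX)
  mdifferentiableAt hX := (hα.mdifferentiableAt hX).add (hβ.mdifferentiableAt hX)

lemma OneForm.Smooth.smul (hα : α.Smooth) (hf : ContMDiff I 𝓘(ℝ, ℝ) ∞ f) :
    OneForm.Smooth (fun y ↦ f y • α y) where
  contMDiffAt {n} _ _ hX :=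
    (hf.contMDiffAt.of_le (by exact_mod_cast le_top)).mul (hα.contMDiffAt hX)
  mdifferentiableAt hX :=
    (hf.contMDiffAt.mdifferentiableAt (by simp)).mul (hα.mdifferentiableAt hX)

/-- `d(dα) = 0`. -/
lemma isClosedTwoForm_extDeriv {Ω : TwoTensor I M} (hα : α.Smooth)
    (hΩ : ∀ x u v, Ω x u v = extDerivOne α x u v) : IsClosedTwoForm Ω := by
  have : CompleteSpace E := FiniteDimensional.complete ℝ E
  intro x X Y Z hX hY hZ
  have hX2 := hX.contAt.of_le (m := 2) le_top
  have hY2 := hY.contAt.of_le (m := 2) le_top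
  have hZ2 := hZ.contAt.of_le (m := 2) le_top
  have hb {V W : VField I M} (hV : V.ContAt 2 x) (hW : W.ContAt 2 x) :
      VField.DiffAt (mlieBracket I V W) x :=
    (hV.mlieBracket (m := 1) hW (by norm_num)).diffAt (by simp)
  have hd {V W : VField I M} (hV : V.ContAt 2 x) (hW : W.ContAt 2 x) :
      MDifferentiableAt I 𝓘(ℝ, ℝ) (dirDeriv V (fun y ↦ α y (W y))) x :=
    (contMDiffAt_dirDeriv (m := 1) (hV.of_le (by norm_num)) (hα.contMDiffAt hW)
      (by norm_num)).mdifferentiableAt (by simp)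
  have h1 {U V W : VField I M} (hV : V.SmoothAt x) (hW : W.SmoothAt x) :
      dirDeriv U (fun y ↦ Ω y (V y) (W y)) x
        = dirDeriv U (dirDeriv V (fun y ↦ α y (W y))) x
          - dirDeriv U (dirDeriv W (fun y ↦ α y (V y))) x
          - dirDeriv U (fun y ↦ α y (mlieBracket I V W y)) x := by
    have hV2 := hV.contAt.of_le (m := 2) le_top
    have hW2 := hW.contAt.of_le (m := 2) le_top
    rw [← dirDeriv_sub (hd hV2 hW2) (hd hW2 hV2)]
    refine Eq.trans (dirDeriv_congr ?_)
      (dirDeriv_sub ((hd hV2 hW2).sub (hd hW2 hV2)) (hα.mdifferentiableAt (hb hV2 hW2)))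
    filter_upwards [hV.eventually_diffAt, hW.eventually_diffAt] with y h1 h2
    rw [hΩ, extDerivOne_eq hα h1 h2]
  rw [h1 hY hZ, h1 hX hZ, h1 hX hY, hΩ, hΩ, hΩ,
    extDerivOne_eq hα (hb hX2 hY2) hZ.diffAt, extDerivOne_eq hα (hb hX2 hZ2) hY.diffAt,
    extDerivOne_eq hα (hb hY2 hZ2) hX.diffAt,
    dirDeriv_mlieBracket hX2 hY2 (hα.contMDiffAt hZ2),
    dirDeriv_mlieBracket hX2 hZ2 (hα.contMDiffAt hY2),
    dirDeriv_mlieBracket hY2 hZ2 (hα.contMDiffAt hX2)]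
  -- The second derivatives have cancelled through the commutator formula; the values of `α` on
  -- iterated brackets sum to zero by Jacobi.
  have hJ := congrArg (α x) (jacobi_identity hX2 hY2 hZ2)
  rw [mlieBracket_swap_apply (V := X) (W := mlieBracket I Y Z),
    mlieBracket_swap_apply (V := Y) (W := mlieBracket I X Z)] at hJ
  simp only [map_add, map_neg] at hJ
  linarith

end ExteriorDerivative

/-! ### Lie derivative of a 2-tensor and the Koszul formula -/

section LieDerivative

variable {g : TwoTensor I M}

/-- The formula for `(L_Y g)(X, Z)`. -/
def lieFormAux (g : TwoTensor I M) (Y : VField I M) (x : M) (X Z : VField I M) : ℝ :=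
  dirDeriv Y (fun y ↦ g y (X y) (Z y)) x - g x (mlieBracket I Y X x) (Z x)
    - g x (X x) (mlieBracket I Y Z x)

/-- The Lie derivative of `g` along `Y`. -/
def lieForm (g : TwoTensor I M) (Y : VField I M) (x : M) (u v : TangentSpace I x) : ℝ :=
  lieFormAux g Y x (FiberBundle.extend E u) (FiberBundle.extend E v)

/-- As for `dα`, the term with `Y f` from the product rule cancels the one from the bracket. -/
lemma lieFormAux_tensorialAt (hg : g.Smooth) (hX : X.DiffAt x) :
    TensorialAt I E (lieFormAux g Y x X ·) x where
  smul {f σ} hf hσ := by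
    simp only [lieFormAux]
    rw [mlieBracket_smul_right' hf hσ]
    have h1 : dirDeriv Y (fun y ↦ g y (X y) ((f • σ) y)) x
        = f x * dirDeriv Y (fun y ↦ g y (X y) (σ y)) x + g x (X x) (σ x) * dirDeriv Y f x := by
      simp only [Pi.smul_apply', map_smul, smul_eq_mul]
      exact dirDeriv_mul hf (hg.mdifferentiableAt hX hσ)
    rw [h1]
    simp only [map_add, map_smul, smul_eq_mul, Pi.smul_apply']
    ring
  add {σ σ'} hσ hσ' := by
    simp only [lieFormAux]
    rw [mlieBracket_add_right' hσ hσ']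
    have h1 : dirDeriv Y (fun y ↦ g y (X y) ((σ + σ') y)) x
        = dirDeriv Y (fun y ↦ g y (X y) (σ y)) x + dirDeriv Y (fun y ↦ g y (X y) (σ' y)) x := by
      simp only [Pi.add_apply, map_add]
      exact dirDeriv_add (hg.mdifferentiableAt hX hσ) (hg.mdifferentiableAt hX hσ')
    rw [h1]
    simp only [map_add, Pi.add_apply]
    ring

lemma lieFormAux_swap (hs : ∀ x u v, g x u v = g x v u) :
    lieFormAux g Y x X Z = lieFormAux g Y x Z X := by
  simp only [lieFormAux]
  rw [hs x (mlieBracket I Y X x), hs x (X x)]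
  simp only [fun y ↦ hs y (X y) (Z y)]
  ring

lemma lieFormAux_tensorialAt' (hg : g.Smooth) (hs : ∀ x u v, g x u v = g x v u)
    (hX : X.DiffAt x) : TensorialAt I E (lieFormAux g Y x · X) x := by
  simp only [fun Z ↦ lieFormAux_swap (Y := Y) (x := x) (X := Z) (Z := X) hs]
  exact lieFormAux_tensorialAt hg hX

/-- The Lie derivative of a smooth symmetric 2-tensor may be computed with arbitrary
differentiable vector fields. -/
lemma lieForm_eq (hg : g.Smooth) (hs : ∀ x u v, g x u v = g x v u) (hX : X.DiffAt x)
    (hZ : Z.DiffAt x) :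
    lieForm g Y x (X x) (Z x) = dirDeriv Y (fun y ↦ g y (X y) (Z y)) x
      - g x (mlieBracket I Y X x) (Z x) - g x (X x) (mlieBracket I Y Z x) :=
  TensorialAt.mkHom₂_apply (fun _ h ↦ lieFormAux_tensorialAt' hg hs h)
    (fun _ h ↦ lieFormAux_tensorialAt hg h) hX hZ

lemma lieForm_swap (hs : ∀ x u v, g x u v = g x v u) (u v : TangentSpace I x) :
    lieForm g Y x u v = lieForm g Y x v u :=
  lieFormAux_swap hs

lemma OneForm.Smooth.of_twoTensor (hg : g.Smooth) (hY : ∀ x, Y.SmoothAt x) :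
    OneForm.Smooth (fun y ↦ g y (Y y)) where
  contMDiffAt hX := hg.contMDiffAt ((hY _).contAt.of_le le_top) hX
  mdifferentiableAt hX := hg.mdifferentiableAt (hY _).diffAt hX

/-- The Levi-Civita connection in terms of the exterior and the Lie derivative. -/
lemma leviCivita_spec (hg : g.Smooth) (hs : ∀ x u v, g x u v = g x v u)
    (hn : ∀ x u, (∀ v, g x u v = 0) → u = 0) (hY : ∀ x, Y.SmoothAt x) (u v : TangentSpace I x) :
    2 * g x (leviCivita g Y x u) v
      = extDerivOne (fun y ↦ g y (Y y)) x u v + lieForm g Y x u v := by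
  -- The six Koszul terms split into three that form `dY^♭(u, v)` and three that form `(L_Y g)(u,
  -- v)`.
  have hK (u v : TangentSpace I x) :
      koszul g (FiberBundle.extend E u) Y (FiberBundle.extend E v) x
        = extDerivOne (fun y ↦ g y (Y y)) x u v + lieForm g Y x u v := by
    simp only [koszul, extDerivOne, lieForm, lieFormAux]
    rw [mlieBracket_swap_apply (V := Y) (W := FiberBundle.extend E u), map_neg,
      hs x (FiberBundle.extend E u x) (mlieBracket I Y _ x)]
    simp only [fun y ↦ hs y (FiberBundle.extend E u y) (Y y),
      fun y ↦ hs y (FiberBundle.extend E v y) (FiberBundle.extend E u y)]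
    rw [hs x (Y x)]
    simp only [_root_.neg_apply]
    ring
  set B : TangentSpace I x →L[ℝ] TangentSpace I x →L[ℝ] ℝ :=
    extDerivForm _ (OneForm.Smooth.of_twoTensor hg hY) x +
    TensorialAt.mkHom₂ (I := I) (F := E) (F' := E) (lieFormAux g Y x) x
      (fun _ h ↦ lieFormAux_tensorialAt' hg hs h) (fun _ h ↦ lieFormAux_tensorialAt hg h) with hB
  have hBK (u v : TangentSpace I x) :
      B u v = koszul g (FiberBundle.extend E u) Y (FiberBundle.extend E v) x := by
    rw [hK]; rfl
  have : FiniteDimensional ℝ (TangentSpace I x) := inferInstanceAs (FiniteDimensional ℝ E)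
  have hnd : (g x).toBilinForm.Nondegenerate := by
    have hr : LinearMap.IsRefl (g x).toBilinForm := fun u v h ↦ by
      simpa [ContinuousLinearMap.toBilinForm, hs x v u] using h
    rw [LinearMap.BilinForm.Nondegenerate, hr.nondegenerate_iff_separatingLeft]
    exact fun u hu ↦ hn x u hu
  -- The right-hand side is bilinear by tensoriality, so nondegeneracy of `g` represents it by an
  -- operator and the default value `0` of `leviCivita` does not occur.
  have hex : ∃ L : TangentSpace I x →ₗ[ℝ] TangentSpace I x, ∀ v z : TangentSpace I x,
      2 * g x (L v) z = koszul g (FiberBundle.extend E v) Y (FiberBundle.extend E z) x := by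
    refine ⟨(2⁻¹ : ℝ) • ((LinearMap.BilinForm.toDual (g x).toBilinForm hnd).symm.toLinearMap ∘ₗ
      B.toBilinForm), fun v z ↦ ?_⟩
    rw [← hBK]
    have := LinearMap.BilinForm.apply_toDual_symm_apply (hB := hnd) (B.toBilinForm v) z
    simp only [ContinuousLinearMap.toBilinForm] at this ⊢
    simp
    exact this
  rw [← hK]
  have hL : leviCivita g Y x = hex.choose := by
    unfold leviCivita
    exact dif_pos hex
  rw [hL]
  exact hex.choose_spec u v

end LieDerivative

end Tensors

/-! ### Shear and twist of an operator relative to a splitting -/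

section Splitting

open LinearMap Module

variable {T : Type*} [AddCommGroup T] [Module ℝ T]

section Adjoint

variable [FiniteDimensional ℝ T] {b : LinearMap.BilinForm ℝ T}

/-- Nondegeneracy supplies an adjoint, so the default value in `formAdjoint` is not taken. Symmetry
of `b` allows the use of the left adjoint. -/
lemma isAdjointPair_formAdjoint (hs : ∀ u v, b u v = b v u) (hb : b.Nondegenerate)
    (B : T →ₗ[ℝ] T) (u v : T) : b (B u) v = b u (formAdjoint b B v) := by
  have hex : ∃ B' : T →ₗ[ℝ] T, IsAdjointPair b b B B' := by
    refine ⟨b.leftAdjointOfNondegenerate hb B, fun u v ↦ ?_⟩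
    rw [hs, hs u]
    exact (b.isAdjointPairLeftAdjointOfNondegenerate hb B v u).symm
  have h : formAdjoint b B = hex.choose := by
    unfold formAdjoint
    exact dif_pos hex
  rw [h]
  exact hex.choose_spec u v

/-- The isomorphism `T ≃ T*` given by `b` conjugates the adjoint into the transpose. -/
lemma trace_formAdjoint (hs : ∀ u v, b u v = b v u) (hb : b.Nondegenerate) (B : T →ₗ[ℝ] T) :
    trace ℝ T (formAdjoint b B) = trace ℝ T B := by
  rw [← trace_transpose' B, ← trace_conj' _ (b.toDual hb)]
  congr 1
  ext f u
  obtain ⟨v, rfl⟩ := (b.toDual hb).surjective f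
  simp only [LinearEquiv.conj_apply_apply, LinearEquiv.symm_apply_apply]
  change b (formAdjoint b B v) u = b v (B u)
  rw [hs, ← isAdjointPair_formAdjoint hs hb, hs]

end Adjoint

variable {b : LinearMap.BilinForm ℝ T} {V : Submodule ℝ T}

/-- What the projection removes lies in `V`, and so is invisible when paired with a vector of `V^⊥`.
-/
lemma apply_horizontalPart (hc : IsCompl (b.orthogonal V) V)
    (A : T →ₗ[ℝ] T) (v z : b.orthogonal V) :
    b (horizontalPart b V A v : T) z = b (A v) z := by
  have h : orthProj b V = (b.orthogonal V).projectionOnto V hc := dif_pos hc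
  simp only [horizontalPart, h, LinearMap.comp_apply, Submodule.subtype_apply]
  set p := (b.orthogonal V).projectionOnto V hc with hp
  have h1 : A v - (p (A v) : T) ∈ V := by
    rw [← Submodule.projectionOnto_apply_eq_zero_iff hc, map_sub,
      Submodule.projectionOnto_apply_left, sub_self]
  have h2 := LinearMap.BilinForm.mem_orthogonal_iff.1 z.2 _ h1
  have h3 : b (A v - (p (A v) : T)) z = 0 := h2
  rw [map_sub, LinearMap.sub_apply] at h3
  linarith

section

variable [FiniteDimensional ℝ T]

lemma nondegenerate_restrict (hs : ∀ u v, b u v = b v u)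
    (hpos : ∀ v ∈ b.orthogonal V, v ≠ 0 → 0 < b v v) :
    (b.restrict (b.orthogonal V)).Nondegenerate := by
  have hr : IsRefl (b.restrict (b.orthogonal V)) := fun u v h ↦ by
    simpa [hs v.1 u.1] using h
  rw [LinearMap.BilinForm.Nondegenerate, hr.nondegenerate_iff_separatingLeft]
  intro u hu
  by_contra hne
  have := hpos u u.2 (by simpa using hne)
  exact this.ne' (hu u)

lemma restrict_horizontalPart_adjoint (hs : ∀ u v, b u v = b v u)
    (hc : IsCompl (b.orthogonal V) V) (hpos : ∀ v ∈ b.orthogonal V, v ≠ 0 → 0 < b v v)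
    (A : T →ₗ[ℝ] T) (v z : b.orthogonal V) :
    b (formAdjoint (b.restrict (b.orthogonal V)) (horizontalPart b V A) v : T) z = b v (A z) := by
  have := isAdjointPair_formAdjoint (b := b.restrict (b.orthogonal V)) (fun u v ↦ hs u v)
    (nondegenerate_restrict hs hpos) (horizontalPart b V A) z v
  have h2 : b (horizontalPart b V A z : T) v
    = b z (formAdjoint (b.restrict (b.orthogonal V)) (horizontalPart b V A) v : T) := this
  rw [hs, ← h2, apply_horizontalPart hc, hs]

/-- The shear vanishes iff the symmetric part is conformal. -/
lemma shearPart_eq_zero_iff (hs : ∀ u v, b u v = b v u)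
    (hc : IsCompl (b.orthogonal V) V) (hpos : ∀ v ∈ b.orthogonal V, v ≠ 0 → 0 < b v v)
    (A : T →ₗ[ℝ] T) :
    shearPart b V A = 0 ↔
      ∃ c : ℝ, ∀ v ∈ b.orthogonal V, ∀ z ∈ b.orthogonal V, b (A v) z + b v (A z) = c * b v z := by
  set B := horizontalPart b V A with hB
  set B' := formAdjoint (b.restrict (b.orthogonal V)) B with hB'
  have h1 (v z : b.orthogonal V) : b ((B + B') v : T) z = b (A v) z + b v (A z) := by
    rw [LinearMap.add_apply, Submodule.coe_add, map_add, LinearMap.add_apply,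
      apply_horizontalPart hc, restrict_horizontalPart_adjoint hs hc hpos]
  have hsh : shearPart b V A = (1 / 2 : ℝ) • (B + B')
      - (trace ℝ (b.orthogonal V) B / (finrank ℝ (b.orthogonal V) : ℝ)) • LinearMap.id := rfl
  constructor
  · intro h
    rw [hsh, sub_eq_zero] at h
    refine ⟨2 * (trace ℝ (b.orthogonal V) B / (finrank ℝ (b.orthogonal V) : ℝ)), fun v hv z hz ↦ ?_⟩
    rw [← h1 ⟨v, hv⟩ ⟨z, hz⟩]
    have h2 := congrArg (fun L ↦ b (L ⟨v, hv⟩ : T) z) h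
    simp only [LinearMap.smul_apply, Submodule.coe_smul, map_smul, smul_eq_mul,
      LinearMap.id_apply] at h2
    linarith
  · rintro ⟨c, h⟩
    have hBB : B + B' = c • LinearMap.id := by
      ext v : 1
      rw [← sub_eq_zero]
      set r := (B + B') v - (c • LinearMap.id : b.orthogonal V →ₗ[ℝ] b.orthogonal V) v with hr
      by_contra hne
      have h3 (z : b.orthogonal V) : b (r : T) z = 0 := by
        rw [hr, Submodule.coe_sub, map_sub, LinearMap.sub_apply, h1, h v v.2 z z.2]
        simp
      exact (hpos r r.2 (by simpa using hne)).ne' (h3 r)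
    -- Taking traces in `B + B' = c id` gives `2 tr B = c dim H`, so the trace part subtracted in
    -- the shear is exactly `c/2`.
    have ht : trace ℝ (b.orthogonal V) B' = trace ℝ (b.orthogonal V) B :=
      trace_formAdjoint (b := b.restrict (b.orthogonal V)) (fun u v ↦ hs u v)
        (nondegenerate_restrict hs hpos) B
    have h4 := congrArg (trace ℝ (b.orthogonal V)) hBB
    rw [map_add, ht, map_smul, trace_id, smul_eq_mul] at h4
    rw [hsh, hBB]
    rcases eq_or_ne (finrank ℝ (b.orthogonal V)) 0 with hn | hn
    · have := finrank_zero_iff.1 hn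
      exact Subsingleton.elim _ _
    · have hn' : (finrank ℝ (b.orthogonal V) : ℝ) ≠ 0 := by exact_mod_cast hn
      have h5 : trace ℝ (b.orthogonal V) B / (finrank ℝ (b.orthogonal V) : ℝ) = 1 / 2 * c := by
        field_simp
        linarith
      rw [h5, smul_smul, sub_self]

/-- By contraposition: if the form `b(Av, z) - b(v, Az)` vanishes on `H`, the skew part is the zero
operator. Its determinant is then `0`, but only in positive dimension, whence the rank hypothesis.
-/
lemma exists_of_det_twistPart_ne_zero (hs : ∀ u v, b u v = b v u)
    (hc : IsCompl (b.orthogonal V) V) (hpos : ∀ v ∈ b.orthogonal V, v ≠ 0 → 0 < b v v)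
    (A : T →ₗ[ℝ] T) (hfr : finrank ℝ (b.orthogonal V) ≠ 0)
    (h : LinearMap.det (twistPart b V A) ≠ 0) :
    ∃ v ∈ b.orthogonal V, ∃ z ∈ b.orthogonal V, b (A v) z - b v (A z) ≠ 0 := by
  by_contra! hcon
  apply h
  have h0 : twistPart b V A = 0 := by
    have : twistPart b V A = (1 / 2 : ℝ) • (horizontalPart b V A
      - formAdjoint (b.restrict (b.orthogonal V)) (horizontalPart b V A)) := rfl
    rw [this, smul_eq_zero]
    right
    ext v : 1
    rw [LinearMap.sub_apply, LinearMap.zero_apply]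
    set r := horizontalPart b V A v
      - formAdjoint (b.restrict (b.orthogonal V)) (horizontalPart b V A) v with hr
    by_contra hne
    have h3 (z : b.orthogonal V) : b (r : T) z = 0 := by
      rw [hr, Submodule.coe_sub, map_sub, LinearMap.sub_apply, apply_horizontalPart hc,
        restrict_horizontalPart_adjoint hs hc hpos]
      exact hcon v v.2 z z.2
    exact (hpos r r.2 (by simpa using hne)).ne' (h3 r)
  rw [h0, ← zero_smul ℝ LinearMap.id, LinearMap.det_smul, zero_pow hfr, zero_mul]

end

end Splitting

/-! ### Adapted frames and the complex structure they determine -/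

section AdaptedFrame

open Module

variable {T : Type*} [AddCommGroup T] [Module ℝ T] [TopologicalSpace T]
  [IsTopologicalAddGroup T] [ContinuousSMul ℝ T]

/-- `(k, t, e₁, e₂)` is a frame of `T` with `e₁`, `e₂` an orthonormal basis of `span(k,t)^⊥`, and
`A`, `B` are the coordinates belonging to `k` and `t`. -/
structure IsAdaptedFrame (b : T →L[ℝ] T →L[ℝ] ℝ) (k t e₁ e₂ : T) (A B : T →L[ℝ] ℝ) : Prop where
  expand : ∀ u, u = A u • k + B u • t + b e₁ u • e₁ + b e₂ u • e₂
  A_k : A k = 1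
  A_t : A t = 0
  B_k : B k = 0
  B_t : B t = 1
  A_e₁ : A e₁ = 0
  A_e₂ : A e₂ = 0
  B_e₁ : B e₁ = 0
  B_e₂ : B e₂ = 0
  e₁_e₁ : b e₁ e₁ = 1
  e₁_e₂ : b e₁ e₂ = 0
  e₂_e₂ : b e₂ e₂ = 1
  symm : ∀ u v, b u v = b v u
  mem_iff : ∀ u, u ∈ b.toBilinForm.orthogonal (Submodule.span ℝ {k, t}) ↔ A u = 0 ∧ B u = 0

lemma mem_orthogonal_pair {b : T →L[ℝ] T →L[ℝ] ℝ} {k t u : T} :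
    u ∈ b.toBilinForm.orthogonal (Submodule.span ℝ {k, t}) ↔ b k u = 0 ∧ b t u = 0 := by
  rw [LinearMap.BilinForm.mem_orthogonal_iff]
  constructor
  · intro h
    exact ⟨h k (Submodule.subset_span (by simp)), h t (Submodule.subset_span (by simp))⟩
  · rintro ⟨h1, h2⟩ n hn
    obtain ⟨x, y, rfl⟩ := Submodule.mem_span_pair.1 hn
    change b (x • k + y • t) u = 0
    simp [h1, h2]

namespace IsAdaptedFrame

variable {b : T →L[ℝ] T →L[ℝ] ℝ} {k t e₁ e₂ : T} {A B : T →L[ℝ] ℝ}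

lemma e₂_e₁ (h : IsAdaptedFrame b k t e₁ e₂ A B) : b e₂ e₁ = 0 := by
  rw [h.symm, h.e₁_e₂]

lemma mem_e₁ (h : IsAdaptedFrame b k t e₁ e₂ A B) :
    e₁ ∈ b.toBilinForm.orthogonal (Submodule.span ℝ {k, t}) :=
  (h.mem_iff _).2 ⟨h.A_e₁, h.B_e₁⟩

lemma mem_e₂ (h : IsAdaptedFrame b k t e₁ e₂ A B) :
    e₂ ∈ b.toBilinForm.orthogonal (Submodule.span ℝ {k, t}) :=
  (h.mem_iff _).2 ⟨h.A_e₂, h.B_e₂⟩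

lemma e₁_k (h : IsAdaptedFrame b k t e₁ e₂ A B) : b e₁ k = 0 := by
  rw [h.symm, (mem_orthogonal_pair.1 h.mem_e₁).1]

lemma e₁_t (h : IsAdaptedFrame b k t e₁ e₂ A B) : b e₁ t = 0 := by
  rw [h.symm, (mem_orthogonal_pair.1 h.mem_e₁).2]

lemma e₂_k (h : IsAdaptedFrame b k t e₁ e₂ A B) : b e₂ k = 0 := by
  rw [h.symm, (mem_orthogonal_pair.1 h.mem_e₂).1]

lemma e₂_t (h : IsAdaptedFrame b k t e₁ e₂ A B) : b e₂ t = 0 := by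
  rw [h.symm, (mem_orthogonal_pair.1 h.mem_e₂).2]

lemma expand_of_mem (h : IsAdaptedFrame b k t e₁ e₂ A B) {u : T}
    (hu : u ∈ b.toBilinForm.orthogonal (Submodule.span ℝ {k, t})) :
    u = b e₁ u • e₁ + b e₂ u • e₂ := by
  obtain ⟨h1, h2⟩ := (h.mem_iff u).1 hu
  have := h.expand u
  simpa [h1, h2] using this

lemma inner_of_mem (h : IsAdaptedFrame b k t e₁ e₂ A B) {u : T}
    (hu : u ∈ b.toBilinForm.orthogonal (Submodule.span ℝ {k, t})) (v : T) :
    b u v = b e₁ u * b e₁ v + b e₂ u * b e₂ v := by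
  nth_rw 1 [h.expand_of_mem hu]
  simp

lemma pos_of_mem (h : IsAdaptedFrame b k t e₁ e₂ A B) {u : T}
    (hu : u ∈ b.toBilinForm.orthogonal (Submodule.span ℝ {k, t})) (hne : u ≠ 0) : 0 < b u u := by
  rw [h.inner_of_mem hu]
  by_contra hcon
  have h1 : b e₁ u = 0 := by nlinarith [sq_nonneg (b e₁ u), sq_nonneg (b e₂ u)]
  have h2 : b e₂ u = 0 := by nlinarith [sq_nonneg (b e₁ u), sq_nonneg (b e₂ u)]
  exact hne (by rw [h.expand_of_mem hu, h1, h2]; simp)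

/-- The basis belonging to an adapted frame. -/
def basis (h : IsAdaptedFrame b k t e₁ e₂ A B) : Basis (Fin 4) ℝ T :=
  Basis.mk (v := ![k, t, e₁, e₂]) (by
    rw [Fintype.linearIndependent_iff]
    intro c hc
    have hA := congrArg A hc
    have hB := congrArg B hc
    have h1 := congrArg (b e₁) hc
    have h2 := congrArg (b e₂) hc
    simp [Fin.sum_univ_four, h.A_k, h.A_t, h.A_e₁, h.A_e₂] at hA
    simp [Fin.sum_univ_four, h.B_k, h.B_t, h.B_e₁, h.B_e₂] at hB
    simp [Fin.sum_univ_four, h.e₁_k, h.e₁_t, h.e₁_e₁, h.e₁_e₂] at h1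
    simp [Fin.sum_univ_four, h.e₂_k, h.e₂_t, h.e₂_e₁, h.e₂_e₂] at h2
    intro i
    fin_cases i <;> assumption) (by
    intro u _
    rw [h.expand u]
    refine add_mem (add_mem (add_mem ?_ ?_) ?_) ?_ <;>
      refine Submodule.smul_mem _ _ (Submodule.subset_span ?_)
    exacts [⟨0, rfl⟩, ⟨1, rfl⟩, ⟨2, rfl⟩, ⟨3, rfl⟩])

lemma coe_basis (h : IsAdaptedFrame b k t e₁ e₂ A B) : ⇑h.basis = ![k, t, e₁, e₂] :=
  Basis.coe_mk _ _

lemma basis_repr (h : IsAdaptedFrame b k t e₁ e₂ A B) (u : T) :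
    ⇑(h.basis.repr u) = ![A u, B u, b e₁ u, b e₂ u] := by
  have h1 : u = h.basis.equivFun.symm ![A u, B u, b e₁ u, b e₂ u] := by
    rw [Basis.equivFun_symm_apply, coe_basis]
    simp only [Fin.sum_univ_four]
    exact h.expand u
  rw [← Basis.equivFun_apply]
  nth_rw 1 [h1]
  rw [LinearEquiv.apply_symm_apply]

/-- The matrix is block diagonal with an identity block for `(k, t)`, which reduces questions about
orientations of `T` to a planar determinant in `H`. -/
lemma basis_det (h : IsAdaptedFrame b k t e₁ e₂ A B) {a a' : T}
    (ha : a ∈ b.toBilinForm.orthogonal (Submodule.span ℝ {k, t}))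
    (ha' : a' ∈ b.toBilinForm.orthogonal (Submodule.span ℝ {k, t})) :
    h.basis.det ![k, t, a, a'] = b e₁ a * b e₂ a' - b e₂ a * b e₁ a' := by
  obtain ⟨h1, h2⟩ := (h.mem_iff a).1 ha
  obtain ⟨h1', h2'⟩ := (h.mem_iff a').1 ha'
  rw [Basis.det_apply]
  have : h.basis.toMatrix ![k, t, a, a'] =
      !![1, 0, 0, 0; 0, 1, 0, 0; 0, 0, b e₁ a, b e₁ a'; 0, 0, b e₂ a, b e₂ a'] := by
    ext i j
    rw [Basis.toMatrix_apply, basis_repr]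
    fin_cases i <;> fin_cases j <;>
      simp [h.A_k, h.A_t, h.B_k, h.B_t, h.e₁_k, h.e₁_t, h.e₂_k, h.e₂_t, h1, h2, h1', h2']
  rw [this]
  simp [Matrix.det_succ_row_zero, Fin.sum_univ_succ]
  ring

lemma orientation_eq_iff (h : IsAdaptedFrame b k t e₁ e₂ A B) {a a' : T}
    (ha : a ∈ b.toBilinForm.orthogonal (Submodule.span ℝ {k, t}))
    (ha' : a' ∈ b.toBilinForm.orthogonal (Submodule.span ℝ {k, t}))
    {f : Basis (Fin 4) ℝ T} (hf : ⇑f = ![k, t, a, a']) :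
    f.orientation = h.basis.orientation ↔ 0 < b e₁ a * b e₂ a' - b e₂ a * b e₁ a' := by
  rw [eq_comm, Basis.orientation_eq_iff_det_pos, hf, h.basis_det ha ha']

lemma exists_basis (h : IsAdaptedFrame b k t e₁ e₂ A B) {a a' : T}
    (ha : a ∈ b.toBilinForm.orthogonal (Submodule.span ℝ {k, t}))
    (ha' : a' ∈ b.toBilinForm.orthogonal (Submodule.span ℝ {k, t}))
    (hD : 0 < b e₁ a * b e₂ a' - b e₂ a * b e₁ a') :
    ∃ f : Basis (Fin 4) ℝ T, ⇑f = ![k, t, a, a'] ∧ f.orientation = h.basis.orientation := by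
  have hu : IsUnit (h.basis.det ![k, t, a, a']) := by
    rw [h.basis_det ha ha']; exact hD.ne'.isUnit
  obtain ⟨hl, hsp⟩ := (Basis.is_basis_iff_det h.basis).2 hu
  have hf : ⇑(Basis.mk hl hsp.ge) = ![k, t, a, a'] := Basis.coe_mk _ _
  exact ⟨Basis.mk hl hsp.ge, hf, (h.orientation_eq_iff ha ha' hf).2 hD⟩

/-- The complex structure belonging to an adapted frame. -/
def complexStructure (_h : IsAdaptedFrame b k t e₁ e₂ A B) : T →L[ℝ] T :=
  A.smulRight t - B.smulRight k + (b e₁).smulRight e₂ - (b e₂).smulRight e₁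

lemma complexStructure_apply (h : IsAdaptedFrame b k t e₁ e₂ A B) (u : T) :
    h.complexStructure u = A u • t - B u • k + b e₁ u • e₂ - b e₂ u • e₁ := by
  simp [complexStructure]

lemma isSplitComplexStructure (h : IsAdaptedFrame b k t e₁ e₂ A B) :
    IsSplitComplexStructure b.toBilinForm h.basis.orientation k t h.complexStructure := by
  have hA (u : T) : A (h.complexStructure u) = - B u := by
    simp [complexStructure_apply, h.A_k, h.A_t, h.A_e₁, h.A_e₂]
  have hB (u : T) : B (h.complexStructure u) = A u := by
    simp [complexStructure_apply, h.B_k, h.B_t, h.B_e₁, h.B_e₂]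
  have h1 (u : T) : b e₁ (h.complexStructure u) = - b e₂ u := by
    simp [complexStructure_apply, h.e₁_k, h.e₁_t, h.e₁_e₁, h.e₁_e₂]
  have h2 (u : T) : b e₂ (h.complexStructure u) = b e₁ u := by
    simp [complexStructure_apply, h.e₂_k, h.e₂_t, h.e₂_e₁, h.e₂_e₂]
  have hmem : ∀ v ∈ b.toBilinForm.orthogonal (Submodule.span ℝ {k, t}),
      h.complexStructure v ∈ b.toBilinForm.orthogonal (Submodule.span ℝ {k, t}) := by
    intro v hv
    rw [h.mem_iff] at hv ⊢
    rw [hA, hB]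
    simp [hv.1, hv.2]
  refine ⟨?_, ?_, hmem, ?_, ?_, ?_⟩
  · simp [complexStructure_apply, h.A_k, h.B_k, h.e₁_k, h.e₂_k]
  · simp [complexStructure_apply, h.A_t, h.B_t, h.e₁_t, h.e₂_t]
  · intro v hv
    rw [h.expand_of_mem (hmem _ (hmem v hv)), h1, h2, h2, h1]
    nth_rw 3 [h.expand_of_mem hv]
    simp [add_comm]
  · intro v hv v' hv'
    change b (h.complexStructure v) (h.complexStructure v') = b v v'
    rw [h.inner_of_mem (hmem v hv), h.inner_of_mem hv, h1, h2, h1, h2]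
    ring
  · intro v hv hne
    -- For the pair `(v, J v)` the planar determinant is `|v|²`.
    refine h.exists_basis hv (hmem v hv) ?_
    rw [h1, h2]
    have := h.pos_of_mem hv hne
    rw [h.inner_of_mem hv] at this
    linarith

/-- The complex structure of the splitting is the one belonging to an adapted frame. -/
lemma splitComplexStructure_eq (h : IsAdaptedFrame b k t e₁ e₂ A B) :
    splitComplexStructure b.toBilinForm h.basis.orientation k t = h.complexStructure := by
  have hex : ∃ J : T →L[ℝ] T, IsSplitComplexStructure b.toBilinForm h.basis.orientation k t J :=
    ⟨_, h.isSplitComplexStructure⟩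
  have hJ : splitComplexStructure b.toBilinForm h.basis.orientation k t = hex.choose := by
    unfold splitComplexStructure
    exact dif_pos hex
  rw [hJ]
  obtain ⟨jk, jt, jm, js, ji, jo⟩ := hex.choose_spec
  set J := hex.choose
  have hm := jm _ h.mem_e₁
  -- `J` is an isometry with square `-1`, so `b(e₁, J e₁) = b(J e₁, J² e₁) = -b(J e₁, e₁)`. Hence `J
  -- e₁ = ± e₂`, and the orientation decides the sign.
  have h0 : b e₁ (J e₁) = 0 := by
    have := ji _ h.mem_e₁ _ hm
    rw [js _ h.mem_e₁] at this
    change b (J e₁) (-e₁) = b e₁ (J e₁) at this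
    rw [map_neg, h.symm] at this
    linarith
  have hsq : b e₂ (J e₁) * b e₂ (J e₁) = 1 := by
    have : b (J e₁) (J e₁) = b e₁ e₁ := ji _ h.mem_e₁ _ h.mem_e₁
    rw [h.e₁_e₁, h.inner_of_mem hm, h0] at this
    linarith
  have hpos : 0 < b e₂ (J e₁) := by
    have hne : e₁ ≠ 0 := by
      rintro h'
      have := h.e₁_e₁
      simp [h'] at this
    obtain ⟨f, hf, hfo⟩ := jo _ h.mem_e₁ hne
    have := (h.orientation_eq_iff h.mem_e₁ hm hf).1 hfo
    rw [h0, h.e₁_e₁] at this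
    linarith
  have h1 : b e₂ (J e₁) = 1 := by nlinarith
  have he₁ : J e₁ = e₂ := by
    rw [h.expand_of_mem hm, h0, h1]; simp
  have he₂ : J e₂ = -e₁ := by rw [← he₁, js _ h.mem_e₁]
  ext u
  rw [complexStructure_apply]
  nth_rw 1 [h.expand u]
  simp only [map_add, map_smul, jk, jt, he₁, he₂, smul_neg]
  abel

end IsAdaptedFrame

end AdaptedFrame

/-! ### Smoothness of tensor fields tested on vector fields -/

section BundleSmoothness

open Bundle

variable {E : Type*} [NormedAddCommGroup E] [NormedSpace ℝ E] [FiniteDimensional ℝ E]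
  {H : Type*} [TopologicalSpace H] {I : ModelWithCorners ℝ E H}
  {M : Type*} [TopologicalSpace M] [ChartedSpace H M] [IsManifold I ∞ M]

/-- In finite dimension an operator is the finite sum of its values on a basis, each multiplied by
the corresponding coordinate functional. -/
lemma contMDiffAt_clm_of_apply {F : Type*} [NormedAddCommGroup F] [NormedSpace ℝ F]
    {f : M → E →L[ℝ] F} {x : M}
    (h : ∀ v, ContMDiffAt I 𝓘(ℝ, F) ∞ (fun y ↦ f y v) x) :
    ContMDiffAt I 𝓘(ℝ, E →L[ℝ] F) ∞ f x := by
  let b := Module.finBasis ℝ E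
  have hf : f = fun y ↦ ∑ i, ContinuousLinearMap.smulRightL ℝ E F
      (LinearMap.toContinuousLinearMap (b.coord i)) (f y (b i)) := by
    ext y v
    have := congrArg (f y) (b.sum_repr v)
    rw [map_sum] at this
    simpa using this.symm
  rw [hf]
  refine ContMDiffAt.sum fun i _ ↦ ?_
  exact (ContinuousLinearMap.contMDiff _).contMDiffAt.comp x (h (b i))

/-- Fields that are constant in the trivialization at `x` are the test fields that read off the
components of a tensor there. -/
lemma VField.smoothAt_symm (x : M) (v : E) :
    VField.SmoothAt (I := I) (fun y ↦ (trivializationAt E (TangentSpace I) x).symm y v) x := by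
  have hx := FiberBundle.mem_baseSet_trivializationAt' (F := E)
    (E := (TangentSpace I : M → Type _)) x
  have h := VField.smoothAt_extend (I := I) ((trivializationAt E (TangentSpace I) x).symm x v)
  convert h using 3 with y
  simp only [FiberBundle.extend]
  rw [Trivialization.apply_mk_symm _ hx]

/-- A field of bilinear forms is smooth if its values on smooth vector fields are. -/
lemma contMDiff_twoTensor {g : TwoTensor I M}
    (h : ∀ (x : M) (X Y : VField I M), X.SmoothAt x → Y.SmoothAt x →
      ContMDiffAt I 𝓘(ℝ, ℝ) ∞ (fun y ↦ g y (X y) (Y y)) x) :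
    ContMDiff I (I.prod 𝓘(ℝ, E →L[ℝ] E →L[ℝ] ℝ)) ∞
      (fun x ↦ Bundle.TotalSpace.mk' (E →L[ℝ] E →L[ℝ] ℝ)
        (E := fun x : M ↦ TangentSpace I x →L[ℝ] TangentSpace I x →L[ℝ] ℝ) x (g x)) := by
  intro x
  rw [contMDiffAt_hom_bundle]
  refine ⟨contMDiffAt_id, ?_⟩
  refine contMDiffAt_clm_of_apply fun v ↦ contMDiffAt_clm_of_apply fun w ↦ ?_
  refine (h x _ _ (VField.smoothAt_symm x v) (VField.smoothAt_symm x w)).congr_of_eventuallyEq ?_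
  filter_upwards [(trivializationAt E (TangentSpace I) x).open_baseSet.mem_nhds
    (FiberBundle.mem_baseSet_trivializationAt' x)] with y hy
  rw [inCoordinates_apply_eq₂ hy hy (by simp)]
  simp

/-- A field of endomorphisms is smooth if its values on smooth vector fields are. -/
lemma contMDiff_endField {J : EndField I M}
    (h : ∀ (x : M) (X : VField I M), X.SmoothAt x → VField.SmoothAt (fun y ↦ J y (X y)) x) :
    ContMDiff I (I.prod 𝓘(ℝ, E →L[ℝ] E)) ∞
      (fun x ↦ Bundle.TotalSpace.mk' (E →L[ℝ] E)
        (E := fun x : M ↦ TangentSpace I x →L[ℝ] TangentSpace I x) x (J x)) := by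
  intro x
  rw [contMDiffAt_hom_bundle]
  refine ⟨contMDiffAt_id, ?_⟩
  refine contMDiffAt_clm_of_apply fun v ↦ ?_
  have h1 := h x _ (VField.smoothAt_symm x v)
  rw [VField.SmoothAt, contMDiffAt_section] at h1
  refine h1.congr_of_eventuallyEq ?_
  filter_upwards [(trivializationAt E (TangentSpace I) x).open_baseSet.mem_nhds
    (FiberBundle.mem_baseSet_trivializationAt' x)] with y hy
  rw [ContinuousLinearMap.inCoordinates_eq hy hy]
  simp

/-- A smooth section of the bundle of bilinear forms, evaluated on vector fields along a map. -/
lemma contMDiffAt_twoTensor_apply {E' : Type*} [NormedAddCommGroup E'] [NormedSpace ℝ E']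
    {H' : Type*} [TopologicalSpace H'] {I' : ModelWithCorners ℝ E' H'}
    {M' : Type*} [TopologicalSpace M'] [ChartedSpace H' M'] {g : TwoTensor I M}
    (hg : ContMDiff I (I.prod 𝓘(ℝ, E →L[ℝ] E →L[ℝ] ℝ)) ∞
      (fun x ↦ Bundle.TotalSpace.mk' (E →L[ℝ] E →L[ℝ] ℝ)
        (E := fun x : M ↦ TangentSpace I x →L[ℝ] TangentSpace I x →L[ℝ] ℝ) x (g x)))
    {φ : M' → M} {n : ℕ∞} {x : M'} {X Y : (y : M') → TangentSpace I (φ y)}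
    (hX : ContMDiffAt I' I.tangent n (fun y ↦ (⟨φ y, X y⟩ : TangentBundle I M)) x)
    (hY : ContMDiffAt I' I.tangent n (fun y ↦ (⟨φ y, Y y⟩ : TangentBundle I M)) x) :
    ContMDiffAt I' 𝓘(ℝ, ℝ) n (fun y ↦ g (φ y) (X y) (Y y)) x := by
  have hφ : ContMDiffAt I' I n φ x := (contMDiffAt_totalSpace.1 hX).1
  have : ContMDiffAt I' (I.prod 𝓘(ℝ)) n
      (fun m ↦ TotalSpace.mk' ℝ (E := Bundle.Trivial M ℝ) (φ m) (g (φ m) (X m) (Y m))) x := by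
    apply ContMDiffAt.clm_bundle_apply₂ (F₁ := E) (F₂ := E)
    · exact ContMDiffAt.comp x (hg.contMDiffAt.of_le (by exact_mod_cast le_top)) hφ
    · exact hX
    · exact hY
  exact (contMDiffAt_totalSpace.1 this).2

lemma mdifferentiableAt_twoTensor_apply {E' : Type*} [NormedAddCommGroup E'] [NormedSpace ℝ E']
    {H' : Type*} [TopologicalSpace H'] {I' : ModelWithCorners ℝ E' H'}
    {M' : Type*} [TopologicalSpace M'] [ChartedSpace H' M'] {g : TwoTensor I M}
    (hg : ContMDiff I (I.prod 𝓘(ℝ, E →L[ℝ] E →L[ℝ] ℝ)) ∞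
      (fun x ↦ Bundle.TotalSpace.mk' (E →L[ℝ] E →L[ℝ] ℝ)
        (E := fun x : M ↦ TangentSpace I x →L[ℝ] TangentSpace I x →L[ℝ] ℝ) x (g x)))
    {φ : M' → M} {x : M'} {X Y : (y : M') → TangentSpace I (φ y)}
    (hX : MDifferentiableAt I' I.tangent (fun y ↦ (⟨φ y, X y⟩ : TangentBundle I M)) x)
    (hY : MDifferentiableAt I' I.tangent (fun y ↦ (⟨φ y, Y y⟩ : TangentBundle I M)) x) :
    MDifferentiableAt I' 𝓘(ℝ, ℝ) (fun y ↦ g (φ y) (X y) (Y y)) x := by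
  have hφ : MDifferentiableAt I' I φ x := ((mdifferentiableAt_totalSpace _ _).1 hX).1
  have : MDifferentiableAt I' (I.prod 𝓘(ℝ))
      (fun m ↦ TotalSpace.mk' ℝ (E := Bundle.Trivial M ℝ) (φ m) (g (φ m) (X m) (Y m))) x := by
    apply MDifferentiableAt.clm_bundle_apply₂ (F₁ := E) (F₂ := E)
    · exact MDifferentiableAt.comp x (hg.contMDiffAt.mdifferentiableAt (by simp)) hφ
    · exact hX
    · exact hY
  exact ((mdifferentiableAt_totalSpace _ _).1 this).2

lemma TwoTensor.smooth_of_contMDiff {g : TwoTensor I M}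
    (hg : ContMDiff I (I.prod 𝓘(ℝ, E →L[ℝ] E →L[ℝ] ℝ)) ∞
      (fun x ↦ Bundle.TotalSpace.mk' (E →L[ℝ] E →L[ℝ] ℝ)
        (E := fun x : M ↦ TangentSpace I x →L[ℝ] TangentSpace I x →L[ℝ] ℝ) x (g x))) :
    g.Smooth where
  contMDiffAt hX hY := contMDiffAt_twoTensor_apply (φ := id) hg hX hY
  mdifferentiableAt hX hY := mdifferentiableAt_twoTensor_apply (φ := id) hg hX hY

end BundleSmoothness

/-! ### The Nijenhuis tensor -/

section Nijenhuis

open VectorField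

variable {E : Type*} [NormedAddCommGroup E] [NormedSpace ℝ E] [FiniteDimensional ℝ E]
  {H : Type*} [TopologicalSpace H] {I : ModelWithCorners ℝ E H}
  {M : Type*} [TopologicalSpace M] [ChartedSpace H M] [IsManifold I ∞ M]
  {x : M} {X Y : VField I M} {J : EndField I M}

lemma nijenhuis_swap : nijenhuis J Y X x = - nijenhuis J X Y x := by
  simp only [nijenhuis]
  rw [mlieBracket_swap_apply (V := Y) (W := X), mlieBracket_swap_apply (V := fun y ↦ J y (Y y)),
    mlieBracket_swap_apply (V := fun y ↦ J y (Y y)) (W := X),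
    mlieBracket_swap_apply (V := Y)]
  simp only [map_neg]
  abel

/-- The derivatives of `f` along `J X` cancel directly; those along `X` cancel because `J² = -1`. -/
lemma nijenhuis_tensorialAt
    (hJ : ∀ X : VField I M, X.DiffAt x → VField.DiffAt (fun y ↦ J y (X y)) x)
    (hsq : ∀ x v, J x (J x v) = -v) (X : VField I M) :
    TensorialAt I E (fun Y ↦ nijenhuis J X Y x) x where
  smul {f σ} hf hσ := by
    have e : (fun y ↦ J y ((f • σ) y)) = f • fun y ↦ J y (σ y) := by
      ext y; simp
    simp only [nijenhuis]
    rw [e, mlieBracket_smul_right' hf (hJ σ hσ), mlieBracket_smul_right' hf (hJ σ hσ),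
      mlieBracket_smul_right' hf hσ, mlieBracket_smul_right' hf hσ]
    simp only [map_add, map_smul, hsq]
    module
  add {σ σ'} hσ hσ' := by
    have e : (fun y ↦ J y ((σ + σ') y)) = (fun y ↦ J y (σ y)) + fun y ↦ J y (σ' y) := by
      ext y; simp
    simp only [nijenhuis]
    rw [e, mlieBracket_add_right' (hJ σ hσ) (hJ σ' hσ'),
      mlieBracket_add_right' (hJ σ hσ) (hJ σ' hσ'), mlieBracket_add_right' hσ hσ',
      mlieBracket_add_right' hσ hσ']
    simp only [map_add]
    abel

lemma nijenhuis_tensorialAt'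
    (hJ : ∀ X : VField I M, X.DiffAt x → VField.DiffAt (fun y ↦ J y (X y)) x)
    (hsq : ∀ x v, J x (J x v) = -v) (X : VField I M) :
    TensorialAt I E (fun Y ↦ nijenhuis J Y X x) x where
  smul {f σ} hf hσ := by
    have := (nijenhuis_tensorialAt hJ hsq X).smul hf hσ
    rw [nijenhuis_swap (X := X), this, nijenhuis_swap (X := X) (Y := σ), smul_neg]
  add {σ σ'} hσ hσ' := by
    have := (nijenhuis_tensorialAt hJ hsq X).add hσ hσ'
    rw [nijenhuis_swap (X := X), this, nijenhuis_swap (X := X) (Y := σ),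
      nijenhuis_swap (X := X) (Y := σ'), neg_add]

/-- A formal consequence of `J² = -1`: replacing `X` by `J X` permutes the four terms up to `-J`.
This antilinearity is what reduces dimension four to one pair of fields. -/
lemma nijenhuis_map_left (hsq : ∀ x v, J x (J x v) = -v)
    (hX : X.DiffAt x) :
    nijenhuis J (fun y ↦ J y (X y)) Y x = - J x (nijenhuis J X Y x) := by
  have e : (fun y ↦ J y (J y (X y))) = -X := by
    ext y; simp [hsq]
  simp only [nijenhuis]
  rw [e, mlieBracket_neg_left hX, mlieBracket_neg_left hX]
  simp only [map_sub, hsq, map_neg]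
  abel

/-- In real dimension four, the Nijenhuis tensor vanishes if it vanishes on a suitable pair of
vector fields. -/
lemma nijenhuis_eq_zero (hJ : ∀ X : VField I M, X.DiffAt x → VField.DiffAt (fun y ↦ J y (X y)) x)
    (hsq : ∀ x v, J x (J x v) = -v) {k e : VField I M} (hk : k.DiffAt x) (he : e.DiffAt x)
    (hspan : ∀ u : TangentSpace I x, ∃ a b c d : ℝ,
      u = a • k x + b • J x (k x) + c • e x + d • J x (e x))
    (h0 : nijenhuis J k e x = 0) (hX : X.DiffAt x) (hY : Y.DiffAt x) :
    nijenhuis J X Y x = 0 := by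
  set N : TangentSpace I x →L[ℝ] TangentSpace I x →L[ℝ] TangentSpace I x :=
    TensorialAt.mkHom₂ (I := I) (F := E) (F' := E) (fun X Y ↦ nijenhuis J X Y x) x
      (fun X _ ↦ nijenhuis_tensorialAt' hJ hsq X) (fun X _ ↦ nijenhuis_tensorialAt hJ hsq X) with hN
  have hNe {X Y : VField I M} (hX : X.DiffAt x) (hY : Y.DiffAt x) :
      N (X x) (Y x) = nijenhuis J X Y x :=
    TensorialAt.mkHom₂_apply (fun X _ ↦ nijenhuis_tensorialAt' hJ hsq X)
      (fun X _ ↦ nijenhuis_tensorialAt hJ hsq X) hX hY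
  have hNs (u v : TangentSpace I x) : N v u = - N u v := nijenhuis_swap
  have hNJ (u v : TangentSpace I x) : N (J x u) v = - J x (N u v) := by
    have h1 := hNe (hJ _ (VField.diffAt_extend u)) (VField.diffAt_extend v)
    rw [nijenhuis_map_left hsq (VField.diffAt_extend u),
      ← hNe (VField.diffAt_extend u) (VField.diffAt_extend v)] at h1
    simpa only [FiberBundle.extend_apply_self] using h1
  have hNself (u : TangentSpace I x) : N u u = 0 := by
    have h2 : (2 : ℝ) • N u u = 0 := by
      have := hNs u u
      rw [two_smul]
      nth_rw 1 [this]
      exact neg_add_cancel _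
    exact (smul_eq_zero.1 h2).resolve_left two_ne_zero
  have hNJ' (u v : TangentSpace I x) : N u (J x v) = - J x (N u v) := by
    rw [hNs, hNJ, hNs u v]; simp
  -- On the spanning set `k, Jk, e, Je` every value of `N` is, up to sign and powers of `J`, one of
  -- `N(k,k)`, `N(e,e)`, `N(k,e)`, `N(e,k)`, and all of these vanish.
  have hke : N (k x) (e x) = 0 := by rw [hNe hk he, h0]
  have hek : N (e x) (k x) = 0 := by rw [hNs, hke, neg_zero]
  rw [← hNe hX hY]
  obtain ⟨a, b, c, d, h1⟩ := hspan (X x)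
  obtain ⟨a', b', c', d', h2⟩ := hspan (Y x)
  rw [h1, h2]
  simp [hNJ, hNJ', hNself, hke, hek]

end Nijenhuis

/-! ### Orthonormal triples in dimension three -/

section OrthonormalTriple

open Module

variable {T : Type*} [AddCommGroup T] [Module ℝ T] [TopologicalSpace T]
  {b : T →L[ℝ] T →L[ℝ] ℝ} {k e₁ e₂ : T}

lemma mem_orthogonal_singleton {k u : T} :
    u ∈ b.toBilinForm.orthogonal (Submodule.span ℝ {k}) ↔ b k u = 0 := by
  rw [LinearMap.BilinForm.mem_orthogonal_iff]
  constructor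
  · intro h
    exact h k (Submodule.subset_span (by simp))
  · rintro h n hn
    obtain ⟨x, rfl⟩ := Submodule.mem_span_singleton.1 hn
    change b (x • k) u = 0
    simp [h]

lemma isCompl_orthogonal_singleton (hk : b k k = 1) :
    IsCompl (b.toBilinForm.orthogonal (Submodule.span ℝ {k})) (Submodule.span ℝ {k}) := by
  constructor
  · rw [Submodule.disjoint_def]
    intro u hu hu'
    obtain ⟨x, rfl⟩ := Submodule.mem_span_singleton.1 hu'
    rw [mem_orthogonal_singleton] at hu
    simp only [map_smul, hk, smul_eq_mul, mul_one] at hu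
    simp [hu]
  · rw [codisjoint_iff, eq_top_iff]
    intro u _
    rw [Submodule.mem_sup]
    refine ⟨u - b k u • k, ?_, b k u • k,
      Submodule.smul_mem _ _ (Submodule.mem_span_singleton_self k), by abel⟩
    rw [mem_orthogonal_singleton]
    simp [hk]

/-- The vectors `k`, `e₁`, `e₂` are orthonormal with respect to `b`. -/
structure IsOrthonormalTriple (b : T →L[ℝ] T →L[ℝ] ℝ) (k e₁ e₂ : T) : Prop where
  k_k : b k k = 1
  k_e₁ : b k e₁ = 0
  k_e₂ : b k e₂ = 0
  e₁_e₁ : b e₁ e₁ = 1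
  e₁_e₂ : b e₁ e₂ = 0
  e₂_e₂ : b e₂ e₂ = 1

/-- Three orthonormal vectors are independent and so span; the remainder of the expansion is
orthogonal to all of them, hence to itself. -/
lemma IsOrthonormalTriple.expand (h : IsOrthonormalTriple b k e₁ e₂)
    (hs : ∀ u v, b u v = b v u) (hpos : ∀ u, u ≠ 0 → 0 < b u u) (hT : finrank ℝ T = 3) (u : T) :
    u = b k u • k + b e₁ u • e₁ + b e₂ u • e₂ := by
  have h1 : b e₁ k = 0 := by rw [hs, h.k_e₁]
  have h2 : b e₂ k = 0 := by rw [hs, h.k_e₂]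
  have h3 : b e₂ e₁ = 0 := by rw [hs, h.e₁_e₂]
  have hli : LinearIndependent ℝ ![k, e₁, e₂] := by
    rw [Fintype.linearIndependent_iff]
    intro c hc
    have hk := congrArg (b k) hc
    have he1 := congrArg (b e₁) hc
    have he2 := congrArg (b e₂) hc
    simp [Fin.sum_univ_three, h.k_k, h.k_e₁, h.k_e₂] at hk
    simp [Fin.sum_univ_three, h1, h.e₁_e₁, h.e₁_e₂] at he1
    simp [Fin.sum_univ_three, h2, h3, h.e₂_e₂] at he2
    intro i
    fin_cases i <;> assumption
  have : FiniteDimensional ℝ T := FiniteDimensional.of_finrank_pos (by omega)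
  have hsp := hli.span_eq_top_of_card_eq_finrank (by simp [hT])
  set r := u - (b k u • k + b e₁ u • e₁ + b e₂ u • e₂) with hr
  have hrk : b r k = 0 := by rw [hs]; simp [hr, h.k_k, h.k_e₁, h.k_e₂]
  have hr1 : b r e₁ = 0 := by rw [hs]; simp [hr, h1, h.e₁_e₁, h.e₁_e₂]
  have hr2 : b r e₂ = 0 := by rw [hs]; simp [hr, h2, h3, h.e₂_e₂]
  have hall (v : T) : b r v = 0 := by
    have hv : v ∈ Submodule.span ℝ (Set.range ![k, e₁, e₂]) := by rw [hsp]; trivial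
    induction hv using Submodule.span_induction with
    | mem x hx =>
      obtain ⟨i, rfl⟩ := hx
      fin_cases i <;> assumption
    | zero => simp
    | add x y _ _ hx hy => rw [map_add, hx, hy, add_zero]
    | smul c x _ hx => rw [map_smul, hx, smul_zero]
  by_contra hne
  exact (hpos r (by rwa [hr, sub_ne_zero])).ne' (hall r)

end OrthonormalTriple

/-! ### Geodesic, shear-free and twisting fields in terms of `dk^♭` and `L_k g` -/

section Twisting

open VectorField Module

variable {E : Type*} [NormedAddCommGroup E] [NormedSpace ℝ E] [FiniteDimensional ℝ E]
  {H : Type*} [TopologicalSpace H] {I : ModelWithCorners ℝ E H}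
  {N : Type*} [TopologicalSpace N] [ChartedSpace H N] [IsManifold I ∞ N]

lemma contMDiffAt_extDerivOne {α : OneForm I N} (hα : α.Smooth) {x : N} {X Y : VField I N}
    (hX : X.SmoothAt x) (hY : Y.SmoothAt x) :
    ContMDiffAt I 𝓘(ℝ, ℝ) ∞ (fun y ↦ extDerivOne α y (X y) (Y y)) x := by
  have : CompleteSpace E := FiniteDimensional.complete ℝ E
  have h1 : ContMDiffAt I 𝓘(ℝ, ℝ) ∞ (fun y ↦ dirDeriv X (fun y ↦ α y (Y y)) y
      - dirDeriv Y (fun y ↦ α y (X y)) y - α y (mlieBracket I X Y y)) x :=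
    ((contMDiffAt_dirDeriv (m := ⊤) hX.contAt (hα.contMDiffAt hY.contAt) (by simp)).sub
      (contMDiffAt_dirDeriv (m := ⊤) hY.contAt (hα.contMDiffAt hX.contAt) (by simp))).sub
      (hα.contMDiffAt (hX.contAt.mlieBracket hY.contAt (by simp)))
  refine h1.congr_of_eventuallyEq ?_
  filter_upwards [hX.eventually_diffAt, hY.eventually_diffAt] with y hx hy
  exact extDerivOne_eq hα hx hy

variable {g : TwoTensor I N} {k : VField I N}

/-- The two invariant formulas differ only by derivatives of `g(k, k)`, which is constant, and by
`[k, k] = 0`. With the Koszul formula this gives `g(∇_k k, v) = dk^♭(k, v)`. -/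
lemma lieForm_self_left (hg : g.Smooth) (hs : ∀ x u v, g x u v = g x v u)
    (hk : ∀ x, k.SmoothAt x) {c : ℝ} (hunit : ∀ x, g x (k x) (k x) = c) (x : N)
    (v : TangentSpace I x) :
    lieForm g k x (k x) v = extDerivOne (fun y ↦ g y (k y)) x (k x) v := by
  have hv := VField.diffAt_extend v
  have h1 := lieForm_eq (Y := k) hg hs (hk x).diffAt hv
  have h2 := extDerivOne_eq (OneForm.Smooth.of_twoTensor hg hk) (hk x).diffAt hv
  simp only [FiberBundle.extend_apply_self] at h1 h2
  rw [h1, h2]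
  simp [hunit, dirDeriv_const]

/-- For a geodesic field `k` of constant length, `dk^♭(k, ·) = 0`. -/
lemma IsGeodesic.extDerivOne_eq_zero (hgeo : IsGeodesic g k) (hg : g.Smooth)
    (hs : ∀ x u v, g x u v = g x v u) (hn : ∀ x u, (∀ v, g x u v = 0) → u = 0)
    (hk : ∀ x, k.SmoothAt x) {c : ℝ} (hunit : ∀ x, g x (k x) (k x) = c) (x : N)
    (v : TangentSpace I x) : extDerivOne (fun y ↦ g y (k y)) x (k x) v = 0 := by
  have h1 := leviCivita_spec hg hs hn hk (k x) v
  rw [hgeo x, lieForm_self_left hg hs hk hunit] at h1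
  simp at h1
  linarith

/-- The shear vanishes iff the flow of the field is conformal on the orthogonal complement. -/
lemma shear_eq_zero_iff (hg : g.Smooth) (hs : ∀ x u v, g x u v = g x v u)
    (hn : ∀ x u, (∀ v, g x u v = 0) → u = 0) (hk : ∀ x, k.SmoothAt x)
    {V : (x : N) → Submodule ℝ (TangentSpace I x)} {x : N}
    (hc : IsCompl ((g x).toBilinForm.orthogonal (V x)) (V x))
    (hpos : ∀ v ∈ (g x).toBilinForm.orthogonal (V x), v ≠ 0 → 0 < g x v v) :
    shear g V k x = 0 ↔ ∃ c : ℝ, ∀ v ∈ (g x).toBilinForm.orthogonal (V x),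
      ∀ z ∈ (g x).toBilinForm.orthogonal (V x), lieForm g k x v z = c * g x v z := by
  have : FiniteDimensional ℝ (TangentSpace I x) := inferInstanceAs (FiniteDimensional ℝ E)
  rw [shear, shearPart_eq_zero_iff (b := (g x).toBilinForm) (hs x) hc hpos]
  have h1 (v z : TangentSpace I x) :
      g x (leviCivita g k x v) z + g x v (leviCivita g k x z) = lieForm g k x v z := by
    have h1 := leviCivita_spec hg hs hn hk v z
    have h2 := leviCivita_spec hg hs hn hk z v
    rw [extDerivOne_swap v z, lieForm_swap hs z v, hs] at h2
    linarith
  refine exists_congr fun c ↦ ?_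
  refine forall₄_congr fun v _ z _ ↦ ?_
  rw [← h1]
  rfl

/-- The skew part of `g(∇_v k, z)` is half of `dk^♭(v, z)`, so a nonzero twist function forces
`dk^♭` to be nonzero on the complement. -/
lemma exists_extDerivOne_ne_zero (hg : g.Smooth) (hs : ∀ x u v, g x u v = g x v u)
    (hn : ∀ x u, (∀ v, g x u v = 0) → u = 0) (hk : ∀ x, k.SmoothAt x)
    {V : (x : N) → Submodule ℝ (TangentSpace I x)} {x : N}
    (hc : IsCompl ((g x).toBilinForm.orthogonal (V x)) (V x))
    (hpos : ∀ v ∈ (g x).toBilinForm.orthogonal (V x), v ≠ 0 → 0 < g x v v)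
    (hfr : finrank ℝ ((g x).toBilinForm.orthogonal (V x)) ≠ 0)
    (htw : twistFunction g V k x ≠ 0) :
    ∃ v ∈ (g x).toBilinForm.orthogonal (V x), ∃ z ∈ (g x).toBilinForm.orthogonal (V x),
      extDerivOne (fun y ↦ g y (k y)) x v z ≠ 0 := by
  have : FiniteDimensional ℝ (TangentSpace I x) := inferInstanceAs (FiniteDimensional ℝ E)
  have hdet : LinearMap.det (twistPart (g x).toBilinForm (V x) (leviCivita g k x)) ≠ 0 := by
    intro h
    apply htw
    simp [twistFunction, twist, h]
  obtain ⟨v, hv, z, hz, h⟩ := exists_of_det_twistPart_ne_zero (b := (g x).toBilinForm) (hs x) hc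
    hpos _ hfr hdet
  refine ⟨v, hv, z, hz, fun h0 ↦ h ?_⟩
  have h1 := leviCivita_spec hg hs hn hk v z
  have h2 := leviCivita_spec hg hs hn hk z v
  rw [extDerivOne_swap v z, lieForm_swap hs z v, hs] at h2
  change g x (leviCivita g k x v) z - g x v (leviCivita g k x z) = 0
  linarith

lemma VField.SmoothAt.normalize (hg : g.Smooth) (hpos : ∀ x u, u ≠ 0 → 0 < g x u u) {x : N}
    {X : VField I N} (hX : X.SmoothAt x) (hx : X x ≠ 0) :
    VField.SmoothAt (fun y ↦ (√(g y (X y) (X y)))⁻¹ • X y) x ∧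
      ∀ᶠ y in 𝓝 x, 0 < g y (X y) (X y) := by
  have h1 : ContMDiffAt I 𝓘(ℝ, ℝ) ∞ (fun y ↦ g y (X y) (X y)) x :=
    hg.contMDiffAt hX.contAt hX.contAt
  have hp := hpos x _ hx
  have h2 : ContMDiffAt I 𝓘(ℝ, ℝ) ∞ (fun y ↦ (√(g y (X y) (X y)))⁻¹) x := by
    have : ContDiffAt ℝ ∞ (fun s : ℝ ↦ (√s)⁻¹) (g x (X x) (X x)) :=
      (Real.contDiffAt_sqrt hp.ne').inv (Real.sqrt_ne_zero'.2 hp)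
    exact ContMDiffAt.comp (g := fun s : ℝ ↦ (√s)⁻¹) x this.contMDiffAt h1
  exact ⟨hX.contAt.smul h2, h1.continuousAt.eventually (lt_mem_nhds hp)⟩

/-- Near each point, a unit field with nondegenerate `dk^♭` on its orthogonal complement can be
completed to a smooth orthonormal frame `(k, E₁, E₂)` with `dk^♭(E₁, E₂) > 0`. -/
lemma exists_orthonormalTriple (hg : g.Smooth)
    (hpos : ∀ x u, u ≠ 0 → 0 < g x u u) (hk : ∀ x, k.SmoothAt x)
    (hunit : ∀ x, g x (k x) (k x) = 1) {x : N} {v z : TangentSpace I x} (hv : g x (k x) v = 0)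
    (hz : g x (k x) z = 0) (hvz : extDerivOne (fun y ↦ g y (k y)) x v z ≠ 0) :
    ∃ E₁ E₂ : VField I N, E₁.SmoothAt x ∧ E₂.SmoothAt x ∧
      ∀ᶠ y in 𝓝 x, IsOrthonormalTriple (g y) (k y) (E₁ y) (E₂ y) ∧
        0 < extDerivOne (fun y ↦ g y (k y)) y (E₁ y) (E₂ y) := by
  -- Exchanging `v` and `z` changes the sign of `dk^♭(v, z)`.
  wlog hlt : 0 < extDerivOne (fun y ↦ g y (k y)) x v z generalizing v z
  · rw [not_lt] at hlt
    refine this hz hv ?_ ?_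
    · rwa [extDerivOne_swap v z, neg_ne_zero]
    · rw [extDerivOne_swap v z, neg_pos]
      exact lt_of_le_of_ne hlt hvz
  have hα := OneForm.Smooth.of_twoTensor hg hk
  set Ω := extDerivForm _ hα x with hΩdef
  have hΩ (u v : TangentSpace I x) : extDerivOne (fun y ↦ g y (k y)) x u v = Ω u v := rfl
  have hΩs (u : TangentSpace I x) : Ω u u = 0 := extDerivOne_self u
  rw [hΩ] at hlt
  have hproj (u : TangentSpace I x) (hu : g x (k x) u = 0) : ∃ X : VField I N, X.SmoothAt x ∧
      X x = u ∧ ∀ y, g y (k y) (X y) = 0 := by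
    refine ⟨FiberBundle.extend E u - (fun y ↦ g y (k y) (FiberBundle.extend E u y)) • k,
      (VField.smoothAt_extend u).contAt.sub
        ((hk x).contAt.smul (hg.contMDiffAt (hk x).contAt (VField.smoothAt_extend u).contAt)),
      ?_, fun y ↦ ?_⟩
    · simp [hu]
    · simp [hunit]
  obtain ⟨X, hX, hXx, hXk⟩ := hproj v hv
  obtain ⟨Z, hZ, hZx, hZk⟩ := hproj z hz
  have hX0 : X x ≠ 0 := by
    rintro h
    rw [← hXx, h] at hlt
    simp at hlt
  obtain ⟨hE₁, hXpos⟩ := hX.normalize hg hpos hX0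
  set E₁ : VField I N := fun y ↦ (√(g y (X y) (X y)))⁻¹ • X y with hE₁def
  set W : VField I N := Z - (fun y ↦ g y (E₁ y) (Z y)) • E₁ with hWdef
  have hW : W.SmoothAt x := hZ.contAt.sub (hE₁.contAt.smul (hg.contMDiffAt hE₁.contAt hZ.contAt))
  have hWk (y : N) : g y (k y) (W y) = 0 := by
    simp [hWdef, hE₁def, hXk, hZk]
  -- Gram–Schmidt keeps the sign: it rescales by positive factors and subtracts a multiple of `E₁`,
  -- on which `Ω(E₁, ·)` vanishes. This also shows that `W` is nonzero at `x`.
  have hΩW : 0 < Ω (E₁ x) (W x) := by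
    have hp := Real.sqrt_pos.2 hXpos.self_of_nhds
    simp only [hWdef, hE₁def, Pi.sub_apply, Pi.smul_apply', map_sub, map_smul, hXx, hZx, hΩs,
      _root_.smul_apply, smul_eq_mul]
    rw [hXx] at hp
    have := mul_pos (inv_pos.2 hp) hlt
    simpa using this
  have hW0 : W x ≠ 0 := by
    rintro h
    rw [h] at hΩW
    simp at hΩW
  obtain ⟨hE₂, hWpos⟩ := hW.normalize hg hpos hW0
  refine ⟨E₁, _, hE₁, hE₂, ?_⟩
  have hcont := (contMDiffAt_extDerivOne hα hE₁ hE₂).continuousAt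
  have hev := hcont.eventually (lt_mem_nhds (a := 0) ?_)
  · filter_upwards [hXpos, hWpos, hev] with y h1 h2 h3
    have hnorm {s : ℝ} (hs : 0 < s) : (√s)⁻¹ * ((√s)⁻¹ * s) = 1 := by
      have := Real.sqrt_pos.2 hs
      field_simp
      rw [Real.sq_sqrt hs.le]
    have h11 : g y (E₁ y) (E₁ y) = 1 := by
      simp only [hE₁def, map_smul, _root_.smul_apply, smul_eq_mul]
      exact hnorm h1
    have h1W : g y (E₁ y) (W y) = 0 := by
      simp [hWdef, h11]
    refine ⟨⟨hunit y, ?_, ?_, h11, ?_, ?_⟩, h3⟩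
    · simp [hE₁def, hXk]
    · simp [hWk]
    · simp [h1W]
    · simp only [map_smul, _root_.smul_apply, smul_eq_mul]
      exact hnorm h2
  · change 0 < Ω (E₁ x) _
    rw [map_smul, smul_eq_mul]
    exact mul_pos (inv_pos.2 (Real.sqrt_pos.2 hWpos.self_of_nhds)) hΩW

end Twisting

/-! ### Adapted systems: orientation, integrability and the Kähler metric -/

section AdaptedSystem

open VectorField Module

section

variable {T : Type*} [AddCommGroup T] [Module ℝ T] [TopologicalSpace T]
  [IsTopologicalAddGroup T] [ContinuousSMul ℝ T]
  {b : T →L[ℝ] T →L[ℝ] ℝ} {k t e₁ e₂ : T} {A B : T →L[ℝ] ℝ}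

namespace IsAdaptedFrame

lemma isCompl (h : IsAdaptedFrame b k t e₁ e₂ A B) :
    IsCompl (b.toBilinForm.orthogonal (Submodule.span ℝ {k, t})) (Submodule.span ℝ {k, t}) := by
  constructor
  · rw [Submodule.disjoint_def]
    intro u hu hu'
    obtain ⟨h1, h2⟩ := (h.mem_iff u).1 hu
    obtain ⟨x, y, rfl⟩ := Submodule.mem_span_pair.1 hu'
    simp [h.A_k, h.A_t] at h1
    simp [h.B_k, h.B_t] at h2
    simp [h1, h2]
  · rw [codisjoint_iff, eq_top_iff]
    intro u _
    rw [Submodule.mem_sup]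
    refine ⟨b e₁ u • e₁ + b e₂ u • e₂,
      add_mem (Submodule.smul_mem _ _ h.mem_e₁) (Submodule.smul_mem _ _ h.mem_e₂),
      A u • k + B u • t, Submodule.mem_span_pair.2 ⟨_, _, rfl⟩, ?_⟩
    nth_rw 5 [h.expand u]
    abel

lemma linearIndependent_pair (h : IsAdaptedFrame b k t e₁ e₂ A B) :
    LinearIndependent ℝ ![k, t] := by
  rw [LinearIndependent.pair_iff]
  intro x y hxy
  have h1 := congrArg A hxy
  have h2 := congrArg B hxy
  simp [h.A_k, h.A_t] at h1
  simp [h.B_k, h.B_t] at h2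
  exact ⟨h1, h2⟩

lemma complexStructure_k (h : IsAdaptedFrame b k t e₁ e₂ A B) : h.complexStructure k = t :=
  h.isSplitComplexStructure.map_k

lemma complexStructure_t (h : IsAdaptedFrame b k t e₁ e₂ A B) : h.complexStructure t = -k :=
  h.isSplitComplexStructure.map_t

lemma complexStructure_e₁ (h : IsAdaptedFrame b k t e₁ e₂ A B) : h.complexStructure e₁ = e₂ := by
  simp [complexStructure_apply, h.A_e₁, h.B_e₁, h.e₁_e₁, h.e₂_e₁]

lemma complexStructure_e₂ (h : IsAdaptedFrame b k t e₁ e₂ A B) : h.complexStructure e₂ = -e₁ := by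
  simp [complexStructure_apply, h.A_e₂, h.B_e₂, h.e₁_e₂, h.e₂_e₂]

lemma complexStructure_sq (h : IsAdaptedFrame b k t e₁ e₂ A B) (u : T) :
    h.complexStructure (h.complexStructure u) = -u := by
  conv_rhs => rw [h.expand u]
  rw [h.complexStructure_apply u]
  simp only [map_add, map_sub, map_smul, complexStructure_k, complexStructure_t,
    complexStructure_e₁, complexStructure_e₂]
  module

lemma A_complexStructure (h : IsAdaptedFrame b k t e₁ e₂ A B) (u : T) :
    A (h.complexStructure u) = - B u := by
  simp [complexStructure_apply, h.A_k, h.A_t, h.A_e₁, h.A_e₂]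

lemma B_complexStructure (h : IsAdaptedFrame b k t e₁ e₂ A B) (u : T) :
    B (h.complexStructure u) = A u := by
  simp [complexStructure_apply, h.B_k, h.B_t, h.B_e₁, h.B_e₂]

lemma e₁_complexStructure (h : IsAdaptedFrame b k t e₁ e₂ A B) (u : T) :
    b e₁ (h.complexStructure u) = - b e₂ u := by
  simp [complexStructure_apply, h.e₁_k, h.e₁_t, h.e₁_e₁, h.e₁_e₂]

lemma e₂_complexStructure (h : IsAdaptedFrame b k t e₁ e₂ A B) (u : T) :
    b e₂ (h.complexStructure u) = b e₁ u := by
  simp [complexStructure_apply, h.e₂_k, h.e₂_t, h.e₂_e₁, h.e₂_e₂]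

/-- A skew form which vanishes on `k` and `t` is a multiple of `e₁ ∧ e₂`. -/
lemma skew_eq (h : IsAdaptedFrame b k t e₁ e₂ A B) {Ω : T →L[ℝ] T →L[ℝ] ℝ}
    (hs : ∀ u v, Ω v u = - Ω u v) (hk : ∀ v, Ω k v = 0) (ht : ∀ v, Ω t v = 0) (u v : T) :
    Ω u v = (b e₁ u * b e₂ v - b e₂ u * b e₁ v) * Ω e₁ e₂ := by
  have hk' (v) : Ω v k = 0 := by rw [hs, hk, neg_zero]
  have ht' (v) : Ω v t = 0 := by rw [hs, ht, neg_zero]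
  have hself (v) : Ω v v = 0 := by have := hs v v; linarith
  nth_rw 1 [h.expand u, h.expand v]
  simp [hk, ht, hk', ht', hself]
  rw [hs e₁ e₂]
  ring

/-- The open unit ball of a multiple of the standard form of an adapted frame is bounded. -/
lemma isVonNBounded (h : IsAdaptedFrame b k t e₁ e₂ A B) {c d : ℝ} (hc : 0 < c) (hd : 0 < d) :
    Bornology.IsVonNBounded ℝ {u : T | c * (A u ^ 2 + B u ^ 2)
      + d * (b e₁ u ^ 2 + b e₂ u ^ 2) < 1} := by
  let L : (Fin 4 → ℝ) →L[ℝ] T :=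
    (ContinuousLinearMap.proj 0).smulRight k + (ContinuousLinearMap.proj 1).smulRight t
      + (ContinuousLinearMap.proj 2).smulRight e₁ + (ContinuousLinearMap.proj 3).smulRight e₂
  have hb : Bornology.IsVonNBounded ℝ
      (Metric.closedBall (0 : Fin 4 → ℝ) (1 / c + 1 / d + 1)) := by
    rw [NormedSpace.isVonNBounded_iff]
    exact Metric.isBounded_closedBall
  refine (hb.image L).subset fun u hu ↦ ?_
  -- Each coordinate has square at most `r = 1/c + 1/d`, hence absolute value at most `r + 1`; the
  -- summand `1` avoids a square root.
  refine ⟨![A u, B u, b e₁ u, b e₂ u], ?_, ?_⟩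
  · rw [Set.mem_ofPred_eq] at hu
    rw [mem_closedBall_zero_iff, pi_norm_le_iff_of_nonneg (by positivity)]
    have h1 : 0 < 1 / c := by positivity
    have h2 : 0 < 1 / d := by positivity
    have key {s : ℝ} (hs : s ^ 2 ≤ 1 / c + 1 / d) : ‖s‖ ≤ 1 / c + 1 / d + 1 := by
      rw [Real.norm_eq_abs]
      exact abs_le_of_sq_le_sq (by nlinarith) (by positivity)
    have h3 : A u ^ 2 + B u ^ 2 ≤ 1 / c := by
      rw [le_div_iff₀ hc]
      nlinarith [sq_nonneg (b e₁ u), sq_nonneg (b e₂ u)]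
    have h4 : b e₁ u ^ 2 + b e₂ u ^ 2 ≤ 1 / d := by
      rw [le_div_iff₀ hd]
      nlinarith [sq_nonneg (A u), sq_nonneg (B u)]
    intro i
    fin_cases i <;> apply key <;> simp <;>
      nlinarith [sq_nonneg (b e₁ u), sq_nonneg (b e₂ u), sq_nonneg (A u), sq_nonneg (B u),
        one_div c, one_div d]
  · simp only [L]
    exact (h.expand u).symm

end IsAdaptedFrame

end

variable {E : Type*} [NormedAddCommGroup E] [NormedSpace ℝ E] [FiniteDimensional ℝ E]
  {H : Type*} [TopologicalSpace H] {I : ModelWithCorners ℝ E H}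
  {M : Type*} [TopologicalSpace M] [ChartedSpace H M] [IsManifold I ∞ M]

/-- Vector fields `k`, `t` with coordinate forms `A`, `B` and a 1-form `α` such that `dα` vanishes
on `k` and `t`, and such that locally there are smooth adapted frames positive for `dα`. -/
structure IsAdaptedSystem (g : TwoTensor I M) (k t : VField I M) (A B α : OneForm I M) :
    Prop where
  smooth_g : g.Smooth
  nondegenerate : ∀ x u, (∀ v, g x u v = 0) → u = 0
  smooth_k : ∀ x, k.SmoothAt x
  smooth_t : ∀ x, t.SmoothAt x
  smooth_A : A.Smooth
  smooth_B : B.Smooth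
  smooth_α : α.Smooth
  ext_k : ∀ x v, extDerivOne α x (k x) v = 0
  ext_t : ∀ x v, extDerivOne α x (t x) v = 0
  exists_frame : ∀ x, ∃ e₁ e₂ : VField I M, e₁.SmoothAt x ∧ e₂.SmoothAt x ∧
    ∀ᶠ y in 𝓝 x, IsAdaptedFrame (g y) (k y) (t y) (e₁ y) (e₂ y) (A y) (B y) ∧
      0 < extDerivOne α y (e₁ y) (e₂ y)

namespace IsAdaptedSystem

variable {g : TwoTensor I M} {k t : VField I M} {A B α β : OneForm I M} {x : M}

lemma exists_frame_at (h : IsAdaptedSystem g k t A B α) (x : M) :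
    ∃ e : TangentSpace I x × TangentSpace I x,
      IsAdaptedFrame (g x) (k x) (t x) e.1 e.2 (A x) (B x) ∧ 0 < extDerivOne α x e.1 e.2 := by
  obtain ⟨e₁, e₂, -, -, he⟩ := h.exists_frame x
  exact ⟨(e₁ x, e₂ x), he.self_of_nhds⟩

lemma symm (h : IsAdaptedSystem g k t A B α) (x : M) (u v : TangentSpace I x) :
    g x u v = g x v u := by
  obtain ⟨e, he, -⟩ := h.exists_frame_at x
  exact he.symm u v

lemma extDerivOne_frame (h : IsAdaptedSystem g k t A B α) {e₁ e₂ : TangentSpace I x}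
    (hf : IsAdaptedFrame (g x) (k x) (t x) e₁ e₂ (A x) (B x)) (u v : TangentSpace I x) :
    extDerivOne α x u v = (g x e₁ u * g x e₂ v - g x e₂ u * g x e₁ v) * extDerivOne α x e₁ e₂ :=
  hf.skew_eq (Ω := extDerivForm α h.smooth_α x) (fun u v ↦ extDerivOne_swap u v) (h.ext_k x)
    (h.ext_t x) u v

/-- On `H` the form `dα` is a multiple of the area form, so the planar determinant between two
frames is the ratio of the values of `dα` on them. Therefore a pointwise choice of positive frames
gives a well-defined orientation. -/
lemma orientation_congr (h : IsAdaptedSystem g k t A B α) {e₁ e₂ a₁ a₂ : TangentSpace I x}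
    (he : IsAdaptedFrame (g x) (k x) (t x) e₁ e₂ (A x) (B x)) (hpos : 0 < extDerivOne α x e₁ e₂)
    (ha : IsAdaptedFrame (g x) (k x) (t x) a₁ a₂ (A x) (B x)) (hpos' : 0 < extDerivOne α x a₁ a₂) :
    he.basis.orientation = ha.basis.orientation := by
  rw [ha.orientation_eq_iff he.mem_e₁ he.mem_e₂ he.coe_basis]
  rw [h.extDerivOne_frame ha] at hpos
  exact pos_of_mul_pos_left hpos hpos'.le

/-- The orientation for which the adapted frames positive for `dα` are positively oriented. -/
def orientation (h : IsAdaptedSystem g k t A B α) : ManifoldOrientation I M where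
  orient x := (h.exists_frame_at x).choose_spec.1.basis.orientation
  exists_frame x := by
    obtain ⟨e₁, e₂, h₁, h₂, he⟩ := h.exists_frame x
    refine ⟨![k, t, e₁, e₂], fun i ↦ ?_, ?_⟩
    · fin_cases i
      exacts [h.smooth_k x, h.smooth_t x, h₁, h₂]
    · filter_upwards [he] with y hy
      refine ⟨hy.1.basis, fun i ↦ ?_,
        h.orientation_congr hy.1 hy.2 _ (h.exists_frame_at y).choose_spec.2⟩
      rw [hy.1.coe_basis]
      fin_cases i <;> rfl

lemma almostComplex_eq (h : IsAdaptedSystem g k t A B α) {e₁ e₂ : TangentSpace I x}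
    (he : IsAdaptedFrame (g x) (k x) (t x) e₁ e₂ (A x) (B x)) (hpos : 0 < extDerivOne α x e₁ e₂) :
    almostComplex g h.orientation k t x = he.complexStructure := by
  rw [← he.splitComplexStructure_eq, h.orientation_congr he hpos
    (h.exists_frame_at x).choose_spec.1 (h.exists_frame_at x).choose_spec.2]
  rfl

lemma almostComplex_sq (h : IsAdaptedSystem g k t A B α) (x : M) (v : TangentSpace I x) :
    almostComplex g h.orientation k t x (almostComplex g h.orientation k t x v) = -v := by
  obtain ⟨e, he, hpos⟩ := h.exists_frame_at x
  rw [h.almostComplex_eq he hpos, he.complexStructure_sq]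

/-- Although `J` is defined by choice at each point, near `x` it is given by one smooth frame; its
regularity is read off from this formula. -/
lemma almostComplex_eventuallyEq (h : IsAdaptedSystem g k t A B α) {e₁ e₂ X : VField I M}
    (he : ∀ᶠ y in 𝓝 x, IsAdaptedFrame (g y) (k y) (t y) (e₁ y) (e₂ y) (A y) (B y) ∧
      0 < extDerivOne α y (e₁ y) (e₂ y)) :
    (fun y ↦ almostComplex g h.orientation k t y (X y)) =ᶠ[𝓝 x]
      (fun y ↦ A y (X y)) • t + -((fun y ↦ B y (X y)) • k) +
        (fun y ↦ g y (e₁ y) (X y)) • e₂ + -((fun y ↦ g y (e₂ y) (X y)) • e₁) := by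
  filter_upwards [he] with y hy
  rw [h.almostComplex_eq hy.1 hy.2, hy.1.complexStructure_apply]
  simp only [Pi.add_apply, Pi.neg_apply, Pi.smul_apply']
  abel

lemma almostComplex_smoothAt (h : IsAdaptedSystem g k t A B α) {X : VField I M}
    (hX : X.SmoothAt x) :
    VField.SmoothAt (fun y ↦ almostComplex g h.orientation k t y (X y)) x := by
  obtain ⟨e₁, e₂, h₁, h₂, he⟩ := h.exists_frame x
  have h1 : VField.SmoothAt ((fun y ↦ A y (X y)) • t + -((fun y ↦ B y (X y)) • k) +
        (fun y ↦ g y (e₁ y) (X y)) • e₂ + -((fun y ↦ g y (e₂ y) (X y)) • e₁)) x :=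
    ((((h.smooth_t x).contAt.smul (h.smooth_A.contMDiffAt hX.contAt)).add
      ((h.smooth_k x).contAt.smul (h.smooth_B.contMDiffAt hX.contAt)).neg).add
      (h₂.contAt.smul (h.smooth_g.contMDiffAt h₁.contAt hX.contAt))).add
      (h₁.contAt.smul (h.smooth_g.contMDiffAt h₂.contAt hX.contAt)).neg
  refine ContMDiffAt.congr_of_eventuallyEq h1 ?_
  filter_upwards [h.almostComplex_eventuallyEq (X := X) he] with y hy
  rw [hy]

lemma almostComplex_diffAt (h : IsAdaptedSystem g k t A B α) {X : VField I M}
    (hX : X.DiffAt x) :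
    VField.DiffAt (fun y ↦ almostComplex g h.orientation k t y (X y)) x := by
  obtain ⟨e₁, e₂, h₁, h₂, he⟩ := h.exists_frame x
  have h1 : VField.DiffAt ((fun y ↦ A y (X y)) • t + -((fun y ↦ B y (X y)) • k) +
        (fun y ↦ g y (e₁ y) (X y)) • e₂ + -((fun y ↦ g y (e₂ y) (X y)) • e₁)) x :=
    ((((h.smooth_t x).diffAt.smul (h.smooth_A.mdifferentiableAt hX)).add
      ((h.smooth_k x).diffAt.smul (h.smooth_B.mdifferentiableAt hX)).neg).add
      (h₂.diffAt.smul (h.smooth_g.mdifferentiableAt h₁.diffAt hX))).add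
      (h₁.diffAt.smul (h.smooth_g.mdifferentiableAt h₂.diffAt hX)).neg
  refine MDifferentiableAt.congr_of_eventuallyEq h1 ?_
  filter_upwards [h.almostComplex_eventuallyEq (X := X) he] with y hy
  rw [hy]

section Integrability

/-- If the flow of `Z` is conformal on the orthogonal complement of `k`, `t` and preserves it, then
it commutes with the complex structure. -/
lemma mlieBracket_frame (h : IsAdaptedSystem g k t A B α) {Z e₁ e₂ : VField I M}
    (h₁ : e₁.SmoothAt x) (h₂ : e₂.SmoothAt x)
    (he : ∀ᶠ y in 𝓝 x, IsAdaptedFrame (g y) (k y) (t y) (e₁ y) (e₂ y) (A y) (B y) ∧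
      0 < extDerivOne α y (e₁ y) (e₂ y))
    (hbr : ∀ (X : VField I M), X.SmoothAt x →
      (∀ᶠ y in 𝓝 x, X y ∈ (g y).toBilinForm.orthogonal (pairSpan k t y)) →
      mlieBracket I Z X x ∈ (g x).toBilinForm.orthogonal (pairSpan k t x))
    (hZ : ∃ c : ℝ, ∀ v ∈ (g x).toBilinForm.orthogonal (pairSpan k t x),
      ∀ z ∈ (g x).toBilinForm.orthogonal (pairSpan k t x), lieForm g Z x v z = c * g x v z) :
    mlieBracket I Z e₂ x = almostComplex g h.orientation k t x (mlieBracket I Z e₁ x) := by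
  obtain ⟨hx, hpos⟩ := he.self_of_nhds
  obtain ⟨c, hc⟩ := hZ
  have b₁ := hbr e₁ h₁ (he.mono fun y hy ↦ hy.1.mem_e₁)
  have b₂ := hbr e₂ h₂ (he.mono fun y hy ↦ hy.1.mem_e₂)
  have hl {X Y : VField I M} (hX : X.SmoothAt x) (hY : Y.SmoothAt x) (d : ℝ)
      (hd : ∀ᶠ y in 𝓝 x, g y (X y) (Y y) = d) :
      lieForm g Z x (X x) (Y x) =
        - g x (mlieBracket I Z X x) (Y x) - g x (X x) (mlieBracket I Z Y x) := by
    rw [lieForm_eq h.smooth_g h.symm hX.diffAt hY.diffAt, dirDeriv_congr hd, dirDeriv_const]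
    ring
  -- The inner products of the frame are constant, so conformality constrains the matrix of `[Z, ·]`
  -- in the frame: equal diagonal entries and opposite off-diagonal ones, as for multiplication by a
  -- complex number.
  have l₁ := hl h₁ h₁ 1 (he.mono fun y hy ↦ hy.1.e₁_e₁)
  have l₂ := hl h₂ h₂ 1 (he.mono fun y hy ↦ hy.1.e₂_e₂)
  have l₃ := hl h₁ h₂ 0 (he.mono fun y hy ↦ hy.1.e₁_e₂)
  rw [hc _ hx.mem_e₁ _ hx.mem_e₁, hx.e₁_e₁, h.symm x (mlieBracket I Z e₁ x)] at l₁
  rw [hc _ hx.mem_e₂ _ hx.mem_e₂, hx.e₂_e₂, h.symm x (mlieBracket I Z e₂ x)] at l₂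
  rw [hc _ hx.mem_e₁ _ hx.mem_e₂, hx.e₁_e₂, h.symm x (mlieBracket I Z e₁ x)] at l₃
  rw [h.almostComplex_eq hx hpos, hx.expand_of_mem b₂, hx.complexStructure_apply,
    ((hx.mem_iff _).1 b₁).1, ((hx.mem_iff _).1 b₁).2,
    show g x (e₁ x) (mlieBracket I Z e₂ x) = - g x (e₂ x) (mlieBracket I Z e₁ x) by linarith,
    show g x (e₂ x) (mlieBracket I Z e₂ x) = g x (e₁ x) (mlieBracket I Z e₁ x) by linarith]
  module

variable (hbr : ∀ (x : M) (X : VField I M), X.SmoothAt x →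
    (∀ᶠ y in 𝓝 x, X y ∈ (g y).toBilinForm.orthogonal (pairSpan k t y)) →
    mlieBracket I k X x ∈ (g x).toBilinForm.orthogonal (pairSpan k t x) ∧
    mlieBracket I t X x ∈ (g x).toBilinForm.orthogonal (pairSpan k t x))
  (hck : ∀ x, ∃ c : ℝ, ∀ v ∈ (g x).toBilinForm.orthogonal (pairSpan k t x),
    ∀ z ∈ (g x).toBilinForm.orthogonal (pairSpan k t x), lieForm g k x v z = c * g x v z)
  (hct : ∀ x, ∃ c : ℝ, ∀ v ∈ (g x).toBilinForm.orthogonal (pairSpan k t x),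
    ∀ z ∈ (g x).toBilinForm.orthogonal (pairSpan k t x), lieForm g t x v z = c * g x v z)

include hbr hck hct in
/-- The almost complex structure of an adapted system is integrable if the flows of `k` and `t` are
conformal on the orthogonal complement of `k`, `t` and preserve it. -/
lemma isComplexStructure (h : IsAdaptedSystem g k t A B α) :
    IsComplexStructure (almostComplex g h.orientation k t) where
  smooth := contMDiff_endField fun _ _ hX ↦ h.almostComplex_smoothAt hX
  sq := h.almostComplex_sq
  integrable x X Y hX hY := by
    obtain ⟨e₁, e₂, h₁, h₂, he⟩ := h.exists_frame x
    obtain ⟨hx, hpos⟩ := he.self_of_nhds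
    have hJk (y : M) : almostComplex g h.orientation k t y (k y) = t y := by
      obtain ⟨e, he, hpos⟩ := h.exists_frame_at y
      rw [h.almostComplex_eq he hpos, he.complexStructure_k]
    have hJe : ∀ᶠ y in 𝓝 x, almostComplex g h.orientation k t y (e₁ y) = e₂ y := by
      filter_upwards [he] with y hy
      rw [h.almostComplex_eq hy.1 hy.2, hy.1.complexStructure_e₁]
    refine nijenhuis_eq_zero (fun X hX ↦ h.almostComplex_diffAt hX) h.almostComplex_sq
      (h.smooth_k x).diffAt h₁.diffAt (fun u ↦ ?_) ?_ hX.diffAt hY.diffAt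
    · rw [hJk, hJe.self_of_nhds]
      exact ⟨_, _, _, _, hx.expand u⟩
    -- `N(k, e₁) = [t, e₂] - J[t, e₁] - J[k, e₂] - [k, e₁]`. The first two terms cancel by `[t, e₂]
    -- = J[t, e₁]`, the last two by `[k, e₂] = J[k, e₁]` and `J² = -1`.
    · simp only [nijenhuis, hJk]
      rw [Filter.EventuallyEq.mlieBracket_vectorField_eq (Filter.EventuallyEq.refl _ t) hJe,
        Filter.EventuallyEq.mlieBracket_vectorField_eq (Filter.EventuallyEq.refl _ k) hJe,
        h.mlieBracket_frame h₁ h₂ he (fun X hX hH ↦ (hbr x X hX hH).2) (hct x),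
        h.mlieBracket_frame h₁ h₂ he (fun X hX hH ↦ (hbr x X hX hH).1) (hck x),
        h.almostComplex_sq]
      abel

include hbr hck hct in
lemma isAdmissibleComplexStructure (h : IsAdaptedSystem g k t A B α) :
    IsAdmissibleComplexStructure g h.orientation k t where
  linearIndependent x := by
    obtain ⟨e, he, -⟩ := h.exists_frame_at x
    exact he.linearIndependent_pair
  spacelike x v hv hne := by
    obtain ⟨e, he, -⟩ := h.exists_frame_at x
    exact he.pos_of_mem hv hne
  bracket := hbr
  shear_eq x v := by
    obtain ⟨e, he, -⟩ := h.exists_frame_at x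
    -- Both flows are conformal on `H`, so both shear operators are zero.
    rw [(shear_eq_zero_iff h.smooth_g h.symm h.nondegenerate h.smooth_k he.isCompl
        fun v hv hne ↦ he.pos_of_mem hv hne).2 (hck x),
      (shear_eq_zero_iff h.smooth_g h.symm h.nondegenerate h.smooth_t he.isCompl
        fun v hv hne ↦ he.pos_of_mem hv hne).2 (hct x)]
    simp

end Integrability

section Kahler

variable {c d : M → ℝ}

/-- The value of `dβ(·, J·)` in terms of an adapted frame. -/
lemma extDerivOne_almostComplex (h : IsAdaptedSystem g k t A B α)
    (hβ : ∀ x u v, extDerivOne β x u v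
      = c x * (A x u * B x v - B x u * A x v) + d x * extDerivOne α x u v)
    {e₁ e₂ : TangentSpace I x} (he : IsAdaptedFrame (g x) (k x) (t x) e₁ e₂ (A x) (B x))
    (hpos : 0 < extDerivOne α x e₁ e₂) (u v : TangentSpace I x) :
    extDerivOne β x u (almostComplex g h.orientation k t x v)
      = c x * (A x u * A x v + B x u * B x v) + d x * extDerivOne α x e₁ e₂ *
        (g x e₁ u * g x e₁ v + g x e₂ u * g x e₂ v) := by
  rw [h.almostComplex_eq he hpos, hβ, h.extDerivOne_frame he, he.A_complexStructure,
    he.B_complexStructure, he.e₁_complexStructure, he.e₂_complexStructure]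
  ring

/-- The Kähler metric `dβ(·, J·)` of an adapted system. -/
def kahlerMetric (h : IsAdaptedSystem g k t A B α) (hβs : β.Smooth)
    (hc : ∀ x, 0 < c x) (hd : ∀ x, 0 < d x)
    (hβ : ∀ x u v, extDerivOne β x u v
      = c x * (A x u * B x v - B x u * A x v) + d x * extDerivOne α x u v) :
    Bundle.ContMDiffRiemannianMetric I ∞ E (fun x : M ↦ TangentSpace I x) where
  inner x := (ContinuousLinearMap.precomp ℝ (almostComplex g h.orientation k t x)).comp
    (extDerivForm β hβs x)
  symm x u v := by
    obtain ⟨e, he, hpos⟩ := h.exists_frame_at x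
    change extDerivOne β x u (almostComplex g h.orientation k t x v)
      = extDerivOne β x v (almostComplex g h.orientation k t x u)
    rw [h.extDerivOne_almostComplex hβ he hpos, h.extDerivOne_almostComplex hβ he hpos]
    ring
  pos x u hu := by
    obtain ⟨e, he, hpos⟩ := h.exists_frame_at x
    change 0 < extDerivOne β x u (almostComplex g h.orientation k t x u)
    rw [h.extDerivOne_almostComplex hβ he hpos]
    have h1 := hc x
    have h2 := mul_pos (hd x) hpos
    by_contra hcon
    rw [not_lt] at hcon
    have p1 : 0 ≤ c x * (A x u * A x u + B x u * B x u) :=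
      mul_nonneg h1.le (add_nonneg (mul_self_nonneg _) (mul_self_nonneg _))
    have p2 : 0 ≤ d x * extDerivOne α x e.1 e.2 *
      (g x e.1 u * g x e.1 u + g x e.2 u * g x e.2 u) :=
      mul_nonneg h2.le (add_nonneg (mul_self_nonneg _) (mul_self_nonneg _))
    have q1 := (mul_eq_zero.1 (le_antisymm (by linarith) p1)).resolve_left h1.ne'
    have q2 := (mul_eq_zero.1 (le_antisymm (by linarith) p2)).resolve_left h2.ne'
    obtain ⟨r1, r2⟩ := mul_self_add_mul_self_eq_zero.1 q1
    obtain ⟨r3, r4⟩ := mul_self_add_mul_self_eq_zero.1 q2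
    apply hu
    rw [he.expand u, r1, r2, r3, r4]
    simp
  isVonNBounded x := by
    obtain ⟨e, he, hpos⟩ := h.exists_frame_at x
    refine (he.isVonNBounded (hc x) (mul_pos (hd x) hpos)).subset fun u hu ↦ ?_
    have hu' : extDerivOne β x u (almostComplex g h.orientation k t x u) < 1 := hu
    rw [h.extDerivOne_almostComplex hβ he hpos] at hu'
    rw [Set.mem_ofPred_eq]
    simpa only [sq] using hu'
  contMDiff := by
    refine contMDiff_twoTensor fun x X Y hX hY ↦ ?_
    exact contMDiffAt_extDerivOne hβs hX (h.almostComplex_smoothAt hY)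

/-- The metric `dβ(·, J·)` of an adapted system is Kähler if `J` is integrable. -/
lemma isKahlerMetric (h : IsAdaptedSystem g k t A B α) (hβs : β.Smooth)
    (hc : ∀ x, 0 < c x) (hd : ∀ x, 0 < d x)
    (hβ : ∀ x u v, extDerivOne β x u v
      = c x * (A x u * B x v - B x u * A x v) + d x * extDerivOne α x u v)
    (hJ : IsComplexStructure (almostComplex g h.orientation k t)) :
    IsKahlerMetric (h.kahlerMetric hβs hc hd hβ) (almostComplex g h.orientation k t) := by
  have hinner (x : M) (u v : TangentSpace I x) : (h.kahlerMetric hβs hc hd hβ).inner x u v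
      = extDerivOne β x u (almostComplex g h.orientation k t x v) := rfl
  have hherm (x : M) (u v : TangentSpace I x) :
      (h.kahlerMetric hβs hc hd hβ).inner x (almostComplex g h.orientation k t x u)
        (almostComplex g h.orientation k t x v) = (h.kahlerMetric hβs hc hd hβ).inner x u v := by
    obtain ⟨e, he, hpos⟩ := h.exists_frame_at x
    rw [hinner, hinner, h.extDerivOne_almostComplex hβ he hpos,
      h.extDerivOne_almostComplex hβ he hpos, h.almostComplex_eq he hpos, he.A_complexStructure,
      he.B_complexStructure, he.e₁_complexStructure, he.e₂_complexStructure,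
      he.A_complexStructure, he.B_complexStructure, he.e₁_complexStructure,
      he.e₂_complexStructure]
    ring
  refine ⟨hJ, hherm, isClosedTwoForm_extDeriv hβs fun x u v ↦ ?_⟩
  -- By symmetry `h(Ju, v) = h(v, Ju) = dβ(v, J²u) = dβ(u, v)`, so the Kähler form is `dβ` itself.
  change (h.kahlerMetric hβs hc hd hβ).inner x (almostComplex g h.orientation k t x u) v = _
  rw [(h.kahlerMetric hβs hc hd hβ).symm, hinner, h.almostComplex_sq, ← extDerivForm_apply hβs,
    map_neg, extDerivForm_apply, extDerivOne_swap u v, neg_neg]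

end Kahler

end IsAdaptedSystem

end AdaptedSystem

/-! ### Tangent vectors and vector fields of `ℝ × N` -/

section Product

open VectorField Module

variable {E : Type*} [NormedAddCommGroup E] [NormedSpace ℝ E]
  {H : Type*} [TopologicalSpace H] {I : ModelWithCorners ℝ E H}
  {N : Type*} [TopologicalSpace N] [ChartedSpace H N]

/-- The differential of the first coordinate of `ℝ × N`. -/
def timeForm : OneForm (𝓘(ℝ, ℝ).prod I) (ℝ × N) := fun p ↦
  mvfderiv (𝓘(ℝ, ℝ).prod I) (Prod.fst : ℝ × N → ℝ) p

/-- The differential of the projection `ℝ × N → N`. -/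
def spaceProj (p : ℝ × N) : TangentSpace (𝓘(ℝ, ℝ).prod I) p →L[ℝ] TangentSpace I p.2 :=
  mfderiv (𝓘(ℝ, ℝ).prod I) I (Prod.snd : ℝ × N → N) p

lemma warpedMetric_apply (w : ℝ → ℝ) (gN : TwoTensor I N) (p : ℝ × N)
    (u v : TangentSpace (𝓘(ℝ, ℝ).prod I) p) :
    warpedMetric w gN p u v = -(timeForm p u * timeForm p v)
      + w p.1 ^ 2 * gN p.2 (spaceProj p u) (spaceProj p v) := rfl

lemma timeForm_apply (p : ℝ × N) (u : TangentSpace (𝓘(ℝ, ℝ).prod I) p) :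
    timeForm p u = (u : ℝ × E).1 := by
  simp only [timeForm, mvfderiv, mfderiv_fst]
  rfl

lemma spaceProj_apply (p : ℝ × N) (u : TangentSpace (𝓘(ℝ, ℝ).prod I) p) :
    spaceProj p u = (u : ℝ × E).2 := by
  simp only [spaceProj, mfderiv_snd]
  rfl

lemma tangent_ext {p : ℝ × N} {u v : TangentSpace (𝓘(ℝ, ℝ).prod I) p}
    (h₁ : timeForm p u = timeForm p v) (h₂ : spaceProj p u = spaceProj p v) : u = v := by
  rw [timeForm_apply, timeForm_apply] at h₁
  rw [spaceProj_apply, spaceProj_apply] at h₂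
  exact Prod.ext h₁ h₂

lemma timeField_eq (p : ℝ × N) : timeField (I := I) p = ((1, 0) : ℝ × E) := by
  simp only [timeField, mfderiv_prod_left]
  rfl

lemma liftField_eq (X : VField I N) (p : ℝ × N) : liftField X p = ((0, X p.2) : ℝ × E) := by
  simp only [liftField, mfderiv_prod_right]
  rfl

lemma timeForm_timeField (p : ℝ × N) : timeForm p (timeField (I := I) p) = 1 := by
  rw [timeForm_apply, timeField_eq]

lemma spaceProj_timeField (p : ℝ × N) : spaceProj p (timeField (I := I) p) = 0 := by
  rw [spaceProj_apply, timeField_eq]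
  rfl

lemma timeForm_liftField (X : VField I N) (p : ℝ × N) : timeForm p (liftField X p) = 0 := by
  rw [timeForm_apply, liftField_eq]

lemma spaceProj_liftField (X : VField I N) (p : ℝ × N) :
    spaceProj p (liftField X p) = X p.2 := by
  rw [spaceProj_apply, liftField_eq]

lemma dirDeriv_comp_snd {f : N → ℝ} {p : ℝ × N} (hf : MDifferentiableAt I 𝓘(ℝ, ℝ) f p.2)
    (X : VField (𝓘(ℝ, ℝ).prod I) (ℝ × N)) :
    dirDeriv X (fun y ↦ f y.2) p = mvfderiv I f p.2 (spaceProj p (X p)) :=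
  mvfderiv_comp_apply (f := (Prod.snd : ℝ × N → N)) p hf mdifferentiableAt_snd (X p)

lemma dirDeriv_comp_fst {φ : ℝ → ℝ} {p : ℝ × N} (hφ : DifferentiableAt ℝ φ p.1)
    (X : VField (𝓘(ℝ, ℝ).prod I) (ℝ × N)) :
    dirDeriv X (fun y ↦ φ y.1) p = deriv φ p.1 * timeForm p (X p) := by
  have h1 : dirDeriv X (fun y ↦ φ y.1) p = mvfderiv 𝓘(ℝ, ℝ) φ p.1
      (mfderiv (𝓘(ℝ, ℝ).prod I) 𝓘(ℝ, ℝ) (Prod.fst : ℝ × N → ℝ) p (X p)) :=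
    mvfderiv_comp_apply (f := (Prod.fst : ℝ × N → ℝ)) p hφ.mdifferentiableAt
      mdifferentiableAt_fst (X p)
  rw [h1]
  have h2 : mvfderiv 𝓘(ℝ, ℝ) φ p.1 = fderiv ℝ φ p.1 := by
    simp only [mvfderiv, mfderiv_eq_fderiv]
    rfl
  rw [h2]
  change fderiv ℝ φ p.1 (timeForm p (X p)) = _
  rw [fderiv_eq_smul_deriv, smul_eq_mul, mul_comm]

/-- Linear functionals composed with a chart are enough test functions, since the differential of
the chart is invertible. -/
lemma eq_of_mvfderiv_eq [IsManifold I ∞ N] {q : N} {u v : TangentSpace I q}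
    (h : ∀ f : N → ℝ, ContMDiffAt I 𝓘(ℝ, ℝ) ∞ f q → mvfderiv I f q u = mvfderiv I f q v) :
    u = v := by
  have hinv := isInvertible_mfderiv_extChartAt (I := I) (mem_extChartAt_source (I := I) q)
  refine hinv.injective ?_
  refine (SeparatingDual.eq_iff_forall_dual_eq (R := ℝ) (V := E)).2 fun l ↦ ?_
  have hc : ContMDiffAt I 𝓘(ℝ, E) ∞ (extChartAt I q) q := contMDiffAt_extChartAt
  have h1 := h (fun y ↦ l (extChartAt I q y)) (l.contMDiff.contMDiffAt.comp q hc)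
  have h2 (u : TangentSpace I q) : mvfderiv I (fun y ↦ l (extChartAt I q y)) q u
      = l (mfderiv I 𝓘(ℝ, E) (extChartAt I q) q u) := by
    have h3 := mvfderiv_comp_apply (g := l) (f := extChartAt I q) q
      l.differentiableAt.mdifferentiableAt (hc.mdifferentiableAt (by simp)) u
    have h4 : mvfderiv 𝓘(ℝ, E) l (extChartAt I q q) = l := by
      simp only [mvfderiv, mfderiv_eq_fderiv, l.fderiv]
      rfl
    rw [h4] at h3
    exact h3
  rw [h2, h2] at h1
  exact h1

variable [IsManifold I ∞ N]

lemma VField.ContAt.spaceProj {n : ℕ∞} {X : VField (𝓘(ℝ, ℝ).prod I) (ℝ × N)} {p : ℝ × N}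
    (hX : X.ContAt n p) : ContMDiffAt (𝓘(ℝ, ℝ).prod I) I.tangent n
      (fun y ↦ (⟨y.2, spaceProj y (X y)⟩ : TangentBundle I N)) p := by
  have h : ContMDiff (𝓘(ℝ, ℝ).prod I).tangent I.tangent n
      (tangentMap (𝓘(ℝ, ℝ).prod I) I (Prod.snd : ℝ × N → N)) :=
    (contMDiff_snd (n := ∞)).contMDiff_tangentMap (by exact_mod_cast (le_top : n + 1 ≤ ⊤))
  exact h.contMDiffAt.comp p hX

lemma VField.smoothAt_of_prod {a : ℝ × N → ℝ} {Y : (p : ℝ × N) → TangentSpace I p.2} {p : ℝ × N}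
    (ha : ContMDiffAt (𝓘(ℝ, ℝ).prod I) 𝓘(ℝ, ℝ) ∞ a p)
    (hY : ContMDiffAt (𝓘(ℝ, ℝ).prod I) I.tangent ∞
      (fun y ↦ (⟨y.2, Y y⟩ : TangentBundle I N)) p) :
    VField.SmoothAt (I := 𝓘(ℝ, ℝ).prod I) (fun y ↦ ((a y, Y y) : ℝ × E)) p := by
  have h := contMDiff_equivTangentBundleProd_symm (n := ∞) (I := 𝓘(ℝ, ℝ)) (I' := I) (M := ℝ)
    (M' := N)
  have h1 : ContMDiffAt (𝓘(ℝ, ℝ).prod I) (𝓘(ℝ, ℝ).tangent) ∞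
      (fun y : ℝ × N ↦ (⟨y.1, a y⟩ : TangentBundle 𝓘(ℝ, ℝ) ℝ)) p := by
    rw [Bundle.contMDiffAt_totalSpace]
    exact ⟨contMDiffAt_fst, by simpa using ha⟩
  exact h.contMDiffAt.comp p (h1.prodMk hY)

lemma smoothAt_timeField (p : ℝ × N) : VField.SmoothAt (timeField (I := I) (N := N)) p := by
  have := VField.smoothAt_of_prod (I := I) (a := fun _ ↦ 1) (Y := fun _ ↦ 0) (p := p)
    contMDiffAt_const
    (ContMDiffAt.comp p (Bundle.contMDiff_zeroSection ℝ (TangentSpace I)).contMDiffAt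
      contMDiffAt_snd)
  simp only [VField.SmoothAt, timeField_eq]
  exact this

lemma smoothAt_liftField {X : VField I N} {p : ℝ × N} (hX : X.SmoothAt p.2) :
    VField.SmoothAt (liftField X) p := by
  have := VField.smoothAt_of_prod (I := I) (a := fun _ ↦ 0) (Y := fun y ↦ X y.2) (p := p)
    contMDiffAt_const (ContMDiffAt.comp p hX contMDiffAt_snd)
  simpa only [← liftField_eq] using this

end Product

/-! ### Brackets, pullbacks and exterior derivatives on `ℝ × N` -/

section ProductCalculus

open VectorField Module

variable {E : Type*} [NormedAddCommGroup E] [NormedSpace ℝ E] [FiniteDimensional ℝ E]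
  {H : Type*} [TopologicalSpace H] {I : ModelWithCorners ℝ E H}
  {N : Type*} [TopologicalSpace N] [ChartedSpace H N] [IsManifold I ∞ N] {p : ℝ × N}

/-- The bracket of fields related to fields on `N` is related to the bracket. -/
lemma spaceProj_mlieBracket {X Y : VField (𝓘(ℝ, ℝ).prod I) (ℝ × N)} {X' Y' : VField I N}
    (hX : X.SmoothAt p) (hY : Y.SmoothAt p) (hX' : X'.SmoothAt p.2) (hY' : Y'.SmoothAt p.2)
    (hXX' : ∀ᶠ y in 𝓝 p, spaceProj y (X y) = X' y.2)
    (hYY' : ∀ᶠ y in 𝓝 p, spaceProj y (Y y) = Y' y.2) :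
    spaceProj p (mlieBracket (𝓘(ℝ, ℝ).prod I) X Y p) = mlieBracket I X' Y' p.2 := by
  -- Tested on functions pulled back from `N`, both brackets become commutators of derivations,
  -- which agree because the fields are related.
  refine eq_of_mvfderiv_eq fun f hf ↦ ?_
  have hf2 : ContMDiffAt I 𝓘(ℝ, ℝ) 2 f p.2 :=
    hf.of_le ENat.LEInfty.out
  have hfM : ContMDiffAt (𝓘(ℝ, ℝ).prod I) 𝓘(ℝ, ℝ) 2 (fun y : ℝ × N ↦ f y.2) p :=
    hf2.comp p contMDiffAt_snd
  have hfd : ∀ᶠ q in 𝓝 p.2, MDifferentiableAt I 𝓘(ℝ, ℝ) f q := by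
    filter_upwards [(contMDiffAt_iff_contMDiffAt_nhds (by decide)).1 hf2] with q hq
    exact hq.mdifferentiableAt (by simp)
  have hfd' := (continuous_snd.continuousAt (x := p)).eventually hfd
  have key {X Y : VField (𝓘(ℝ, ℝ).prod I) (ℝ × N)} {X' Y' : VField I N}
      (hY' : Y'.SmoothAt p.2)
      (hXX' : ∀ᶠ y in 𝓝 p, spaceProj y (X y) = X' y.2)
      (hYY' : ∀ᶠ y in 𝓝 p, spaceProj y (Y y) = Y' y.2) :
      dirDeriv X (dirDeriv Y fun y ↦ f y.2) p = dirDeriv X' (dirDeriv Y' f) p.2 := by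
    have h1 : dirDeriv Y (fun y ↦ f y.2) =ᶠ[𝓝 p] fun y ↦ dirDeriv Y' f y.2 := by
      filter_upwards [hfd', hYY'] with y h1 h2
      rw [dirDeriv_comp_snd h1, h2]
      rfl
    rw [dirDeriv_congr h1, dirDeriv_comp_snd, hXX'.self_of_nhds]
    · rfl
    · exact (contMDiffAt_dirDeriv (m := 1) (hY'.contAt.of_le le_top) hf2
        (by norm_num)).mdifferentiableAt (by simp)
  rw [← dirDeriv_comp_snd hfd.self_of_nhds,
    dirDeriv_mlieBracket (hX.contAt.of_le le_top) (hY.contAt.of_le le_top) hfM,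
    key hY' hXX' hYY', key hX' hYY' hXX',
    ← dirDeriv_mlieBracket (hX'.contAt.of_le le_top) (hY'.contAt.of_le le_top) hf2]
  rfl

lemma timeForm_mlieBracket {X Y : VField (𝓘(ℝ, ℝ).prod I) (ℝ × N)} (hX : X.SmoothAt p)
    (hY : Y.SmoothAt p) : timeForm p (mlieBracket (𝓘(ℝ, ℝ).prod I) X Y p)
      = dirDeriv X (fun y ↦ timeForm y (Y y)) p - dirDeriv Y (fun y ↦ timeForm y (X y)) p :=
  dirDeriv_mlieBracket (f := Prod.fst) (hX.contAt.of_le le_top) (hY.contAt.of_le le_top)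
    contMDiffAt_fst

lemma VField.DiffAt.spaceProj {X : VField (𝓘(ℝ, ℝ).prod I) (ℝ × N)} (hX : X.DiffAt p) :
    MDifferentiableAt (𝓘(ℝ, ℝ).prod I) I.tangent
      (fun y ↦ (⟨y.2, spaceProj y (X y)⟩ : TangentBundle I N)) p := by
  have h : ContMDiff (𝓘(ℝ, ℝ).prod I).tangent I.tangent 1
      (tangentMap (𝓘(ℝ, ℝ).prod I) I (Prod.snd : ℝ × N → N)) :=
    (contMDiff_snd (n := ∞)).contMDiff_tangentMap
        (one_add_one_eq_two.trans_le ENat.LEInfty.out)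
  exact (h.contMDiffAt.mdifferentiableAt (by simp)).comp p hX

lemma timeForm_smooth : OneForm.Smooth (timeForm (I := I) (N := N)) where
  contMDiffAt hX := contMDiffAt_dirDeriv (n := ⊤) hX contMDiffAt_fst le_top
  mdifferentiableAt {x X} hX := by
    have h : ContMDiff (𝓘(ℝ, ℝ).prod I).tangent 𝓘(ℝ, ℝ).tangent 1
        (tangentMap (𝓘(ℝ, ℝ).prod I) 𝓘(ℝ, ℝ) (Prod.fst : ℝ × N → ℝ)) :=
      (contMDiff_fst (n := ∞)).contMDiff_tangentMap
        (one_add_one_eq_two.trans_le ENat.LEInfty.out)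
    have h2 := ((contMDiff_snd_tangentBundle_modelSpace ℝ 𝓘(ℝ, ℝ) (n := 1)).comp h)
    exact (h2.contMDiffAt.mdifferentiableAt (by simp)).comp x hX

/-- The pullback to `ℝ × N` of a 1-form on `N`. -/
def liftForm (α : OneForm I N) : OneForm (𝓘(ℝ, ℝ).prod I) (ℝ × N) := fun p ↦
  (α p.2).comp (spaceProj p)

lemma liftForm_apply (α : OneForm I N) (u : TangentSpace (𝓘(ℝ, ℝ).prod I) p) :
    liftForm α p u = α p.2 (spaceProj p u) := rfl

lemma liftForm_smooth {g : TwoTensor I N} (hg : ContMDiff I (I.prod 𝓘(ℝ, E →L[ℝ] E →L[ℝ] ℝ)) ∞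
      (fun x ↦ Bundle.TotalSpace.mk' (E →L[ℝ] E →L[ℝ] ℝ)
        (E := fun x : N ↦ TangentSpace I x →L[ℝ] TangentSpace I x →L[ℝ] ℝ) x (g x)))
    {k : VField I N} (hk : ∀ q, k.SmoothAt q) :
    OneForm.Smooth (liftForm fun q ↦ g q (k q)) where
  contMDiffAt {_ x _} hX := contMDiffAt_twoTensor_apply (φ := Prod.snd) hg
    (ContMDiffAt.comp (g := fun q ↦ (⟨q, k q⟩ : TangentBundle I N)) x
      ((hk x.2).contAt.of_le le_top) contMDiffAt_snd) hX.spaceProj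
  mdifferentiableAt {x _} hX := mdifferentiableAt_twoTensor_apply (φ := Prod.snd) hg
    (MDifferentiableAt.comp (g := fun q ↦ (⟨q, k q⟩ : TangentBundle I N)) x
      (hk x.2).diffAt mdifferentiableAt_snd) hX.spaceProj

/-- The generic extension of `u` need not project to a field on `N`; this one does, so brackets can
be computed on `N`. -/
lemma exists_prodField (u : TangentSpace (𝓘(ℝ, ℝ).prod I) p) :
    ∃ X : VField (𝓘(ℝ, ℝ).prod I) (ℝ × N), X.SmoothAt p ∧ X p = u ∧
      ∀ y, spaceProj y (X y) = FiberBundle.extend E (spaceProj p u) y.2 := by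
  refine ⟨(fun _ ↦ timeForm p u) • timeField + liftField (FiberBundle.extend E (spaceProj p u)),
    ((smoothAt_timeField p).contAt.smul contMDiffAt_const).add
      (smoothAt_liftField (VField.smoothAt_extend _)).contAt, ?_, fun y ↦ ?_⟩
  · apply tangent_ext
    · simp [timeForm_timeField, timeForm_liftField]
    · simp [spaceProj_timeField, spaceProj_liftField]
  · simp [spaceProj_timeField, spaceProj_liftField]

/-- The exterior derivative commutes with the pullback to `ℝ × N`. -/
lemma extDerivOne_liftForm {α : OneForm I N} (hα : α.Smooth) (hα' : (liftForm α).Smooth)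
    (u v : TangentSpace (𝓘(ℝ, ℝ).prod I) p) :
    extDerivOne (liftForm α) p u v = extDerivOne α p.2 (spaceProj p u) (spaceProj p v) := by
  obtain ⟨U, hU, hUp, hUs⟩ := exists_prodField u
  obtain ⟨V, hV, hVp, hVs⟩ := exists_prodField v
  have hu := VField.smoothAt_extend (spaceProj p u)
  have hv := VField.smoothAt_extend (spaceProj p v)
  have h := extDerivOne_eq hα' hU.diffAt hV.diffAt
  rw [hUp, hVp] at h
  simp only [liftForm_apply, hUs, hVs] at h
  rw [h, spaceProj_mlieBracket hU hV hu hv (.of_forall hUs) (.of_forall hVs),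
    dirDeriv_comp_snd (f := fun q ↦ α q (FiberBundle.extend E (spaceProj p v) q))
      (hα.mdifferentiableAt hv.diffAt),
    dirDeriv_comp_snd (f := fun q ↦ α q (FiberBundle.extend E (spaceProj p u) q))
      (hα.mdifferentiableAt hu.diffAt), hUs, hVs]
  rfl

lemma warpedMetric_contMDiff {w : ℝ → ℝ} (hw : ContDiff ℝ ∞ w) {g : TwoTensor I N}
    (hg : ContMDiff I (I.prod 𝓘(ℝ, E →L[ℝ] E →L[ℝ] ℝ)) ∞
      (fun x ↦ Bundle.TotalSpace.mk' (E →L[ℝ] E →L[ℝ] ℝ)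
        (E := fun x : N ↦ TangentSpace I x →L[ℝ] TangentSpace I x →L[ℝ] ℝ) x (g x))) :
    ContMDiff (𝓘(ℝ, ℝ).prod I)
      ((𝓘(ℝ, ℝ).prod I).prod 𝓘(ℝ, (ℝ × E) →L[ℝ] (ℝ × E) →L[ℝ] ℝ)) ∞
      (fun x ↦ Bundle.TotalSpace.mk' ((ℝ × E) →L[ℝ] (ℝ × E) →L[ℝ] ℝ)
        (E := fun x : ℝ × N ↦ TangentSpace (𝓘(ℝ, ℝ).prod I) x →L[ℝ]
          TangentSpace (𝓘(ℝ, ℝ).prod I) x →L[ℝ] ℝ) x (warpedMetric w g x)) := by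
  refine contMDiff_twoTensor fun p X Y hX hY ↦ ?_
  simp only [warpedMetric_apply]
  have hwM : ContMDiffAt (𝓘(ℝ, ℝ).prod I) 𝓘(ℝ, ℝ) ∞ (fun y : ℝ × N ↦ w y.1) p :=
    hw.contMDiff.contMDiffAt.comp p contMDiffAt_fst
  exact (((timeForm_smooth.contMDiffAt hX.contAt).mul
    (timeForm_smooth.contMDiffAt hY.contAt)).neg).add
    ((hwM.pow 2).mul (contMDiffAt_twoTensor_apply (φ := Prod.snd) hg hX.contAt.spaceProj
      hY.contAt.spaceProj))

end ProductCalculus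

/-! ### The warped metric and fields of the form `a ∂_t + φ(t) Y` -/

section WarpedKahler

open VectorField Module

variable {E : Type*} [NormedAddCommGroup E] [NormedSpace ℝ E] [FiniteDimensional ℝ E]
  {H : Type*} [TopologicalSpace H] {I : ModelWithCorners ℝ E H}

lemma grad_eq {M : Type*} [TopologicalSpace M] [ChartedSpace H M] {g : TwoTensor I M} {τ : M → ℝ}
    {x : M} (hn : ∀ u, (∀ v, g x u v = 0) → u = 0) {u : TangentSpace I x}
    (h : ∀ v, g x u v = mvfderiv I τ x v) : grad g τ x = u := by
  have hex : ∃ u : TangentSpace I x, ∀ v, g x u v = mvfderiv I τ x v := ⟨u, h⟩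
  have h1 : grad g τ x = hex.choose := by
    unfold grad
    exact dif_pos hex
  rw [h1, ← sub_eq_zero]
  refine hn _ fun v ↦ ?_
  rw [map_sub, _root_.sub_apply, hex.choose_spec v, h v, sub_self]

variable {N : Type*} [TopologicalSpace N] [ChartedSpace H N] [IsManifold I ∞ N]
  {gN : Bundle.ContMDiffRiemannianMetric I ∞ E (fun q : N ↦ TangentSpace I q)}
  {w : ℝ → ℝ} {p : ℝ × N}

lemma riemannian_smooth : TwoTensor.Smooth gN.inner := TwoTensor.smooth_of_contMDiff gN.contMDiff

lemma riemannian_nondegenerate (q : N) (u : TangentSpace I q) (h : ∀ v, gN.inner q u v = 0) :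
    u = 0 := by
  by_contra hne
  exact (gN.pos q u hne).ne' (h u)

lemma warpedMetric_smooth (hw : ContDiff ℝ ∞ w) : (warpedMetric w gN.inner).Smooth :=
  TwoTensor.smooth_of_contMDiff (warpedMetric_contMDiff hw gN.contMDiff)

lemma warpedMetric_symm (u v : TangentSpace (𝓘(ℝ, ℝ).prod I) p) :
    warpedMetric w gN.inner p u v = warpedMetric w gN.inner p v u := by
  rw [warpedMetric_apply, warpedMetric_apply, gN.symm, mul_comm (timeForm p u)]

lemma warpedMetric_timeField (v : TangentSpace (𝓘(ℝ, ℝ).prod I) p) :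
    warpedMetric w gN.inner p (timeField p) v = - timeForm p v := by
  simp [warpedMetric_apply, timeForm_timeField, spaceProj_timeField]

lemma warpedMetric_liftField (X : VField I N) (v : TangentSpace (𝓘(ℝ, ℝ).prod I) p) :
    warpedMetric w gN.inner p (liftField X p) v
      = w p.1 ^ 2 * gN.inner p.2 (X p.2) (spaceProj p v) := by
  simp [warpedMetric_apply, timeForm_liftField, spaceProj_liftField]

lemma warpedMetric_pos (hw : ∀ s, 0 < w s) {v : TangentSpace (𝓘(ℝ, ℝ).prod I) p}
    (hv : timeForm p v = 0) (hne : v ≠ 0) : 0 < warpedMetric w gN.inner p v v := by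
  rw [warpedMetric_apply, hv]
  have h1 : spaceProj p v ≠ 0 := by
    rintro h
    exact hne (tangent_ext (by simpa using hv) (by simpa using h))
  have h2 := gN.pos _ _ h1
  have h3 := hw p.1
  have : 0 < w p.1 ^ 2 * gN.inner p.2 (spaceProj p v) (spaceProj p v) := by positivity
  linarith

/-- Pairing with `∂_t` shows that `u` is tangent to the slice, where the metric is positive
definite. -/
lemma warpedMetric_nondegenerate (hw : ∀ s, 0 < w s) (u : TangentSpace (𝓘(ℝ, ℝ).prod I) p)
    (h : ∀ v, warpedMetric w gN.inner p u v = 0) : u = 0 := by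
  by_contra hne
  refine (warpedMetric_pos (gN := gN) hw ?_ hne).ne' (h u)
  have := h (timeField p)
  rw [warpedMetric_symm, warpedMetric_timeField] at this
  linarith

lemma isLorentzianMetric_warpedMetric (hws : ContDiff ℝ ∞ w) (hw : ∀ s, 0 < w s) :
    IsLorentzianMetric (warpedMetric w gN.inner) where
  smooth := warpedMetric_contMDiff hws gN.contMDiff
  symm _ _ _ := warpedMetric_symm _ _
  nondegenerate _ u h := warpedMetric_nondegenerate hw u h
  index p := by
    constructor
    · have hne : timeField (I := I) p ≠ 0 := by
        intro h
        have := timeForm_timeField (I := I) p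
        rw [h] at this
        simp at this
      refine ⟨Submodule.span ℝ {timeField p}, finrank_span_singleton hne, fun v hv hv0 ↦ ?_⟩
      obtain ⟨a, rfl⟩ := Submodule.mem_span_singleton.1 hv
      have ha : a ≠ 0 := by
        rintro rfl
        simp at hv0
      have : 0 < a * a := mul_self_pos.2 ha
      simpa [warpedMetric_timeField, timeForm_timeField] using this
    · rintro n ⟨W, rfl, hW⟩
      -- The kernel of `dt` is spacelike, so `dt` is injective on a negative definite subspace,
      -- whose dimension is therefore at most one.
      have hinj : Function.Injective ((timeForm p).toLinearMap ∘ₗ W.subtype) := by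
        rw [← LinearMap.ker_eq_bot, LinearMap.ker_eq_bot']
        intro v hv
        by_contra hne
        have hne' : (v : TangentSpace (𝓘(ℝ, ℝ).prod I) p) ≠ 0 := by simpa using hne
        exact (hW v v.2 hne').not_gt (warpedMetric_pos hw hv hne')
      simpa using LinearMap.finrank_le_finrank_of_injective hinj

/-- The sign comes from `g(∂_t, ∂_t) = -1`. -/
lemma grad_fst (hw : ∀ s, 0 < w s) (p : ℝ × N) :
    grad (warpedMetric w gN.inner) Prod.fst p = - timeField p := by
  refine grad_eq (fun u h ↦ warpedMetric_nondegenerate hw u h) fun v ↦ ?_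
  rw [map_neg, _root_.neg_apply, warpedMetric_timeField, neg_neg]
  rfl

lemma grad_const (hw : ∀ s, 0 < w s) (c : ℝ) (p : ℝ × N) :
    grad (warpedMetric w gN.inner) (fun _ ↦ c) p = 0 := by
  refine grad_eq (fun u h ↦ warpedMetric_nondegenerate hw u h) fun v ↦ ?_
  rw [mvfderiv_const]
  simp

/-- The field `k = ∂_t + w⁻¹ kN`. -/
def nullField (w : ℝ → ℝ) (kN : VField I N) : VField (𝓘(ℝ, ℝ).prod I) (ℝ × N) := fun p ↦
  timeField p + (w p.1)⁻¹ • liftField kN p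

lemma timeForm_nullField (kN : VField I N) : timeForm p (nullField w kN p) = 1 := by
  simp [nullField, timeForm_timeField, timeForm_liftField]

lemma spaceProj_nullField (kN : VField I N) :
    spaceProj p (nullField w kN p) = (w p.1)⁻¹ • kN p.2 := by
  simp [nullField, spaceProj_timeField, spaceProj_liftField]

lemma contMDiffAt_comp_fst {φ : ℝ → ℝ} (hφ : ContDiff ℝ ∞ φ) (p : ℝ × N) :
    ContMDiffAt (𝓘(ℝ, ℝ).prod I) 𝓘(ℝ, ℝ) ∞ (fun y : ℝ × N ↦ φ y.1) p :=
  hφ.contMDiff.contMDiffAt.comp p contMDiffAt_fst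

lemma nullField_smoothAt (hws : ContDiff ℝ ∞ w) (hw : ∀ s, 0 < w s) {kN : VField I N}
    (hk : ∀ q, kN.SmoothAt q) (p : ℝ × N) : (nullField w kN).SmoothAt p :=
  (smoothAt_timeField p).contAt.add ((smoothAt_liftField (hk p.2)).contAt.smul
    (contMDiffAt_comp_fst (φ := fun s ↦ (w s)⁻¹) (hws.inv fun s ↦ (hw s).ne') p))

lemma warpedMetric_nullField (hw : ∀ s, 0 < w s) (kN : VField I N)
    (v : TangentSpace (𝓘(ℝ, ℝ).prod I) p) :
    warpedMetric w gN.inner p (nullField w kN p) v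
      = - timeForm p v + w p.1 * gN.inner p.2 (kN p.2) (spaceProj p v) := by
  have := (hw p.1).ne'
  simp only [nullField, map_add, map_smul, _root_.add_apply, _root_.smul_apply,
    warpedMetric_timeField, warpedMetric_liftField, smul_eq_mul]
  field_simp

/-- The 1-form `kN^♭`, pulled back to `ℝ × N`. -/
abbrev dualForm (gN : Bundle.ContMDiffRiemannianMetric I ∞ E (fun q : N ↦ TangentSpace I q))
    (kN : VField I N) : OneForm (𝓘(ℝ, ℝ).prod I) (ℝ × N) :=
  liftForm fun q ↦ gN.inner q (kN q)

/-- Orthogonality to `∂_t` removes the `dt` term from `k^♭ = w α - dt`. Thus `H` is cut out by `dt`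
and `α` and does not depend on `w`. -/
lemma mem_orthogonal_pairSpan (hw : ∀ s, 0 < w s) {kN : VField I N}
    {u : TangentSpace (𝓘(ℝ, ℝ).prod I) p} :
    u ∈ (warpedMetric w gN.inner p).toBilinForm.orthogonal
        (pairSpan (nullField w kN) (-timeField) p) ↔
      timeForm p u = 0 ∧ dualForm gN kN p u = 0 := by
  rw [pairSpan, mem_orthogonal_pair, Pi.neg_apply, map_neg, _root_.neg_apply,
    warpedMetric_timeField, warpedMetric_nullField hw, neg_neg, liftForm_apply]
  have := (hw p.1).ne'
  constructor
  · rintro ⟨h1, h2⟩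
    rw [h2, neg_zero, zero_add] at h1
    exact ⟨h2, (mul_eq_zero.1 h1).resolve_left this⟩
  · rintro ⟨h1, h2⟩
    rw [h1, h2]
    simp

/-- The field `a ∂_t + φ(t) Y`. -/
def productField (a : ℝ) (φ : ℝ → ℝ) (Y : VField I N) : VField (𝓘(ℝ, ℝ).prod I) (ℝ × N) :=
  fun p ↦ a • timeField p + φ p.1 • liftField Y p

/-- With `neg_timeField_eq`, this lets the flows of `k` and `-∂_t` be treated by a single
computation. -/
lemma nullField_eq (kN : VField I N) :
    nullField w kN = productField 1 (fun s ↦ (w s)⁻¹) kN := by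
  ext p
  simp [nullField, productField]

lemma neg_timeField_eq (kN : VField I N) :
    -timeField (I := I) = productField (-1) (fun _ ↦ 0) kN := by
  ext p
  simp [productField]

/-- The Lie derivative of the warped metric along fields `a ∂_t + φ(t) Y`. -/
lemma lieForm_warpedMetric (hws : ContDiff ℝ ∞ w) {φ : ℝ → ℝ} (hφ : ContDiff ℝ ∞ φ) (a : ℝ)
    {Y : VField I N} (hY : ∀ q, Y.SmoothAt q) {v z : TangentSpace (𝓘(ℝ, ℝ).prod I) p}
    (hv : timeForm p v = 0) (hz : timeForm p z = 0) :
    lieForm (warpedMetric w gN.inner)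
        (productField a φ Y) p v z
      = 2 * a * w p.1 * deriv w p.1 * gN.inner p.2 (spaceProj p v) (spaceProj p z)
        + w p.1 ^ 2 * φ p.1 * lieForm gN.inner Y p.2 (spaceProj p v) (spaceProj p z) := by
  set V : VField I N := FiberBundle.extend E (spaceProj p v) with hVdef
  set Z : VField I N := FiberBundle.extend E (spaceProj p z) with hZdef
  have hV : V.SmoothAt p.2 := VField.smoothAt_extend _
  have hZ : Z.SmoothAt p.2 := VField.smoothAt_extend _
  have hVM := smoothAt_liftField (p := p) hV
  have hZM := smoothAt_liftField (p := p) hZ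
  have hYM := smoothAt_liftField (hY p.2)
  have hV0 : V p.2 = spaceProj p v := FiberBundle.extend_apply_self ..
  have hZ0 : Z p.2 = spaceProj p z := FiberBundle.extend_apply_self ..
  have hVp : liftField V p = v :=
    tangent_ext (by rw [timeForm_liftField, hv]) (by rw [spaceProj_liftField, hV0])
  have hZp : liftField Z p = z :=
    tangent_ext (by rw [timeForm_liftField, hz]) (by rw [spaceProj_liftField, hZ0])
  -- Only the spatial component of the bracket is needed, since lifted fields have no `dt`
  -- component. The field `∂_t` contributes nothing to it, being related to the zero field on `N`.
  have hbr {X : VField I N} (hX : X.SmoothAt p.2) :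
      spaceProj p (mlieBracket (𝓘(ℝ, ℝ).prod I) (productField a φ Y) (liftField X) p)
        = φ p.1 • mlieBracket I Y X p.2 := by
    have hXM := smoothAt_liftField (p := p) hX
    have hφM := (contMDiffAt_comp_fst (I := I) hφ p).mdifferentiableAt (by simp)
    have haM : MDifferentiableAt (𝓘(ℝ, ℝ).prod I) 𝓘(ℝ, ℝ) (fun _ : ℝ × N ↦ a) p :=
      mdifferentiableAt_const
    have e : productField a φ Y = (fun _ : ℝ × N ↦ a) • timeField (I := I) (N := N)
      + (fun y : ℝ × N ↦ φ y.1) • liftField Y := rfl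
    rw [e, mlieBracket_add_left' ((smoothAt_timeField p).diffAt.smul haM) (hYM.diffAt.smul hφM),
      mlieBracket_smul_left' haM (smoothAt_timeField p).diffAt,
      mlieBracket_smul_left' hφM hYM.diffAt, dirDeriv_const,
      dirDeriv_comp_fst (hφ.differentiable (by simp)).differentiableAt, timeForm_liftField]
    simp only [map_add, map_smul, mul_zero, neg_zero, zero_smul, zero_add]
    rw [spaceProj_mlieBracket (X' := 0) (Y' := X) (smoothAt_timeField p) hXM
        (Bundle.contMDiff_zeroSection ℝ (TangentSpace I)).contMDiffAt hX
        (.of_forall fun y ↦ spaceProj_timeField y) (.of_forall fun y ↦ spaceProj_liftField X y),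
      spaceProj_mlieBracket (X' := Y) (Y' := X) hYM hXM (hY p.2) hX
        (.of_forall fun y ↦ spaceProj_liftField Y y) (.of_forall fun y ↦ spaceProj_liftField X y),
      mlieBracket_zero_left]
    simp
  have hF : MDifferentiableAt I 𝓘(ℝ, ℝ) (fun q ↦ gN.inner q (V q) (Z q)) p.2 :=
    riemannian_smooth.mdifferentiableAt hV.diffAt hZ.diffAt
  have hwd : DifferentiableAt ℝ w p.1 := (hws.differentiable (by simp)).differentiableAt
  have h1 := lieForm_eq (Y := productField a φ Y) (warpedMetric_smooth (gN := gN) hws)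
    (fun _ ↦ warpedMetric_symm) hVM.diffAt hZM.diffAt
  have h2 := lieForm_eq (Y := Y) (riemannian_smooth (gN := gN)) gN.symm hV.diffAt hZ.diffAt
  rw [hVp, hZp] at h1
  rw [hV0, hZ0] at h2
  rw [h1, h2]
  simp only [warpedMetric_apply, timeForm_liftField, spaceProj_liftField, hbr hV, hbr hZ, hv, hz,
    mul_zero, neg_zero, zero_add, zero_mul]
  rw [dirDeriv_mul (f := fun y : ℝ × N ↦ w y.1 ^ 2) (h := fun y ↦ gN.inner y.2 (V y.2) (Z y.2))
      (((contMDiffAt_comp_fst hws p).pow 2).mdifferentiableAt (by simp))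
      (hF.comp p mdifferentiableAt_snd),
    dirDeriv_comp_fst (φ := fun s ↦ w s ^ 2) (hwd.pow 2), dirDeriv_comp_snd hF]
  have h3 : deriv (fun s ↦ w s ^ 2) p.1 = 2 * w p.1 * deriv w p.1 := by
    rw [deriv_fun_pow hwd]
    ring
  rw [h3, hV0, hZ0]
  simp only [productField, map_add, map_smul, timeForm_timeField,
    timeForm_liftField, spaceProj_timeField, spaceProj_liftField, smul_eq_mul, smul_zero, map_zero,
    _root_.smul_apply, dirDeriv]
  ring

end WarpedKahler

/-! ### The induced Kähler metric of the warped product -/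

section MainConstruction

open VectorField Module

variable {E : Type*} [NormedAddCommGroup E] [NormedSpace ℝ E] [FiniteDimensional ℝ E]
  {H : Type*} [TopologicalSpace H] {I : ModelWithCorners ℝ E H}
  {N : Type*} [TopologicalSpace N] [ChartedSpace H N] [IsManifold I ∞ N]
  {gN : Bundle.ContMDiffRiemannianMetric I ∞ E (fun q : N ↦ TangentSpace I q)}
  {kN : VField I N} {w : ℝ → ℝ} {p : ℝ × N}

/-- The coordinate belonging to `k` with respect to a frame `(k, -∂_t, e₁, e₂)`. -/
def coordForm (w : ℝ → ℝ) (gN : Bundle.ContMDiffRiemannianMetric I ∞ E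
    (fun q : N ↦ TangentSpace I q)) (kN : VField I N) :
    OneForm (𝓘(ℝ, ℝ).prod I) (ℝ × N) := fun p ↦ w p.1 • dualForm gN kN p

/-- The coordinate belonging to `-∂_t` with respect to a frame `(k, -∂_t, e₁, e₂)`. -/
def coordForm' (w : ℝ → ℝ) (gN : Bundle.ContMDiffRiemannianMetric I ∞ E
    (fun q : N ↦ TangentSpace I q)) (kN : VField I N) :
    OneForm (𝓘(ℝ, ℝ).prod I) (ℝ × N) := fun p ↦ coordForm w gN kN p + (-1 : ℝ) • timeForm p

lemma coordForm_apply (u : TangentSpace (𝓘(ℝ, ℝ).prod I) p) :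
    coordForm w gN kN p u = w p.1 * gN.inner p.2 (kN p.2) (spaceProj p u) := rfl

lemma coordForm'_apply (u : TangentSpace (𝓘(ℝ, ℝ).prod I) p) :
    coordForm' w gN kN p u
      = w p.1 * gN.inner p.2 (kN p.2) (spaceProj p u) - timeForm p u := by
  simp only [coordForm', _root_.add_apply, coordForm_apply, _root_.smul_apply, smul_eq_mul]
  ring

/-- The metric on the slices is `w² gN`, so dividing by `w` makes `gN`-orthonormal vectors
`g`-orthonormal. The coordinate forms are dual to `k` and `-∂_t` because `w α` and `dt` both take
the value `1` on `k`. -/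
lemma isAdaptedFrame_of_orthonormalTriple (hw : ∀ s, 0 < w s) (hE : finrank ℝ E = 3)
    {E₁ E₂ : VField I N} (h : IsOrthonormalTriple (gN.inner p.2) (kN p.2) (E₁ p.2) (E₂ p.2)) :
    IsAdaptedFrame (warpedMetric w gN.inner p) (nullField w kN p) ((-timeField) p)
      ((w p.1)⁻¹ • liftField E₁ p) ((w p.1)⁻¹ • liftField E₂ p) (coordForm w gN kN p)
      (coordForm' w gN kN p) := by
  have hne := (hw p.1).ne'
  have hinner (X : VField I N) (u : TangentSpace (𝓘(ℝ, ℝ).prod I) p) :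
      warpedMetric w gN.inner p ((w p.1)⁻¹ • liftField X p) u
        = w p.1 * gN.inner p.2 (X p.2) (spaceProj p u) := by
    rw [map_smul, _root_.smul_apply, warpedMetric_liftField, smul_eq_mul]
    field_simp
  have hdim : finrank ℝ (TangentSpace I p.2) = 3 := hE
  refine ⟨fun u ↦ ?_, ?_, ?_, ?_, ?_, ?_, ?_, ?_, ?_, ?_, ?_, ?_, fun _ _ ↦ warpedMetric_symm _ _,
    fun u ↦ ?_⟩
  · apply tangent_ext
    · simp [timeForm_nullField, timeForm_timeField, timeForm_liftField, coordForm_apply,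
        coordForm'_apply]
    · have hx := h.expand (gN.symm p.2) (gN.pos p.2) hdim (spaceProj p u)
      rw [hinner, hinner]
      nth_rw 1 [hx]
      simp only [map_add, map_smul, map_neg, Pi.neg_apply, spaceProj_nullField,
        spaceProj_timeField, spaceProj_liftField, coordForm_apply, smul_smul, neg_zero,
        smul_zero, add_zero]
      congr 2
      · congr 1; field_simp
      · congr 1; field_simp
      · field_simp
  · simp [coordForm_apply, spaceProj_nullField, h.k_k, hne]
  · simp [coordForm_apply, spaceProj_timeField]
  · simp [coordForm'_apply, spaceProj_nullField, timeForm_nullField, h.k_k, hne]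
  · simp [coordForm'_apply, spaceProj_timeField, timeForm_timeField]
  · simp [coordForm_apply, spaceProj_liftField, h.k_e₁]
  · simp [coordForm_apply, spaceProj_liftField, h.k_e₂]
  · simp [coordForm'_apply, spaceProj_liftField, timeForm_liftField, h.k_e₁]
  · simp [coordForm'_apply, spaceProj_liftField, timeForm_liftField, h.k_e₂]
  · rw [hinner, map_smul, spaceProj_liftField, map_smul, h.e₁_e₁]; simp [hne]
  · rw [hinner, map_smul, spaceProj_liftField, map_smul, h.e₁_e₂]; simp
  · rw [hinner, map_smul, spaceProj_liftField, map_smul, h.e₂_e₂]; simp [hne]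
  · have := mem_orthogonal_pairSpan (gN := gN) (kN := kN) (u := u) hw
    rw [pairSpan] at this
    rw [this, coordForm_apply, coordForm'_apply, liftForm_apply]
    constructor
    · rintro ⟨h1, h2⟩
      rw [h1, h2]
      simp
    · rintro ⟨h1, h2⟩
      rw [h1] at h2
      exact ⟨by linarith, (mul_eq_zero.1 h1).resolve_left hne⟩

/-- The geometric assumptions on the unit field `kN`: the derived 1-form satisfies
`dkN^♭(kN, ·) = 0` and is nondegenerate on the orthogonal complement of `kN`, and the flow of `kN`
is conformal there. -/
structure IsTwistingField (gN : Bundle.ContMDiffRiemannianMetric I ∞ E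
    (fun q : N ↦ TangentSpace I q)) (kN : VField I N) : Prop where
  smooth : ∀ q, kN.SmoothAt q
  unit : ∀ q, gN.inner q (kN q) (kN q) = 1
  ext_k : ∀ q v, extDerivOne (fun q ↦ gN.inner q (kN q)) q (kN q) v = 0
  conformal : ∀ q, ∃ c : ℝ, ∀ v z : TangentSpace I q, gN.inner q (kN q) v = 0 →
    gN.inner q (kN q) z = 0 → lieForm gN.inner kN q v z = c * gN.inner q v z
  twist : ∀ q, ∃ v z : TangentSpace I q, gN.inner q (kN q) v = 0 ∧ gN.inner q (kN q) z = 0 ∧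
    extDerivOne (fun q ↦ gN.inner q (kN q)) q v z ≠ 0

lemma isTwistingField (hE : finrank ℝ E = 3) (hk_smooth : ∀ q, kN.SmoothAt q)
    (hk_unit : ∀ q, gN.inner q (kN q) (kN q) = 1) (hk_geodesic : IsGeodesic gN.inner kN)
    (hk_shearFree : ∀ q, shear gN.inner (lineSpan kN) kN q = 0)
    (hk_twisting : ∀ q, twistFunction gN.inner (lineSpan kN) kN q ≠ 0) :
    IsTwistingField gN kN := by
  have hc (q : N) := isCompl_orthogonal_singleton (hk_unit q)
  have hpos (q : N) (v : TangentSpace I q)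
    (_ : v ∈ (gN.inner q).toBilinForm.orthogonal (lineSpan kN q)) (hv : v ≠ 0) := gN.pos q v hv
  refine ⟨hk_smooth, hk_unit, fun q v ↦ hk_geodesic.extDerivOne_eq_zero riemannian_smooth gN.symm
    riemannian_nondegenerate hk_smooth hk_unit q v, fun q ↦ ?_, fun q ↦ ?_⟩
  · obtain ⟨c, h⟩ := (shear_eq_zero_iff riemannian_smooth gN.symm riemannian_nondegenerate
      hk_smooth (hc q) (hpos q)).1 (hk_shearFree q)
    exact ⟨c, fun v z hv hz ↦ h v (mem_orthogonal_singleton.2 hv) z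
      (mem_orthogonal_singleton.2 hz)⟩
  · have : FiniteDimensional ℝ (TangentSpace I q) := inferInstanceAs (FiniteDimensional ℝ E)
    -- The complement of the line of `kN` has rank `3 - 1`; only that it is nonzero matters here.
    have hfr : finrank ℝ ((gN.inner q).toBilinForm.orthogonal (lineSpan kN q)) ≠ 0 := by
      have h1 := Submodule.finrank_add_eq_of_isCompl (hc q)
      have hne : kN q ≠ 0 := by
        intro h
        have := hk_unit q
        rw [h] at this
        simp at this
      rw [finrank_span_singleton hne] at h1
      have h2 : finrank ℝ (TangentSpace I q) = 3 := hE
      rw [lineSpan]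
      omega
    obtain ⟨v, hv, z, hz, h⟩ := exists_extDerivOne_ne_zero riemannian_smooth gN.symm
      riemannian_nondegenerate hk_smooth (hc q) (hpos q) hfr (hk_twisting q)
    exact ⟨v, z, mem_orthogonal_singleton.1 hv, mem_orthogonal_singleton.1 hz, h⟩

namespace IsTwistingField

lemma dualForm_smooth (h : IsTwistingField gN kN) : (dualForm gN kN).Smooth :=
  liftForm_smooth gN.contMDiff h.smooth

lemma extDerivOne_dualForm (h : IsTwistingField gN kN) (u v : TangentSpace (𝓘(ℝ, ℝ).prod I) p) :
    extDerivOne (dualForm gN kN) p u v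
      = extDerivOne (fun q ↦ gN.inner q (kN q)) p.2 (spaceProj p u) (spaceProj p v) :=
  extDerivOne_liftForm (OneForm.Smooth.of_twoTensor riemannian_smooth h.smooth)
    h.dualForm_smooth u v

/-- `dα` is pulled back from `N`, where `kN` lies in its kernel. This covers `k` (with `c = w⁻¹`)
and `∂_t` (with `c = 0`). -/
lemma extDerivOne_dualForm_eq_zero (h : IsTwistingField gN kN)
    {u : TangentSpace (𝓘(ℝ, ℝ).prod I) p} {c : ℝ} (hu : spaceProj p u = c • kN p.2)
    (v : TangentSpace (𝓘(ℝ, ℝ).prod I) p) : extDerivOne (dualForm gN kN) p u v = 0 := by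
  rw [h.extDerivOne_dualForm, hu, ← extDerivForm_apply
    (OneForm.Smooth.of_twoTensor riemannian_smooth h.smooth), map_smul, _root_.smul_apply,
    extDerivForm_apply, h.ext_k, smul_zero]

/-- The warped product with the fields `k = ∂_t + w⁻¹ kN` and `-∂_t` is an adapted system. -/
lemma isAdaptedSystem (h : IsTwistingField gN kN) (hE : finrank ℝ E = 3)
    (hws : ContDiff ℝ ∞ w) (hw : ∀ s, 0 < w s) :
    IsAdaptedSystem (warpedMetric w gN.inner) (nullField w kN) (-timeField)
      (coordForm w gN kN) (coordForm' w gN kN) (dualForm gN kN) := by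
  have hA : (coordForm w gN kN).Smooth :=
    h.dualForm_smooth.smul fun p ↦ contMDiffAt_comp_fst hws p
  refine ⟨warpedMetric_smooth hws, fun p u hu ↦ warpedMetric_nondegenerate hw u hu,
    nullField_smoothAt hws hw h.smooth, fun p ↦ (smoothAt_timeField p).contAt.neg, hA,
    hA.add (timeForm_smooth.smul contMDiff_const), h.dualForm_smooth,
    fun p v ↦ h.extDerivOne_dualForm_eq_zero (spaceProj_nullField kN) v,
    fun p v ↦ h.extDerivOne_dualForm_eq_zero (c := 0) (by simp [spaceProj_timeField]) v,
    fun p ↦ ?_⟩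
  obtain ⟨v, z, hv, hz, hvz⟩ := h.twist p.2
  obtain ⟨E₁, E₂, h₁, h₂, he⟩ := exists_orthonormalTriple riemannian_smooth gN.pos
    h.smooth h.unit hv hz hvz
  have hwi := contMDiffAt_comp_fst (I := I) (φ := fun s ↦ (w s)⁻¹)
    (hws.inv fun s ↦ (hw s).ne') p
  refine ⟨fun p ↦ (w p.1)⁻¹ • liftField E₁ p, fun p ↦ (w p.1)⁻¹ • liftField E₂ p,
    (smoothAt_liftField h₁).contAt.smul hwi, (smoothAt_liftField h₂).contAt.smul hwi, ?_⟩
  filter_upwards [(continuous_snd.continuousAt (x := p)).eventually he] with y hy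
  refine ⟨isAdaptedFrame_of_orthonormalTriple hw hE hy.1, ?_⟩
  rw [h.extDerivOne_dualForm, map_smul, map_smul, spaceProj_liftField, spaceProj_liftField,
    ← extDerivForm_apply (OneForm.Smooth.of_twoTensor riemannian_smooth h.smooth)]
  simp only [map_smul, _root_.smul_apply, smul_eq_mul]
  have := inv_pos.2 (hw y.1)
  exact mul_pos this (mul_pos this hy.2)

/-- Fields `a ∂_t + φ(t) kN` preserve the orthogonal complement of `k` and `∂_t`. -/
lemma mlieBracket_mem (h : IsTwistingField gN kN) (hw : ∀ s, 0 < w s) {φ : ℝ → ℝ}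
    (hφ : ContDiff ℝ ∞ φ) (a : ℝ) {X : VField (𝓘(ℝ, ℝ).prod I) (ℝ × N)} (hX : X.SmoothAt p)
    (hXH : ∀ᶠ y in 𝓝 p, X y ∈ (warpedMetric w gN.inner y).toBilinForm.orthogonal
      (pairSpan (nullField w kN) (-timeField) y)) :
    mlieBracket (𝓘(ℝ, ℝ).prod I) (productField a φ kN) X p ∈
      (warpedMetric w gN.inner p).toBilinForm.orthogonal
        (pairSpan (nullField w kN) (-timeField) p) := by
  simp only [mem_orthogonal_pairSpan hw] at hXH ⊢
  have hZ : VField.SmoothAt (productField a φ kN) p :=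
    ((smoothAt_timeField p).contAt.smul (contMDiffAt_const (c := a))).add
      ((smoothAt_liftField (h.smooth p.2)).contAt.smul (contMDiffAt_comp_fst hφ p))
  have hZs (y : ℝ × N) : spaceProj y (productField a φ kN y) = φ y.1 • kN y.2 := by
    simp [productField, spaceProj_timeField, spaceProj_liftField]
  constructor
  · have h1 (y : ℝ × N) : timeForm y (productField a φ kN y) = a := by
      simp [productField, timeForm_timeField, timeForm_liftField]
    -- `dt([Z, X]) = Z(dt(X)) - X(dt(Z))`, where `dt(X) = 0` near `p` and `dt(Z) = a` is constant.
    rw [timeForm_mlieBracket hZ hX, dirDeriv_congr (hXH.mono fun y hy ↦ hy.1)]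
    simp only [h1, dirDeriv_const, sub_self]
  · have h2 (y : ℝ × N) : dualForm gN kN y (productField a φ kN y) = φ y.1 := by
      rw [liftForm_apply, hZs, map_smul, h.unit, smul_eq_mul, mul_one]
    -- Since `dα(Z, X) = 0` and `α(X) = 0` near `p`, the invariant formula leaves `α([Z, X]) =
    -- -X(φ(t)) = -φ' dt(X) = 0`.
    have h3 := extDerivOne_eq h.dualForm_smooth hZ.diffAt hX.diffAt
    rw [h.extDerivOne_dualForm_eq_zero (hZs p), dirDeriv_congr (hXH.mono fun y hy ↦ hy.2),
      dirDeriv_const] at h3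
    simp only [h2] at h3
    rw [dirDeriv_comp_fst (hφ.differentiable (by simp)).differentiableAt,
      hXH.self_of_nhds.1] at h3
    linarith

/-- The flows of fields `a ∂_t + φ(t) kN` are conformal on the orthogonal complement of `k` and
`∂_t`. -/
lemma exists_lieForm_eq (h : IsTwistingField gN kN) (hws : ContDiff ℝ ∞ w) (hw : ∀ s, 0 < w s)
    {φ : ℝ → ℝ} (hφ : ContDiff ℝ ∞ φ) (a : ℝ) (p : ℝ × N) :
    ∃ c : ℝ, ∀ v ∈ (warpedMetric w gN.inner p).toBilinForm.orthogonal
      (pairSpan (nullField w kN) (-timeField) p),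
      ∀ z ∈ (warpedMetric w gN.inner p).toBilinForm.orthogonal
        (pairSpan (nullField w kN) (-timeField) p),
      lieForm (warpedMetric w gN.inner) (productField a φ kN) p v z
        = c * warpedMetric w gN.inner p v z := by
  obtain ⟨c, hc⟩ := h.conformal p.2
  -- On `H` the Lie derivative is `(2 a w w' + w² φ c) gN`, and `g` is `w² gN`; the constant is the
  -- quotient.
  refine ⟨2 * a * deriv w p.1 / w p.1 + φ p.1 * c, fun v hv z hz ↦ ?_⟩
  rw [mem_orthogonal_pairSpan hw] at hv hz
  rw [lieForm_warpedMetric hws hφ a h.smooth hv.1 hz.1,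
    hc (spaceProj p v) (spaceProj p z) hv.2 hz.2, warpedMetric_apply, hv.1]
  have := (hw p.1).ne'
  field_simp
  ring

/-- The exterior derivative of `e^t k^♭`. -/
lemma extDerivOne_exp_smul (h : IsTwistingField gN kN) (hws : ContDiff ℝ ∞ w)
    (hw : ∀ s, 0 < w s) (u v : TangentSpace (𝓘(ℝ, ℝ).prod I) p) :
    extDerivOne (fun y ↦ Real.exp y.1 • warpedMetric w gN.inner y (nullField w kN y)) p u v
      = Real.exp p.1 * (1 + deriv w p.1 / w p.1) *
          (coordForm w gN kN p u * coordForm' w gN kN p v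
            - coordForm' w gN kN p u * coordForm w gN kN p v)
        + Real.exp p.1 * w p.1 * extDerivOne (dualForm gN kN) p u v := by
  have hwd : DifferentiableAt ℝ w p.1 := (hws.differentiable (by simp)).differentiableAt
  -- From `k^♭ = w α - dt`. The second summand is closed, being a function of `t` times `dt`.
  have e : (fun y ↦ Real.exp y.1 • warpedMetric w gN.inner y (nullField w kN y))
      = fun y : ℝ × N ↦ (Real.exp y.1 * w y.1) • dualForm gN kN y
        + (- Real.exp y.1) • timeForm y := by
    ext y u
    simp only [_root_.smul_apply, _root_.add_apply, smul_eq_mul, warpedMetric_nullField hw,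
      liftForm_apply]
    ring
  have s1 (p : ℝ × N) := contMDiffAt_comp_fst (I := I) (φ := fun s ↦ Real.exp s * w s)
    (Real.contDiff_exp.mul hws) p
  have s2 (p : ℝ × N) := contMDiffAt_comp_fst (I := I) (φ := fun s ↦ -Real.exp s)
    Real.contDiff_exp.neg p
  have d1 (u : TangentSpace (𝓘(ℝ, ℝ).prod I) p) :
      mvfderiv (𝓘(ℝ, ℝ).prod I) (fun y : ℝ × N ↦ Real.exp y.1 * w y.1) p u
        = Real.exp p.1 * (w p.1 + deriv w p.1) * timeForm p u := by
    have := dirDeriv_comp_fst (φ := fun s ↦ Real.exp s * w s) (p := p)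
      (Real.differentiableAt_exp.mul hwd) (FiberBundle.extend (ℝ × E) u)
    rw [deriv_fun_mul Real.differentiableAt_exp hwd, Real.deriv_exp] at this
    simp only [dirDeriv, FiberBundle.extend_apply_self] at this
    rw [this]
    ring
  have d2 (u : TangentSpace (𝓘(ℝ, ℝ).prod I) p) :
      mvfderiv (𝓘(ℝ, ℝ).prod I) (fun y : ℝ × N ↦ -Real.exp y.1) p u
        = -Real.exp p.1 * timeForm p u := by
    have := dirDeriv_comp_fst (φ := fun s ↦ -Real.exp s) (p := p)
      Real.differentiableAt_exp.neg (FiberBundle.extend (ℝ × E) u)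
    rw [deriv.fun_neg, Real.deriv_exp] at this
    simpa only [dirDeriv, FiberBundle.extend_apply_self] using this
  have h0 : extDerivOne (timeForm (I := I) (N := N)) p u v = 0 :=
    extDerivOne_mvfderiv contMDiffAt_fst u v
  -- The Leibniz rule gives `e^t (w + w') dt ∧ α + e^t w dα`, and `A ∧ B = w dt ∧ α`.
  rw [e, extDerivOne_add (h.dualForm_smooth.smul s1) (timeForm_smooth.smul s2),
    extDerivOne_smul h.dualForm_smooth ((s1 p).mdifferentiableAt (by simp)),
    extDerivOne_smul timeForm_smooth ((s2 p).mdifferentiableAt (by simp)), d1, d1, d2, d2, h0,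
    coordForm_apply, coordForm_apply, coordForm'_apply, coordForm'_apply, liftForm_apply,
    liftForm_apply]
  have := (hw p.1).ne'
  field_simp
  ring

lemma isAdmissible_and_exists (h : IsTwistingField gN kN) (hE : finrank ℝ E = 3)
    (hws : ContDiff ℝ ∞ w) (hw : ∀ s, 0 < w s) (hw' : ∀ s, -1 < deriv w s / w s) :
    ∃ o : ManifoldOrientation (𝓘(ℝ, ℝ).prod I) (ℝ × N),
      IsAdmissible (warpedMetric w gN.inner) o (nullField w kN)
        (grad (warpedMetric w gN.inner) Prod.fst) ∧
      ∃ h : Bundle.ContMDiffRiemannianMetric (𝓘(ℝ, ℝ).prod I) ∞ (ℝ × E)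
          (fun p : ℝ × N ↦ TangentSpace (𝓘(ℝ, ℝ).prod I) p),
        IsInducedKahlerMetric (warpedMetric w gN.inner) o (nullField w kN)
          (grad (warpedMetric w gN.inner) Prod.fst) Prod.fst Real.exp h := by
  have hgrad : grad (warpedMetric w gN.inner) Prod.fst = -timeField := funext (grad_fst hw)
  have hS := h.isAdaptedSystem hE hws hw
  have hwi : ContDiff ℝ ∞ fun s ↦ (w s)⁻¹ := hws.inv fun s ↦ (hw s).ne'
  have hbr (p : ℝ × N) (X : VField (𝓘(ℝ, ℝ).prod I) (ℝ × N)) (hX : X.SmoothAt p)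
      (hXH : ∀ᶠ y in 𝓝 p, X y ∈ (warpedMetric w gN.inner y).toBilinForm.orthogonal
        (pairSpan (nullField w kN) (-timeField) y)) :
      mlieBracket (𝓘(ℝ, ℝ).prod I) (nullField w kN) X p ∈
        (warpedMetric w gN.inner p).toBilinForm.orthogonal
          (pairSpan (nullField w kN) (-timeField) p) ∧
      mlieBracket (𝓘(ℝ, ℝ).prod I) (-timeField) X p ∈
        (warpedMetric w gN.inner p).toBilinForm.orthogonal
          (pairSpan (nullField w kN) (-timeField) p) := by
    have h1 := h.mlieBracket_mem hw hwi 1 hX hXH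
    have h2 := h.mlieBracket_mem hw (contDiff_const (c := 0)) (-1) hX hXH
    rw [← nullField_eq] at h1
    rw [← neg_timeField_eq] at h2
    exact ⟨h1, h2⟩
  have hck (p : ℝ × N) := h.exists_lieForm_eq hws hw hwi 1 p
  have hct (p : ℝ × N) := h.exists_lieForm_eq hws hw (contDiff_const (c := 0)) (-1) p
  rw [← nullField_eq] at hck
  rw [← neg_timeField_eq] at hct
  -- This is where `w'/w > -1` is used: it makes the metric positive on the span of `k` and `∂_t`.
  have hc (p : ℝ × N) : 0 < Real.exp p.1 * (1 + deriv w p.1 / w p.1) :=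
    mul_pos (Real.exp_pos _) (by linarith [hw' p.1])
  have hd (p : ℝ × N) : 0 < Real.exp p.1 * w p.1 := mul_pos (Real.exp_pos _) (hw p.1)
  have hβ (p : ℝ × N) (u v) := h.extDerivOne_exp_smul (p := p) hws hw u v
  have hβs : OneForm.Smooth (fun y : ℝ × N ↦
      Real.exp y.1 • warpedMetric w gN.inner y (nullField w kN y)) :=
    (OneForm.Smooth.of_twoTensor (warpedMetric_smooth hws) hS.smooth_k).smul fun p ↦
      contMDiffAt_comp_fst Real.contDiff_exp p
  -- `g(k, ∇t)` and `g(k, k)` are constant, so their gradients vanish and lie trivially in the span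
  -- of `k` and `∇t`.
  have hkt (y : ℝ × N) : warpedMetric w gN.inner y (nullField w kN y) ((-timeField) y) = 1 := by
    rw [warpedMetric_nullField hw]
    simp [timeForm_timeField, spaceProj_timeField]
  have hkk (y : ℝ × N) : warpedMetric w gN.inner y (nullField w kN y) (nullField w kN y) = 0 := by
    have := (hw y.1).ne'
    rw [warpedMetric_nullField hw, timeForm_nullField, spaceProj_nullField, map_smul, h.unit]
    simp [this]
  refine ⟨hS.orientation, ?_, hS.kahlerMetric hβs hc hd hβ, ?_⟩
  · refine ⟨by simp [hE], ⟨1, isLorentzianMetric_warpedMetric hws hw⟩, hS.smooth_k, ?_, ?_,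
      ⟨Prod.fst, fun _ ↦ 1, contMDiff_fst, contMDiff_const, fun p ↦ (one_smul ℝ _).symm⟩, ?_, ?_⟩
    · rw [hgrad]; exact hS.smooth_t
    · rw [hgrad]; exact hS.isAdmissibleComplexStructure hbr hck hct
    · intro p
      simp only [hgrad, hkt, grad_const hw]
      exact zero_mem _
    · intro p
      simp only [hkk, grad_const hw]
      exact zero_mem _
  · rw [hgrad]
    exact ⟨fun _ _ _ ↦ rfl, hS.isKahlerMetric hβs hc hd hβ
      (hS.isComplexStructure hbr hck hct)⟩

end IsTwistingField

end MainConstruction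

end LorentzKahler

end

theorem mainTheorem5
    {N : Type*} [TopologicalSpace N] [ChartedSpace (EuclideanSpace ℝ (Fin 3)) N]
    [IsManifold (𝓡 3) ∞ N]
    (gN : Bundle.ContMDiffRiemannianMetric (𝓡 3) ∞ (EuclideanSpace ℝ (Fin 3))
      (fun q : N ↦ TangentSpace (𝓡 3) q))
    (kN : LorentzKahler.VField (𝓡 3) N)
    (hk_smooth : ∀ q, kN.SmoothAt q)
    (hk_unit : ∀ q, gN.inner q (kN q) (kN q) = 1)
    (hk_geodesic : LorentzKahler.IsGeodesic gN.inner kN)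
    (hk_shearFree : ∀ q, LorentzKahler.shear gN.inner (LorentzKahler.lineSpan kN) kN q = 0)
    (hk_twisting : ∀ q,
      LorentzKahler.twistFunction gN.inner (LorentzKahler.lineSpan kN) kN q ≠ 0)
    (w : ℝ → ℝ) (hw_smooth : ContDiff ℝ ∞ w) (hw_pos : ∀ s, 0 < w s)
    (hw : ∀ s, -1 < deriv w s / w s) :
    let g := LorentzKahler.warpedMetric w gN.inner
    let k : LorentzKahler.VField (𝓘(ℝ, ℝ).prod (𝓡 3)) (ℝ × N) := fun p ↦
      LorentzKahler.timeField p + (w p.1)⁻¹ • LorentzKahler.liftField kN p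
    let t := LorentzKahler.grad g (Prod.fst : ℝ × N → ℝ)
    LorentzKahler.IsLorentzianMetric g ∧
    ∃ o : LorentzKahler.ManifoldOrientation (𝓘(ℝ, ℝ).prod (𝓡 3)) (ℝ × N),
      LorentzKahler.IsAdmissible g o k t ∧
      ∃ h : Bundle.ContMDiffRiemannianMetric (𝓘(ℝ, ℝ).prod (𝓡 3)) ∞
          (ℝ × EuclideanSpace ℝ (Fin 3))
          (fun p : ℝ × N ↦ TangentSpace (𝓘(ℝ, ℝ).prod (𝓡 3)) p),
        LorentzKahler.IsInducedKahlerMetric g o k t Prod.fst Real.exp h := by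
  intro g k t
  have hE : Module.finrank ℝ (EuclideanSpace ℝ (Fin 3)) = 3 := by simp
  exact ⟨LorentzKahler.isLorentzianMetric_warpedMetric hw_smooth hw_pos,
    (LorentzKahler.isTwistingField hE hk_smooth hk_unit hk_geodesic hk_shearFree
      hk_twisting).isAdmissible_and_exists hE hw_smooth hw_pos hw⟩
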